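/- Fix integers $k,n\ge 0$. **Pairings.** A $(k,n)$-partial non-crossing pairing is a pair $(\tau,T)$, where $\tau$ is a matching of a subset $S\subseteq[n]=\{1,\dots,n\}$ such that, with $1,\dots,n$ placed in order on a circle and the edges of $\tau$ drawn inside it as chords, no two edges cross, and $T\subseteq[n]\setminus S$ satisfies $|S|+2|T|=2k$. Let $\mathcal A_{k,n}$ be the set of these pairs. **Coordinate ring.** Let $\mathbb C[\mathrm{Gr}(k,n)]$ be the homogeneous coordinate ring of the Grassmannian in its Plücker embedding: the polynomial ring in variables $\Delta_I$, $I\in\binom{[n]}{k}$, modulo the polynomials that vanish on the affine cone $\widetilde{\mathrm{Gr}}(k,n)$ of all multiples of vectors of maximal minors of complex $k\times n$ matrices. **Networks.** Let $N$ be a finite bipartite graph (parallel edges allowed), properly coloured black and white, embedded in the closed disk, with nonnegative real edge weights and with $n$ boundary vertices labelled $1,\dots,n$ clockwise; all boundary vertices have degree one, and no edge joins two of them. Say that $N$ has rank $k$ if $k$ is the number of white boundary vertices plus the number of interior white vertices minus the number of interior black vertices. A dimer configuration $\Pi$ of $N$ is a set of edges using every interior vertex exactly once; $I(\Pi)\subseteq[n]$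 is the set of used black boundary vertices and unused white boundary vertices. The boundary measurement $\Delta_I(N)$ is the sum over $\Pi$ with $I(\Pi)=I$ of the product of the weights of the edges of $\Pi$, and $\widetilde M(N)=(\Delta_I(N))_{I\in\binom{[n]}{k}}$. **Temperley–Lieb immanants.** A Temperley–Lieb subgraph $\Sigma$ of $N$ is a subgraph using every interior vertex, each of whose connected components is a path between two boundary vertices, a cycle through interior vertices, or a single edge. Its weight $\mathrm{wt}(\Sigma)$ is $2^{\#\text{cycles}}$ times the product of the weights of its edges, where the weight of an edge that is a component by itself is squared. For $(\tau,T)\in\mathcal A_{k,n}$ let $F_{\tau,T}(N)=\sum_\Sigma\mathrm{wt}(\Sigma)$, the sum being over those $\Sigma$ whose paths pair the boundary vertices according to $\tau$, and for which $T$ consists of the black boundary vertices lying on a single-edge component of $\Sigma$ and the white boundary vertices not used in $\Sigma$. **Statement.** For every network $N$ of rank $k$ one has $\widetilde M(N)\in\widetilde{\mathrm{Gr}}(k,n)$. For every $(\tau,T)\in\mathcal A_{k,n}$ there is exactly one element $F_{\tau,T}$ of the degree-two part of $\mathbb C[\mathrm{Gr}(k,n)]$ whose value at $\widetilde M(N)$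 is $F_{\tau,T}(N)$ for all networks $N$ of rank $k$ with $n$ boundary vertices. The family $(F_{\tau,T})_{(\tau,T)\in\mathcal A_{k,n}}$ is a basis of the degree-two part of $\mathbb C[\mathrm{Gr}(k,n)]$. In particular, $|\mathcal A_{k,n}|$ equals the number of semistandard tableaux of shape $2^k$ ($k$ rows of length two) with entries in $\{1,\dots,n\}$. -/

import Mathlib

/-! ### Partial non-crossing pairings -/

/-- A `(k,n)`-partial non-crossing pairing `(τ, T)`.  The matching `τ` is recorded by the involution
`partner` of `Fin n` that exchanges the two ends of every edge of `τ` and fixes the unmatched points.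
Two chords `{a, partner a}`, `{b, partner b}` of a circle cross exactly when their ends alternate. -/
@[ext]
structure PartialNCPairing (k n : ℕ) where
  partner : Fin n → Fin n
  T : Finset (Fin n)
  involutive : Function.Involutive partner
  noncrossing : ∀ a b : Fin n, ¬ (a < b ∧ b < partner a ∧ partner a < partner b)
  disjoint : ∀ i ∈ T, partner i = i
  size : (Finset.univ.filter fun i => partner i ≠ i).card + 2 * T.card = 2 * k

instance (k n : ℕ) : Finite (PartialNCPairing k n) :=
  Finite.of_injective (fun p : PartialNCPairing k n => (p.partner, p.T)) (by
    intro p q h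
    simp only [Prod.mk.injEq] at h
    exact PartialNCPairing.ext h.1 h.2)

/-! ### The homogeneous coordinate ring of the Grassmannian -/

/-- The `k`-element subsets of `Fin n`, indexing the Plücker coordinates. -/
abbrev PluckerIndex (k n : ℕ) : Type := {I : Finset (Fin n) // I.card = k}

/-- The maximal minor of a `k × n` matrix in the columns `I` (in increasing order). -/
noncomputable def maximalMinor {k n : ℕ} (A : Matrix (Fin k) (Fin n) ℂ) (I : PluckerIndex k n) : ℂ :=
  (A.submatrix id (I.1.orderEmbOfFin I.2)).det

/-- The affine cone over `Gr(k,n)` in its Plücker embedding: all multiples of vectors of maximal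
minors of complex `k × n` matrices (a matrix of rank less than `k` contributes the origin). -/
def pluckerCone (k n : ℕ) : Set (PluckerIndex k n → ℂ) :=
  {x | ∃ (c : ℂ) (A : Matrix (Fin k) (Fin n) ℂ), ∀ I, x I = c * maximalMinor A I}

/-- The homogeneous coordinate ring of `Gr(k,n)` in the Plücker embedding: polynomials in the
Plücker coordinates modulo those that vanish on the cone over the Grassmannian. -/
abbrev GrCoordinateRing (k n : ℕ) : Type :=
  MvPolynomial (PluckerIndex k n) ℂ ⧸ MvPolynomial.vanishingIdeal ℂ (pluckerCone k n)

/-- The degree `d` part of the homogeneous coordinate ring. -/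
noncomputable def grDegreePart (k n d : ℕ) : Submodule ℂ (GrCoordinateRing k n) :=
  (MvPolynomial.homogeneousSubmodule (PluckerIndex k n) ℂ d).map
    (Ideal.Quotient.mkₐ ℂ (MvPolynomial.vanishingIdeal ℂ (pluckerCone k n))).toLinearMap

/-- Evaluation of an element of the homogeneous coordinate ring at a point of the cone. -/
noncomputable def grEval {k n : ℕ} (x : PluckerIndex k n → ℂ) (hx : x ∈ pluckerCone k n) :
    GrCoordinateRing k n →ₐ[ℂ] ℂ :=
  Ideal.Quotient.liftₐ _ (MvPolynomial.aeval x) fun _ ha => ha x hx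

/-! ### Planar bipartite networks in the disk -/

/-- A weighted planar bipartite network embedded in the closed unit disk of `ℂ`, with boundary
vertices labelled by `Fin n` in clockwise order.  The vertices are `V ⊕ Fin n`: `Sum.inl v` is an
interior vertex and `Sum.inr i` is the `i`-th boundary vertex.  Parallel edges are allowed. -/
structure DiskNetwork (n : ℕ) where
  V : Type
  E : Type
  fintypeV : Fintype V
  fintypeE : Fintype E
  /-- `white u = true` when `u` is white, `white u = false` when `u` is black. -/
  white : V ⊕ Fin n → Bool
  blackEnd : E → V ⊕ Fin n
  whiteEnd : E → V ⊕ Fin n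
  blackEnd_color : ∀ e, white (blackEnd e) = false
  whiteEnd_color : ∀ e, white (whiteEnd e) = true
  weight : E → ℝ
  weight_nonneg : ∀ e, 0 ≤ weight e
  /-- Every boundary vertex has degree one. -/
  boundary_degree : ∀ i : Fin n, ∃! e, blackEnd e = Sum.inr i ∨ whiteEnd e = Sum.inr i
  /-- No edge joins two boundary vertices. -/
  boundary_not_adjacent : ∀ e (i j : Fin n), ¬ (blackEnd e = Sum.inr i ∧ whiteEnd e = Sum.inr j)
  /-- The position of each vertex in the disk. -/
  pos : V ⊕ Fin n → ℂ
  pos_injective : Function.Injective pos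
  interior_pos : ∀ v : V, ‖pos (Sum.inl v)‖ < 1
  /-- The boundary vertices lie on the unit circle in clockwise order: they have arguments
  `angle 0 > angle 1 > ... > angle (n-1)`, all within one turn. -/
  angle : Fin n → ℝ
  angle_strictAnti : StrictAnti angle
  angle_lt : ∀ i j, angle i < angle j + 2 * Real.pi
  boundary_pos : ∀ i : Fin n, pos (Sum.inr i) = Complex.exp (angle i * Complex.I)
  /-- The simple curve in the disk along which each edge is drawn. -/
  arc : ∀ e, Path (pos (blackEnd e)) (pos (whiteEnd e))
  arc_injective : ∀ e, Function.Injective (arc e)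
  arc_interior : ∀ e, ∀ t ∈ Set.Ioo (0 : unitInterval) 1, ‖arc e t‖ < 1
  arc_avoids_vertices : ∀ e u, ∀ t ∈ Set.Ioo (0 : unitInterval) 1, arc e t ≠ pos u
  arc_disjoint : ∀ e f, e ≠ f → ∀ s ∈ Set.Ioo (0 : unitInterval) 1,
    ∀ t ∈ Set.Ioo (0 : unitInterval) 1, arc e s ≠ arc f t

attribute [instance] DiskNetwork.fintypeV DiskNetwork.fintypeE

namespace DiskNetwork

variable {n : ℕ} (N : DiskNetwork n)

def Incident (e : N.E) (u : N.V ⊕ Fin n) : Prop := N.blackEnd e = u ∨ N.whiteEnd e = u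

/-- The edge `e` has ends `u` and `v`. -/
def Joins (e : N.E) (u v : N.V ⊕ Fin n) : Prop :=
  (N.blackEnd e = u ∧ N.whiteEnd e = v) ∨ (N.blackEnd e = v ∧ N.whiteEnd e = u)

/-- `k` equals the number of white boundary vertices, plus the number of interior white vertices,
minus the number of interior black vertices. -/
def HasRank (k : ℕ) : Prop :=
  (k : ℤ) = ((Finset.univ.filter fun i : Fin n => N.white (Sum.inr i) = true).card : ℤ)
    + ((Finset.univ.filter fun v : N.V => N.white (Sum.inl v) = true).card : ℤ)
    - ((Finset.univ.filter fun v : N.V => N.white (Sum.inl v) = false).card : ℤ)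

/-- A dimer configuration: every interior vertex is used exactly once. -/
def IsDimer (P : Finset N.E) : Prop := ∀ v : N.V, ∃! e, e ∈ P ∧ N.Incident e (Sum.inl v)

/-- The boundary vertex `i` is used by the set of edges `P`. -/
def UsesBoundary (P : Finset N.E) (i : Fin n) : Prop := ∃ e ∈ P, N.Incident e (Sum.inr i)

open Classical in
/-- The boundary subset: used black boundary vertices and unused white boundary vertices. -/
noncomputable def boundarySubset (P : Finset N.E) : Finset (Fin n) :=
  Finset.univ.filter fun i =>
    (N.white (Sum.inr i) = false ∧ N.UsesBoundary P i) ∨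
      (N.white (Sum.inr i) = true ∧ ¬ N.UsesBoundary P i)

open Classical in
/-- The boundary measurement `Δ_I(N)`. -/
noncomputable def boundaryMeasurement (I : Finset (Fin n)) : ℝ :=
  ∑ P ∈ Finset.univ.filter (fun P : Finset N.E => N.IsDimer P ∧ N.boundarySubset P = I),
    ∏ e ∈ P, N.weight e

/-- The vector of boundary measurements indexed by the `k`-element subsets. -/
noncomputable def boundaryVector (k : ℕ) : PluckerIndex k n → ℂ :=
  fun I => (N.boundaryMeasurement I.1 : ℂ)

/-! ### Temperley-Lieb subgraphs -/

/-- Two edges of `S` that share a vertex. -/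
def Touch (S : Finset N.E) (e f : N.E) : Prop :=
  e ∈ S ∧ f ∈ S ∧ ∃ u, N.Incident e u ∧ N.Incident f u

open Classical in
/-- The edge sets of the connected components of the subgraph with edge set `S`. -/
noncomputable def components (S : Finset N.E) : Finset (Finset N.E) :=
  S.image fun e => S.filter fun f => Relation.ReflTransGen (N.Touch S) e f

/-- `C` is the edge set of a path from the boundary vertex `i` to the boundary vertex `j`. -/
def IsBoundaryPath (C : Finset N.E) (i j : Fin n) : Prop :=
  ∃ (m : ℕ) (v : Fin (m + 2) → N.V ⊕ Fin n) (e : Fin (m + 1) → N.E),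
    Function.Injective v ∧ v 0 = Sum.inr i ∧ v (Fin.last (m + 1)) = Sum.inr j ∧
    (∀ r, N.Joins (e r) (v r.castSucc) (v r.succ)) ∧ ∀ f, f ∈ C ↔ ∃ r, e r = f

/-- `C` is the edge set of a cycle (of length at least two) through interior vertices. -/
def IsInteriorCycle (C : Finset N.E) : Prop :=
  ∃ (m : ℕ) (v : Fin (m + 2) → N.V) (e : Fin (m + 2) → N.E),
    Function.Injective v ∧ Function.Injective e ∧
    (∀ r, N.Joins (e r) (Sum.inl (v r)) (Sum.inl (v (r + 1)))) ∧ ∀ f, f ∈ C ↔ ∃ r, e r = f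

/-- A Temperley-Lieb subgraph: each component is a path between boundary vertices, an interior
cycle or a single edge, and every interior vertex is used. -/
def IsTLSubgraph (S : Finset N.E) : Prop :=
  (∀ C ∈ N.components S, (∃ i j, N.IsBoundaryPath C i j) ∨ N.IsInteriorCycle C ∨ ∃ e, C = {e}) ∧
    ∀ v : N.V, ∃ e ∈ S, N.Incident e (Sum.inl v)

/-- The paths of `S` pair the boundary vertices as `τ` does; and `T` consists of the black boundary
vertices used twice (those on a component that is a single edge) and the unused white ones. -/
def HasPairing {k : ℕ} (S : Finset N.E) (p : PartialNCPairing k n) : Prop :=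
  (∀ i j : Fin n, (i ≠ j ∧ p.partner i = j) ↔ ∃ C ∈ N.components S, N.IsBoundaryPath C i j) ∧
  (∀ i : Fin n, i ∈ p.T ↔
    (N.white (Sum.inr i) = false ∧ ∃ e, {e} ∈ N.components S ∧ N.Incident e (Sum.inr i)) ∨
      (N.white (Sum.inr i) = true ∧ ¬ N.UsesBoundary S i))

open Classical in
/-- The weight of a component: the square of the edge weight for a single edge, twice the product
of the edge weights for a cycle, the product of the edge weights for a path. -/
noncomputable def componentWeight (C : Finset N.E) : ℝ :=
  if C.card = 1 then (∏ e ∈ C, N.weight e) ^ 2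
  else if N.IsInteriorCycle C then 2 * ∏ e ∈ C, N.weight e
  else ∏ e ∈ C, N.weight e

/-- The weight of a Temperley-Lieb subgraph. -/
noncomputable def tlWeight (S : Finset N.E) : ℝ := ∏ C ∈ N.components S, N.componentWeight C

open Classical in
/-- The Temperley-Lieb immanant `F_{τ,T}(N)`. -/
noncomputable def tlImmanant {k : ℕ} (p : PartialNCPairing k n) : ℝ :=
  ∑ S ∈ Finset.univ.filter (fun S : Finset N.E => N.IsTLSubgraph S ∧ N.HasPairing S p), N.tlWeight S

end DiskNetwork

/-! ### Semistandard tableaux of shape `2^k` -/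

/-- The Young diagram with `k` rows of length two. -/
def twoColumnDiagram (k : ℕ) : YoungDiagram where
  cells := Finset.range k ×ˢ Finset.range 2
  isLowerSet := by
    rintro ⟨a, b⟩ ⟨c, d⟩ hle hab
    simp only [Prod.mk_le_mk] at hle
    simp only [Finset.coe_product, Finset.coe_range, Set.mem_prod, Set.mem_Iio] at hab ⊢
    omega

/-- Semistandard tableaux of shape `2^k` with entries in `{1, ..., n}`. -/
abbrev TwoColumnTableau (k n : ℕ) : Type :=
  {t : SemistandardYoungTableau (twoColumnDiagram k) //
    ∀ i j, (i, j) ∈ twoColumnDiagram k → 1 ≤ t i j ∧ t i j ≤ n}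

/-! Superimpose two dimer configurations with boundary subsets `I` and `J`. Their union is a
Temperley–Lieb subgraph, and planarity makes its paths pair the boundary vertices without crossings.
Conversely a Temperley–Lieb subgraph splits into two configurations component by component. A cycle
splits in two ways and an isolated edge in one; a path splits in two ways, of which `I` and `J`
select one. Hence `Δ_I Δ_J` is the sum of the `F_{τ,T}` over the pairings compatible with `(I, J)`,
which means that `T = I ∩ J` and that every chord joins `I \ J` to `J \ I`
(`boundaryMeasurement_mul`).

For a fixed pairing, the indicator of compatibility satisfies the quadratic Plücker relations in
`(I, J)`: exchanging a point and exchanging its partner give terms of opposite sign, because as many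
points of `I` as of `J` lie between the ends of a chord (`isExchange_compat`). So boundary
measurements satisfy the Plücker relations, and solutions of these relations lie in the cone
(`mem_pluckerCone_of_isExchange`).

A pairing is determined by its sets of larger and of smaller chord ends, each enlarged by `T`; these
pairs of sets are exactly the columns of semistandard tableaux, which gives the count. On these
standard pairs the compatibility matrix is triangular with ones on the diagonal, and its inverse
defines the immanants as elements of the ring. A function of `(I, J)` that satisfies the exchange
relations and vanishes on standard pairs is zero (`IsExchange.eq_zero_of_isStandardPair`). Therefore
the product formula holds in the coordinate ring (`pluckerCoord_mul`), and the immanants span.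

Independence and uniqueness come from one explicit network per pairing, drawn with chords and short
radial segments. The values of the standard monomials at these networks form a triangular matrix
with nonzero diagonal (`eq_zero_of_sum_measurement`), so these networks separate elements of degree
two. -/

/-! ### Plücker relations and the cone over the Grassmannian. -/

section Minors

variable {n k : ℕ}

/-- The number of elements of `s` below `a`. -/
def posIn {α : Type*} [LinearOrder α] (s : Finset α) (a : α) : ℕ := (s.filter (· < a)).card

theorem posIn_orderEmbOfFin (s : Finset (Fin n)) (h : s.card = k) (j : Fin k) :
    posIn s (s.orderEmbOfFin h j) = j := by
  have : s.filter (· < s.orderEmbOfFin h j) =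
      (Finset.Iio j).map (s.orderEmbOfFin h).toEmbedding := by
    ext x
    simp only [Finset.mem_filter, Finset.mem_map, Finset.mem_Iio]
    constructor
    · rintro ⟨hx, hlt⟩
      rw [← Finset.image_orderEmbOfFin_univ s h] at hx
      obtain ⟨i, -, rfl⟩ := Finset.mem_image.1 hx
      exact ⟨i, by simpa using hlt, rfl⟩
    · rintro ⟨i, hi, rfl⟩
      exact ⟨Finset.orderEmbOfFin_mem s h i, by simpa using hi⟩
  rw [posIn, this, Finset.card_map, Fin.card_Iio]

theorem sum_eq_sum_orderEmbOfFin (s : Finset (Fin n)) (h : s.card = k) (f : Fin n → ℂ) :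
    ∑ a ∈ s, f a = ∑ j, f (s.orderEmbOfFin h j) := by
  have := Finset.sum_map Finset.univ (s.orderEmbOfFin h).toEmbedding f
  rwa [Finset.map_orderEmbOfFin_univ] at this

theorem orderEmbOfFin_erase (s : Finset (Fin n)) (h : s.card = k + 1) (j : Fin (k + 1))
    (h' : (s.erase (s.orderEmbOfFin h j)).card = k) :
    ⇑((s.erase (s.orderEmbOfFin h j)).orderEmbOfFin h') = s.orderEmbOfFin h ∘ j.succAbove := by
  symm
  apply Finset.orderEmbOfFin_unique
  · intro x
    simp [Fin.succAbove_ne]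
  · exact (s.orderEmbOfFin h).strictMono.comp (Fin.strictMono_succAbove j)

/-- The maximal minor in the columns `I`, extended by zero to all subsets of the columns. -/
noncomputable def minorOn (A : Matrix (Fin k) (Fin n) ℂ) (I : Finset (Fin n)) : ℂ :=
  if h : I.card = k then maximalMinor A ⟨I, h⟩ else 0

theorem minorOn_eq_det (A : Matrix (Fin k) (Fin n) ℂ) (I : Finset (Fin n)) (h : I.card = k) :
    minorOn A I = (A.submatrix id (I.orderEmbOfFin h)).det := by
  simp [minorOn, h, maximalMinor]

/-- Laplace expansion of a determinant in which row `r` occurs twice. -/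
theorem sum_row_mul_minorOn_erase (A : Matrix (Fin k) (Fin n) ℂ) (K : Finset (Fin n))
    (hK : K.card = k + 1) (r : Fin k) :
    ∑ a ∈ K, (-1) ^ posIn K a * (A r a * minorOn A (K.erase a)) = 0 := by
  set M : Matrix (Fin (k + 1)) (Fin (k + 1)) ℂ :=
    Matrix.of fun i j => (Fin.cons (A r) A : Fin (k + 1) → Fin n → ℂ) i (K.orderEmbOfFin hK j)
  have h0 : M.det = 0 := by
    apply Matrix.det_zero_of_row_eq (Fin.succ_ne_zero r).symm
    ext j
    rfl
  rw [Matrix.det_succ_row_zero] at h0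
  rw [sum_eq_sum_orderEmbOfFin K hK, ← h0]
  refine Finset.sum_congr rfl fun j _ => ?_
  have hc : (K.erase (K.orderEmbOfFin hK j)).card = k := by
    rw [Finset.card_erase_of_mem (Finset.orderEmbOfFin_mem K hK j), hK]; rfl
  rw [posIn_orderEmbOfFin, minorOn_eq_det _ _ hc, orderEmbOfFin_erase, mul_assoc]
  rfl

/-- The `c r` are the signed cofactors of a column placed in front of the columns `L`; pairing them
with column `a` gives a determinant with a repeated column when `a ∈ L`, and otherwise the minor on
`insert a L` up to the sign of moving `a` into position. -/
theorem exists_cofactor (A : Matrix (Fin k) (Fin n) ℂ) (L : Finset (Fin n)) (hL : L.card + 1 = k) :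
    ∃ c : Fin k → ℂ, (∀ a ∈ L, ∑ r, c r * A r a = 0) ∧
      ∀ a ∉ L, ∑ r, c r * A r a = (-1) ^ posIn L a * minorOn A (insert a L) := by
  subst hL
  refine ⟨fun r => (-1) ^ (r : ℕ) * (A.submatrix r.succAbove (L.orderEmbOfFin rfl)).det, ?_, ?_⟩
  · intro a ha
    set M : Matrix (Fin (L.card + 1)) (Fin (L.card + 1)) ℂ :=
      Matrix.of fun i j => A i ((Fin.cons a (L.orderEmbOfFin rfl) : Fin (L.card + 1) → Fin n) j)
    obtain ⟨i, hi⟩ : a ∈ Set.range (L.orderEmbOfFin rfl) := by simpa using ha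
    have h0 : M.det = 0 := by
      apply Matrix.det_zero_of_column_eq (Fin.succ_ne_zero i).symm
      intro r
      simp [M, hi]
    rw [Matrix.det_succ_column_zero] at h0
    rw [← h0]
    refine Finset.sum_congr rfl fun r _ => ?_
    rw [mul_right_comm]
    rfl
  · intro a ha
    have hc : (insert a L).card = L.card + 1 := Finset.card_insert_of_notMem ha
    obtain ⟨q, hq⟩ : a ∈ Set.range ((insert a L).orderEmbOfFin hc) := by simp
    have hpos : posIn L a = q := by
      rw [← posIn_orderEmbOfFin (insert a L) hc q, hq, posIn, posIn, Finset.filter_insert]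
      simp
    have he : (insert a L).erase ((insert a L).orderEmbOfFin hc q) = L := by
      rw [hq, Finset.erase_insert ha]
    have hl : ⇑(L.orderEmbOfFin rfl) = (insert a L).orderEmbOfFin hc ∘ q.succAbove := by
      rw [← orderEmbOfFin_erase (insert a L) hc q (by rw [he])]
      simp only [he]
    rw [minorOn_eq_det _ _ hc, Matrix.det_succ_column _ q, Finset.mul_sum]
    refine Finset.sum_congr rfl fun r _ => ?_
    rw [hl, hpos, Matrix.submatrix_apply, hq, Matrix.submatrix_submatrix, Function.id_comp, id, pow_add]
    have : ((-1 : ℂ) ^ (q : ℕ)) * (-1) ^ (q : ℕ) = 1 := by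
      rw [← mul_pow]; simp
    linear_combination (exp := 1) (-(-1) ^ (r : ℕ) * A r a *
      (A.submatrix r.succAbove ((insert a L).orderEmbOfFin hc ∘ q.succAbove)).det) * this

/-- A function of two subsets satisfies the exchange relations if it satisfies the relations that
the products of two Plücker coordinates satisfy. -/
def IsExchange (k : ℕ) (h : Finset (Fin n) → Finset (Fin n) → ℂ) : Prop :=
  ∀ K L : Finset (Fin n), K.card = k + 1 → L.card + 1 = k →
    ∑ a ∈ K \ L, (-1) ^ (posIn K a + posIn L a) * h (K.erase a) (insert a L) = 0

/-- Contract the row expansion over `K` with the cofactors of `L`: this turns the matrix entries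
into minors on `insert a L`, and kills the terms with `a ∈ L`. -/
theorem isExchange_minorOn (A : Matrix (Fin k) (Fin n) ℂ) :
    IsExchange k fun I J => minorOn A I * minorOn A J := by
  intro K L hK hL
  obtain ⟨c, hc0, hc⟩ := exists_cofactor A L hL
  have h1 : ∑ a ∈ K, (-1) ^ posIn K a * ((∑ r, c r * A r a) * minorOn A (K.erase a)) = 0 := by
    have : ∀ a ∈ K, (-1) ^ posIn K a * ((∑ r, c r * A r a) * minorOn A (K.erase a)) =
        ∑ r, c r * ((-1) ^ posIn K a * (A r a * minorOn A (K.erase a))) := by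
      intro a _
      rw [Finset.sum_mul, Finset.mul_sum]
      exact Finset.sum_congr rfl fun r _ => by ring
    rw [Finset.sum_congr rfl this, Finset.sum_comm]
    refine Finset.sum_eq_zero fun r _ => ?_
    rw [← Finset.mul_sum, sum_row_mul_minorOn_erase A K hK r, mul_zero]
  rw [← h1, ← Finset.sum_sdiff (Finset.inter_subset_left (s₁ := K) (s₂ := L)),
    Finset.sdiff_inter_self_left, Finset.sum_eq_zero (s := K ∩ L), add_zero]
  · refine Finset.sum_congr rfl fun a ha => ?_
    rw [hc a (Finset.mem_sdiff.1 ha).2, pow_add]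
    ring
  · intro a ha
    rw [hc0 a (Finset.mem_inter.1 ha).2]
    ring

/-- A solution of the Plücker relations that does not vanish at `I` is determined by its values at
`I` and at the subsets obtained from `I` by exchanging one element. -/
theorem IsExchange.eq_of_eq_neighbors {x y : Finset (Fin n) → ℂ}
    (hx : IsExchange k fun I J => x I * x J) (hy : IsExchange k fun I J => y I * y J)
    {I : Finset (Fin n)} (hI : I.card = k) (hxI : x I = 1) (hyI : y I = 1)
    (hn : ∀ a ∈ I, ∀ b ∉ I, x ((insert b I).erase a) = y ((insert b I).erase a)) :
    ∀ J : Finset (Fin n), J.card = k → x J = y J := by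
  suffices H : ∀ m, ∀ J : Finset (Fin n), J.card = k → (J \ I).card = m → x J = y J from
    fun J hJ => H _ J hJ rfl
  intro m
  induction m with
  | zero =>
    intro J hJ h0
    have : J = I := by
      rw [Finset.card_eq_zero, Finset.sdiff_eq_empty_iff_subset] at h0
      exact Finset.eq_of_subset_of_card_le h0 (by rw [hI, hJ])
    rw [this, hxI, hyI]
  | succ m ih =>
    intro J hJ hm
    obtain ⟨b, hb⟩ := Finset.card_pos.1 (by omega : 0 < (J \ I).card)
    obtain ⟨hbJ, hbI⟩ := Finset.mem_sdiff.1 hb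
    have hK : (insert b I).card = k + 1 := by rw [Finset.card_insert_of_notMem hbI, hI]
    have hL : (J.erase b).card + 1 = k := by rw [Finset.card_erase_add_one hbJ, hJ]
    -- In the relation for `insert b I` and `J.erase b` the term `a = b` is `x I * x J`. Every other
    -- term is a neighbour of `I` times a set with one element fewer outside `I`.
    have h1 := hx _ _ hK hL
    have h2 := hy _ _ hK hL
    have hbm : b ∈ insert b I \ J.erase b := by simp
    rw [← Finset.add_sum_erase _ _ hbm] at h1 h2
    simp only [Finset.erase_insert hbI, Finset.insert_erase hbJ, hxI, hyI, one_mul] at h1 h2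
    have h3 : ∀ a ∈ (insert b I \ J.erase b).erase b,
        x ((insert b I).erase a) * x (insert a (J.erase b)) =
          y ((insert b I).erase a) * y (insert a (J.erase b)) := by
      intro a ha
      simp only [Finset.mem_erase, Finset.mem_sdiff, Finset.mem_insert, ne_eq] at ha
      obtain ⟨hab, ha1, ha2⟩ := ha
      have haI : a ∈ I := by tauto
      have haJ : a ∉ J := by tauto
      rw [hn a haI b hbI]
      congr 1
      apply ih
      · rw [Finset.card_insert_of_notMem (by simp [haJ]), hL]
      · have : insert a (J.erase b) \ I = (J \ I).erase b := by
          ext z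
          simp only [Finset.mem_sdiff, Finset.mem_insert, Finset.mem_erase]
          constructor
          · rintro ⟨rfl | h, h'⟩
            · exact absurd haI h'
            · tauto
          · tauto
        rw [this, Finset.card_erase_of_mem hb, hm]; rfl
    have h4 := Finset.sum_congr rfl fun a ha =>
      congrArg (fun z => (-1 : ℂ) ^ (posIn (insert b I) a + posIn (J.erase b) a) * z) (h3 a ha)
    rw [h4] at h1
    have h5 := h1.trans h2.symm
    have h6 := add_right_cancel h5
    exact mul_left_cancel₀ (pow_ne_zero _ (by norm_num)) h6

/-- Solutions of the Plücker relations lie in the cone over the Grassmannian. -/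
theorem mem_pluckerCone_of_isExchange (x : Finset (Fin n) → ℂ)
    (hx : IsExchange k fun I J => x I * x J) :
    (fun I : PluckerIndex k n => x I.1) ∈ pluckerCone k n := by
  by_cases h0 : ∀ I : Finset (Fin n), I.card = k → x I = 0
  · exact ⟨0, 0, fun I => by simp [h0 I.1 I.2]⟩
  push Not at h0
  obtain ⟨I, hI, hxI⟩ := h0
  set ι := I.orderEmbOfFin hI with hι
  -- The identity in the columns `I`. The remaining entries are forced by the row expansion over
  -- `insert b I`: they make the minors at the neighbours of `I` equal to the values of `x` divided
  -- by `x I`.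
  set A : Matrix (Fin k) (Fin n) ℂ := Matrix.of fun r b =>
    if b ∈ I then (if ι r = b then 1 else 0) else
      -(-1) ^ (posIn (insert b I) (ι r) + posIn (insert b I) b) *
        (x ((insert b I).erase (ι r)) / x I) with hA
  have hAI : minorOn A I = 1 := by
    rw [minorOn_eq_det A I hI]
    have : A.submatrix id (I.orderEmbOfFin hI) = 1 := by
      ext r s
      simp [hA, hι, Matrix.one_apply]
    rw [this, Matrix.det_one]
  refine ⟨x I, A, fun J => ?_⟩
  have key : ∀ J : Finset (Fin n), J.card = k → x J / x I = minorOn A J := by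
    apply IsExchange.eq_of_eq_neighbors (k := k) (x := fun J => x J / x I) (y := minorOn A)
      _ (isExchange_minorOn A) hI (div_self hxI) hAI
    · intro a ha b hb
      obtain ⟨r, rfl⟩ : a ∈ Set.range ι := by simpa [hι] using ha
      have hK : (insert b I).card = k + 1 := by rw [Finset.card_insert_of_notMem hb, hI]
      have h1 := sum_row_mul_minorOn_erase A _ hK r
      have hne : b ≠ ι r := fun h => hb (h ▸ ha)
      rw [Finset.sum_insert hb, Finset.sum_eq_single (ι r)] at h1
      · simp only [Finset.erase_insert hb, hAI] at h1
        have hAb : A r b = -(-1) ^ (posIn (insert b I) (ι r) + posIn (insert b I) b) *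
            (x ((insert b I).erase (ι r)) / x I) := by simp [hA, hb]
        have hAr : A r (ι r) = 1 := by simp [hA, ha]
        rw [hAb, hAr, pow_add] at h1
        have e1 : ((-1 : ℂ) ^ (posIn (insert b I) b)) * (-1) ^ (posIn (insert b I) b) = 1 := by
          rw [← mul_pow]; simp
        have e2 : ((-1 : ℂ) ^ (posIn (insert b I) (ι r))) * (-1) ^ (posIn (insert b I) (ι r)) = 1 := by
          rw [← mul_pow]; simp
        set s := (-1 : ℂ) ^ (posIn (insert b I) b)
        set t := (-1 : ℂ) ^ (posIn (insert b I) (ι r))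
        set X := x ((insert b I).erase (ι r)) / x I
        set Y := minorOn A ((insert b I).erase (ι r))
        linear_combination (-t) * h1 + (Y - X * s * s) * e2 - X * e1
      · intro a' ha' hne'
        simp [hA, ha', hne'.symm]
      · intro h; exact absurd ha h
    · intro K L hK hL
      have := hx K L hK hL
      have h2 := congrArg (fun z => z / (x I * x I)) this
      simp only [zero_div, Finset.sum_div] at h2
      rw [← h2]
      refine Finset.sum_congr rfl fun a _ => ?_
      field_simp
  have := key J.1 J.2
  rw [div_eq_iff hxI] at this
  rw [minorOn, dif_pos J.2, mul_comm] at this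
  exact this

theorem isExchange_of_mem_pluckerCone {x : PluckerIndex k n → ℂ} (hx : x ∈ pluckerCone k n) :
    IsExchange k fun I J => (if h : I.card = k then x ⟨I, h⟩ else 0) *
      (if h : J.card = k then x ⟨J, h⟩ else 0) := by
  obtain ⟨c, A, hA⟩ := hx
  have : ∀ I : Finset (Fin n), (if h : I.card = k then x ⟨I, h⟩ else 0) = c * minorOn A I := by
    intro I
    by_cases h : I.card = k <;> simp [h, minorOn, hA]
  intro K L hK hL
  have h1 := isExchange_minorOn A K L hK hL
  simp only [this]
  rw [← mul_zero (c * c), ← h1, Finset.mul_sum]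
  exact Finset.sum_congr rfl fun a _ => by ring

end Minors

/-! ### A solution of the exchange relations is determined by its values on standard pairs. -/

section Determinacy

variable {α : Type*} [LinearOrder α]

/-- The operator that sends a function on finite sets to the sum of its values at the subsets
with one element removed. -/
def eraseSum (g : Finset α → ℂ) (K : Finset α) : ℂ := ∑ a ∈ K, g (K.erase a)

theorem eraseSum_eq_zero_of_subset {g : Finset α → ℂ} {U : Finset α} (hg : ∀ K ⊆ U, g K = 0) :
    ∀ K ⊆ U, eraseSum g K = 0 := fun K hK =>
  Finset.sum_eq_zero fun a _ => hg _ ((Finset.erase_subset a K).trans hK)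

theorem iterate_eraseSum_eq_zero_of_subset {g : Finset α → ℂ} {U : Finset α}
    (hg : ∀ K ⊆ U, g K = 0) (d : ℕ) : ∀ K ⊆ U, eraseSum^[d] g K = 0 := by
  induction d with
  | zero => exact hg
  | succ d ih =>
    rw [Function.iterate_succ_apply']
    exact eraseSum_eq_zero_of_subset ih

/-- In `d` successive removals `N` is removed at one of the `d` steps or never. For `d = 0` the
truncated exponent `d - 1` is harmless, its coefficient being zero. -/
theorem iterate_eraseSum_insert (g : Finset α → ℂ) (N : α) (d : ℕ) :
    ∀ K : Finset α, N ∉ K → eraseSum^[d] g (insert N K) =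
      d * eraseSum^[d - 1] g K + eraseSum^[d] (fun X => g (insert N X)) K := by
  induction d with
  | zero => intro K _; simp
  | succ d ih =>
    intro K hN
    rw [Function.iterate_succ_apply', Function.iterate_succ_apply', eraseSum,
      Finset.sum_insert hN, Finset.erase_insert hN]
    have : ∀ a ∈ K, eraseSum^[d] g ((insert N K).erase a) = d * eraseSum^[d - 1] g (K.erase a) +
        eraseSum^[d] (fun X => g (insert N X)) (K.erase a) := by
      intro a ha
      rw [Finset.erase_insert_of_ne (by rintro rfl; exact hN ha),
        ih _ fun h => hN (Finset.mem_of_mem_erase h)]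
    rw [Finset.sum_congr rfl this, Finset.sum_add_distrib, ← Finset.mul_sum, ← add_assoc]
    change _ + d * eraseSum (eraseSum^[d - 1] g) K + eraseSum _ K = _
    rw [← Function.iterate_succ_apply' eraseSum]
    rcases d with _ | d
    · simp
    · simp only [Nat.succ_eq_add_one, Nat.add_sub_cancel]
      push_cast
      ring

/-- Reading `U` downwards and starting at height `d`, with a step up for every element of `X` and a
step down for every other element, one stays above zero. -/
def IsBallot (d : ℕ) (U X : Finset α) : Prop :=
  0 < d ∧ ∀ t, ((U \ X).filter (t ≤ ·)).card < d + (X.filter (t ≤ ·)).card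

/-- Split off the largest element `N` of `U`. The sets that contain `N` give a function on the rest
at height `d + 1`, those that omit `N` give one at height `d - 1`, in accordance with the steps of
the ballot path. At height zero the hypothesis says that `g` itself vanishes. -/
theorem eq_zero_of_eraseSum_of_isBallot (U : Finset α) :
    ∀ (d : ℕ) (g : Finset α → ℂ), (∀ K ⊆ U, eraseSum^[d] g K = 0) →
      (∀ X ⊆ U, IsBallot d U X → g X = 0) → ∀ X ⊆ U, g X = 0 := by
  induction U using Finset.induction_on_max with
  | empty =>
    intro d g h0 hb X hX
    rcases d.eq_zero_or_pos with rfl | hd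
    · exact h0 X hX
    · refine hb X hX ⟨hd, fun t => ?_⟩
      rw [Finset.subset_empty] at hX
      simpa [hX] using hd
  | insert N U hmax ih =>
    intro d g h0 hb X hX
    have hN : N ∉ U := fun h => lt_irrefl N (hmax N h)
    rcases d.eq_zero_or_pos with rfl | hd
    · exact h0 X hX
    have hU : ∀ K ⊆ U, K ⊆ insert N U := fun K hK => hK.trans (Finset.subset_insert N U)
    have hle : ∀ t, ¬ t ≤ N → ∀ Y ⊆ insert N U, (Y.filter (t ≤ ·)).card = 0 := by
      intro t ht Y hY
      rw [Finset.card_eq_zero, Finset.filter_eq_empty_iff]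
      intro x hx htx
      rcases Finset.mem_insert.1 (hY hx) with rfl | h
      · exact ht htx
      · exact ht (htx.trans (hmax x h).le)
    -- The sets containing `N` come first: their vanishing removes the second summand of
    -- `iterate_eraseSum_insert` and leaves `d * eraseSum^[d - 1] g K = 0`.
    have g1 : ∀ K ⊆ U, g (insert N K) = 0 := by
      refine ih (d + 1) (fun X => g (insert N X)) (fun K hK => ?_) fun X hX hbX => ?_
      · have hNK : N ∉ K := fun h => hN (hK h)
        have h1 := iterate_eraseSum_insert g N (d + 1) K hNK
        rw [Function.iterate_succ_apply', eraseSum_eq_zero_of_subset h0 _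
          (Finset.insert_subset_insert N hK), Nat.add_sub_cancel, h0 K (hU K hK), mul_zero,
          zero_add] at h1
        exact h1.symm
      · have hNX : N ∉ X := fun h => hN (hX h)
        refine hb _ (Finset.insert_subset_insert N hX) ⟨hd, fun t => ?_⟩
        by_cases ht : t ≤ N
        · have h2 := hbX.2 t
          rw [Finset.filter_insert, if_pos ht, Finset.card_insert_of_notMem (by simp [hNX])]
          have : insert N U \ insert N X = U \ X := by
            ext z
            simp only [Finset.mem_sdiff, Finset.mem_insert]
            constructor
            · tauto
            · rintro ⟨h, h'⟩
              exact ⟨Or.inr h, by rintro (rfl | h3) <;> tauto⟩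
          rw [this]
          omega
        · rw [hle t ht _ Finset.sdiff_subset]
          omega
    have g0 : ∀ K ⊆ U, eraseSum^[d - 1] g K = 0 := by
      intro K hK
      have hNK : N ∉ K := fun h => hN (hK h)
      have h1 := iterate_eraseSum_insert g N d K hNK
      rw [h0 _ (Finset.insert_subset_insert N hK), iterate_eraseSum_eq_zero_of_subset g1 d K hK,
        add_zero] at h1
      -- Characteristic zero allows the factor `d` to be cancelled.
      exact (mul_eq_zero.1 h1.symm).resolve_left (by exact_mod_cast hd.ne')
    by_cases hNX : N ∈ X
    · rw [← Finset.insert_erase hNX]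
      exact g1 _ (Finset.subset_insert_iff.1 hX)
    · refine ih (d - 1) g g0 (fun Y hY hbY => hb Y (hU Y hY) ⟨hd, fun t => ?_⟩) X
        ((Finset.subset_insert_iff_of_notMem hNX).1 hX)
      have hNY : N ∉ Y := fun h => hN (hY h)
      by_cases ht : t ≤ N
      · have h2 := hbY.2 t
        rw [Finset.insert_sdiff_of_notMem _ hNY, Finset.filter_insert, if_pos ht,
          Finset.card_insert_of_notMem (by simp [hN])]
        omega
      · rw [hle t ht _ Finset.sdiff_subset]
        omega

/-- The pairs of subsets that are the columns `J`, `I` of a semistandard tableau. -/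
def IsStandardPair (I J : Finset α) : Prop :=
  ∀ t, (J.filter (t ≤ ·)).card ≤ (I.filter (t ≤ ·)).card

theorem posIn_union {s t : Finset α} (h : Disjoint s t) (a : α) :
    posIn (s ∪ t) a = posIn s a + posIn t a := by
  rw [posIn, Finset.filter_union, Finset.card_union_of_disjoint (Finset.disjoint_filter_filter h)]
  rfl

/-- An exchange preserves both intersection and union. With `T = I ∩ J` and the symmetric difference
`U` fixed, the relations become, after a change of signs, `eraseSum g = 0` for a single function `g`
of the half-size subset `X` of `U`. The ballot condition at height one for `X` makes the pair `T ∪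
X`, `T ∪ (U \ X)` standard. -/
theorem IsExchange.eq_zero_of_isStandardPair {n k : ℕ} {h : Finset (Fin n) → Finset (Fin n) → ℂ}
    (hh : IsExchange k h)
    (h0 : ∀ I J, I.card = k → J.card = k → IsStandardPair I J → h I J = 0)
    {I J : Finset (Fin n)} (hI : I.card = k) (hJ : J.card = k) : h I J = 0 := by
  set T := I ∩ J with hT
  set U := (I \ J) ∪ (J \ I) with hU
  set m := (I \ J).card with hm
  have hIm : T.card + m = k := by
    rw [← hI, hT, hm, add_comm]; exact Finset.card_sdiff_add_card_inter I J
  have hJm : T.card + (J \ I).card = k := by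
    rw [← hJ, hT, add_comm, Finset.inter_comm]; exact Finset.card_sdiff_add_card_inter J I
  have hUm : U.card = m + m := by
    rw [hU, Finset.card_union_of_disjoint disjoint_sdiff_sdiff]; omega
  have hTU : Disjoint T U := by
    rw [Finset.disjoint_left]
    intro x hx
    simp only [hT, hU, Finset.mem_inter, Finset.mem_union, Finset.mem_sdiff] at hx ⊢
    tauto
  -- The term of `a` in the relation has the sign `(-1) ^ posIn U a`, since the points of `T` are
  -- counted twice. The factor over all of `X` therefore makes the signs of all terms equal.
  set g : Finset (Fin n) → ℂ := fun X =>
    if X.card = m then (-1) ^ (∑ x ∈ X, posIn U x) * h (T ∪ X) (T ∪ (U \ X)) else 0 with hg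
  have key : ∀ X ⊆ U, g X = 0 := by
    refine eq_zero_of_eraseSum_of_isBallot U 1 g (fun K hK => ?_) fun X hX hb => ?_
    · rw [Function.iterate_one, eraseSum]
      by_cases hKm : K.card = m + 1
      · have hTK : Disjoint T K := hTU.mono_right hK
        have hTL : Disjoint T (U \ K) := hTU.mono_right Finset.sdiff_subset
        have hKU := Finset.card_le_card hK
        have h1 := hh (T ∪ K) (T ∪ (U \ K))
          (by rw [Finset.card_union_of_disjoint hTK]; omega)
          (by rw [Finset.card_union_of_disjoint hTL, Finset.card_sdiff_of_subset hK]; omega)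
        have h2 : (T ∪ K) \ (T ∪ (U \ K)) = K := by
          ext x
          have : x ∈ K → x ∈ U := fun hx => hK hx
          have : x ∈ T → x ∉ K := fun hx => Finset.disjoint_left.1 hTK hx
          simp only [Finset.mem_sdiff, Finset.mem_union]
          tauto
        rw [h2] at h1
        rw [← mul_zero ((-1 : ℂ) ^ (∑ x ∈ K, posIn U x)), ← h1, Finset.mul_sum]
        refine Finset.sum_congr rfl fun a ha => ?_
        have haT : a ∉ T := Finset.disjoint_right.1 hTK ha
        have e1 : (T ∪ K).erase a = T ∪ K.erase a := by
          rw [Finset.erase_union_distrib, Finset.erase_eq_of_notMem haT]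
        have e2 : insert a (T ∪ (U \ K)) = T ∪ (U \ K.erase a) := by
          ext x
          have := hK ha
          simp only [Finset.mem_insert, Finset.mem_union, Finset.mem_sdiff, Finset.mem_erase]
          by_cases hx : x = a
          · subst hx; tauto
          · tauto
        have e3 : posIn (T ∪ K) a + posIn (T ∪ (U \ K)) a = 2 * posIn T a + posIn U a := by
          rw [posIn_union hTK, posIn_union hTL]
          have : posIn U a = posIn K a + posIn (U \ K) a := by
            rw [← posIn_union Finset.disjoint_sdiff, Finset.union_sdiff_of_subset hK]
          omega
        have e4 : (-1 : ℂ) ^ posIn U a * (-1) ^ posIn U a = 1 := by rw [← mul_pow]; simp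
        rw [e1, e2, e3, hg]
        simp only [Finset.card_erase_of_mem ha, hKm, Nat.add_sub_cancel, if_true]
        rw [← Finset.add_sum_erase K _ ha, pow_add, pow_add, pow_mul]
        simp only [neg_one_sq, one_pow, one_mul]
        linear_combination (-(-1) ^ (∑ x ∈ K.erase a, posIn U x) *
          h (T ∪ K.erase a) (T ∪ (U \ K.erase a))) * e4
      · refine Finset.sum_eq_zero fun a ha => ?_
        have := Finset.card_erase_add_one ha
        simp only [hg]
        rw [if_neg (by omega)]
    · by_cases hXm : X.card = m
      · have hTX : Disjoint T X := hTU.mono_right hX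
        have hTL : Disjoint T (U \ X) := hTU.mono_right Finset.sdiff_subset
        simp only [hg, hXm, if_true]
        rw [h0, mul_zero]
        · rw [Finset.card_union_of_disjoint hTX]; omega
        · rw [Finset.card_union_of_disjoint hTL, Finset.card_sdiff_of_subset hX]; omega
        · intro t
          rw [Finset.filter_union, Finset.filter_union,
            Finset.card_union_of_disjoint (Finset.disjoint_filter_filter hTX),
            Finset.card_union_of_disjoint (Finset.disjoint_filter_filter hTL)]
          have := hb.2 t
          omega
      · simp [hg, hXm]
  have h2 := key (I \ J) Finset.subset_union_left
  have e1 : T ∪ (I \ J) = I := by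
    rw [hT, Finset.union_comm]; exact Finset.sdiff_union_inter I J
  have e2 : T ∪ (U \ (I \ J)) = J := by
    ext x
    simp only [hT, hU, Finset.mem_inter, Finset.mem_union, Finset.mem_sdiff]
    tauto
  simp only [hg, ← hm, if_true, e1, e2] at h2
  exact (mul_eq_zero.1 h2).resolve_left (pow_ne_zero _ (by norm_num))

end Determinacy

/-! ### Compatibility of a pairing with two subsets. -/

namespace PartialNCPairing

variable {k n : ℕ} (p q : PartialNCPairing k n)

/-- The subsets `I` and `J` have the intersection `T`, and every edge of the pairing joins a point of
`I \ J` with a point of `J \ I`. -/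
def Compat (I J : Finset (Fin n)) : Prop :=
  (∀ i, i ∈ J ↔ p.partner i ∈ I) ∧ (∀ i, p.partner i ≠ i → (i ∈ I ↔ p.partner i ∉ I)) ∧
    ∀ i, p.partner i = i → (i ∈ I ↔ i ∈ p.T)

theorem partner_mem_Ioo {a i : Fin n} (hi : i ∈ Finset.Ioo a (p.partner a)) :
    p.partner i ∈ Finset.Ioo a (p.partner a) := by
  rw [Finset.mem_Ioo] at hi ⊢
  have h1 := p.noncrossing a i
  have h2 := p.noncrossing (p.partner i) a
  have h3 := p.involutive i
  have h4 := p.involutive a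
  have h5 : p.partner i ≠ a := by rintro h; rw [h] at h3; exact hi.2.ne h3.symm
  have h6 : p.partner i ≠ p.partner a := fun h => hi.1.ne' (p.involutive.injective h)
  rw [h3] at h2
  have h7 : ¬ p.partner a < p.partner i := fun h => h1 ⟨hi.1, hi.2, h⟩
  have h8 : ¬ p.partner i < a := fun h => h2 ⟨h, hi.1, hi.2⟩
  exact ⟨lt_of_le_of_ne (not_lt.1 h8) h5.symm, lt_of_le_of_ne (not_lt.1 h7) h6⟩

variable {p} in
-- By non-crossing, `partner` maps the open interval below a chord to itself, and it exchanges `I`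
-- with `J`.
theorem Compat.card_inter_Ioo {I J : Finset (Fin n)} (h : p.Compat I J) (a : Fin n) :
    (I ∩ Finset.Ioo a (p.partner a)).card = (J ∩ Finset.Ioo a (p.partner a)).card := by
  apply Finset.card_bij' (fun i _ => p.partner i) (fun i _ => p.partner i)
  · intro i hi
    rw [Finset.mem_inter] at hi ⊢
    exact ⟨(h.1 _).2 (by rw [p.involutive]; exact hi.1), p.partner_mem_Ioo hi.2⟩
  · intro i hi
    rw [Finset.mem_inter] at hi ⊢
    exact ⟨(h.1 _).1 hi.1, p.partner_mem_Ioo hi.2⟩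
  · intro i _; exact p.involutive i
  · intro i _; exact p.involutive i

variable {p} in
theorem Compat.mem_T_iff {I J : Finset (Fin n)} (h : p.Compat I J) (i : Fin n) :
    i ∈ p.T ↔ i ∈ I ∧ i ∈ J := by
  by_cases hi : p.partner i = i
  · rw [h.1 i, hi, h.2.2 i hi, and_self]
  · have := h.2.1 i hi
    have h1 := h.1 i
    have h2 : i ∉ p.T := fun h => hi (p.disjoint i h)
    tauto

theorem posIn_eq_add_card_Ioo {s : Finset (Fin n)} {a b : Fin n} (hab : a < b) :
    posIn s b = posIn s a + (if a ∈ s then 1 else 0) + (s ∩ Finset.Ioo a b).card := by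
  have h1 : s.filter (· < b) = (s.filter (· < a) ∪ s.filter (· = a)) ∪ (s ∩ Finset.Ioo a b) := by
    ext x
    simp only [Finset.mem_filter, Finset.mem_union, Finset.mem_inter, Finset.mem_Ioo]
    constructor
    · rintro ⟨hx, hxb⟩
      rcases lt_trichotomy x a with h | h | h <;> tauto
    · rintro ((⟨h, h'⟩ | ⟨h, h'⟩) | ⟨h, h', h''⟩)
      · exact ⟨h, h'.trans hab⟩
      · exact ⟨h, h' ▸ hab⟩
      · exact ⟨h, h''⟩
  rw [posIn, h1, Finset.card_union_of_disjoint, Finset.card_union_of_disjoint, posIn,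
    Finset.filter_eq']
  · split_ifs <;> simp
  · rw [Finset.disjoint_filter]
    intro x _ h h'
    exact h.ne h'
  · rw [Finset.disjoint_left]
    intro x hx hx'
    simp only [Finset.mem_filter, Finset.mem_union, Finset.mem_inter, Finset.mem_Ioo] at hx hx'
    rcases hx with ⟨_, h⟩ | ⟨_, h⟩
    · exact lt_asymm h hx'.2.1
    · exact hx'.2.1.ne' h

/-- Between the two ends lie equally many points of `K` and of `L`, an even contribution. What
remains is the smaller end itself, which lies in `K` and not in `L`. -/
theorem sign_partner {K L : Finset (Fin n)} {a : Fin n} (haK : a ∈ K) (haL : a ∉ L)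
    (hne : p.partner a ≠ a) (hbK : p.partner a ∈ K) (hbL : p.partner a ∉ L)
    (h : p.Compat (K.erase a) (insert a L)) :
    (-1 : ℂ) ^ (posIn K (p.partner a) + posIn L (p.partner a)) =
      -(-1) ^ (posIn K a + posIn L a) := by
  have e : ∀ B : Finset (Fin n), a ∉ B → K.erase a ∩ B = K ∩ B := fun B ha => by
    rw [Finset.erase_inter, Finset.erase_eq_of_notMem (by simp [ha])]
  have e' : ∀ B : Finset (Fin n), a ∉ B → insert a L ∩ B = L ∩ B := fun B ha =>
    Finset.insert_inter_of_notMem ha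
  rcases lt_or_gt_of_ne hne with hlt | hlt
  · have hc := h.card_inter_Ioo (p.partner a)
    rw [p.involutive, e _ (by simp), e' _ (by simp)] at hc
    rw [posIn_eq_add_card_Ioo (s := K) hlt, posIn_eq_add_card_Ioo (s := L) hlt, if_pos hbK,
      if_neg hbL, hc]
    have : ∀ x y z : ℕ, x + 1 + z + (y + 0 + z) = 2 * z + 1 + (x + y) := fun x y z => by ring
    rw [this, pow_add _ (2 * _ + 1), pow_succ, pow_mul]
    simp
  · have hc := h.card_inter_Ioo a
    rw [e _ (by simp), e' _ (by simp)] at hc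
    rw [posIn_eq_add_card_Ioo (s := K) hlt, posIn_eq_add_card_Ioo (s := L) hlt, if_pos haK,
      if_neg haL, hc]
    have : ∀ x y z : ℕ, x + 1 + z + (y + 0 + z) = 2 * z + 1 + (x + y) := fun x y z => by ring
    rw [this, pow_add _ (2 * _ + 1), pow_succ, pow_mul]
    simp

variable {p} in
-- In `(K.erase a, insert a L)` the point `a` lies in the second set only, hence its partner in the
-- first only. Returning `a` and moving the partner instead merely swaps the two ends of this chord.
theorem Compat.exchange {K L : Finset (Fin n)} {a : Fin n} (haK : a ∈ K) (haL : a ∉ L)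
    (h : p.Compat (K.erase a) (insert a L)) :
    p.partner a ≠ a ∧ p.partner a ∈ K ∧ p.partner a ∉ L ∧
      p.Compat (K.erase (p.partner a)) (insert (p.partner a) L) := by
  have hinv := p.involutive
  have hne : p.partner a ≠ a := by
    intro he
    have := h.1 a
    rw [he] at this
    simp at this
  have h1 := h.1 a
  have h2 := h.1 (p.partner a)
  rw [hinv] at h2
  simp only [Finset.mem_insert, Finset.mem_erase, true_or, true_iff, ne_eq, hne, false_or,
    not_true, false_and, iff_false] at h1 h2
  refine ⟨hne, h1.2, h2, fun i => ?_, fun i hi => ?_, fun i hi => ?_⟩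
  · have := h.1 i
    by_cases hia : i = a
    · subst hia
      simp [haL, hne.symm]
    · by_cases hib : i = p.partner a
      · subst hib
        simp [hinv a, hne.symm, haK]
      · have : p.partner i ≠ a := fun h => hib (by rw [← h, hinv])
        have : p.partner i ≠ p.partner a := fun h => hia (hinv.injective h)
        simp_all
  · have := h.2.1 i hi
    by_cases hia : i = a
    · subst hia
      simp [haK, hne.symm]
    · by_cases hib : i = p.partner a
      · subst hib
        simp [hinv a, hne.symm, haK]
      · have : p.partner i ≠ a := fun h => hib (by rw [← h, hinv])
        have : p.partner i ≠ p.partner a := fun h => hia (hinv.injective h)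
        simp_all
  · have := h.2.2 i hi
    have hia : i ≠ a := by rintro rfl; exact hne hi
    have hib : i ≠ p.partner a := by rintro rfl; rw [hinv] at hi; exact hne hi.symm
    simp_all

-- Passing from `a` to its partner is a sign-reversing involution without fixed points on the
-- nonzero terms.
open Classical in
theorem isExchange_compat : IsExchange k fun I J => if p.Compat I J then (1 : ℂ) else 0 := by
  intro K L _ _
  simp only [mul_ite, mul_one, mul_zero]
  rw [← Finset.sum_filter]
  refine Finset.sum_involution (fun a _ => p.partner a) ?_ ?_ ?_ ?_
  · intro a ha
    simp only [Finset.mem_filter, Finset.mem_sdiff] at ha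
    obtain ⟨h1, h2, h3, -⟩ := ha.2.exchange ha.1.1 ha.1.2
    rw [p.sign_partner ha.1.1 ha.1.2 h1 h2 h3 ha.2, add_neg_cancel]
  · intro a ha _
    simp only [Finset.mem_filter, Finset.mem_sdiff] at ha
    exact (ha.2.exchange ha.1.1 ha.1.2).1
  · intro a ha
    simp only [Finset.mem_filter, Finset.mem_sdiff] at ha ⊢
    obtain ⟨-, h2, h3, h4⟩ := ha.2.exchange ha.1.1 ha.1.2
    exact ⟨⟨h2, h3⟩, h4⟩
  · intro a _
    exact p.involutive a

/-- The points of `T` and the larger ends of the edges. -/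
def upper : Finset (Fin n) := Finset.univ.filter fun i => i ∈ p.T ∨ p.partner i < i

/-- The points of `T` and the smaller ends of the edges. -/
def lower : Finset (Fin n) := Finset.univ.filter fun i => i ∈ p.T ∨ i < p.partner i

theorem mem_upper {i : Fin n} : i ∈ p.upper ↔ i ∈ p.T ∨ p.partner i < i := by simp [upper]

theorem mem_lower {i : Fin n} : i ∈ p.lower ↔ i ∈ p.T ∨ i < p.partner i := by simp [lower]

theorem partner_mem_T {i : Fin n} : p.partner i ∈ p.T ↔ i ∈ p.T := by
  constructor
  · intro h
    have := p.disjoint _ h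
    rw [p.involutive] at this
    rwa [this]
  · intro h
    rwa [p.disjoint _ h]

theorem compat_upper_lower : p.Compat p.upper p.lower := by
  refine ⟨fun i => ?_, fun i hi => ?_, fun i hi => ?_⟩
  · rw [mem_upper, mem_lower, partner_mem_T, p.involutive]
  · have hT : i ∉ p.T := fun h => hi (p.disjoint i h)
    rw [mem_upper, mem_upper, partner_mem_T, p.involutive]
    simp only [hT, false_or, not_lt]
    exact ⟨le_of_lt, fun h => lt_of_le_of_ne h hi⟩
  · rw [mem_upper, hi]
    simp

/-- The union of `I` and `J` consists of the moved points and `T`, and their intersection is `T`.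
The statement avoids the bundled structure because it also serves to prove `size` for a pairing
under construction. -/
theorem card_moved_add_two_mul_card {f : Fin n → Fin n} {T I J : Finset (Fin n)}
    (h1 : ∀ i, i ∈ J ↔ f i ∈ I) (h2 : ∀ i, f i ≠ i → (i ∈ I ↔ f i ∉ I))
    (h3 : ∀ i, f i = i → (i ∈ I ↔ i ∈ T)) (hT : ∀ i ∈ T, f i = i) :
    (Finset.univ.filter fun i => f i ≠ i).card + 2 * T.card = I.card + J.card := by
  have h4 : I ∩ J = T := by
    ext i
    rw [Finset.mem_inter, h1 i]
    by_cases hi : f i = i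
    · rw [hi, h3 i hi, and_self]
    · have := h2 i hi
      have : i ∉ T := fun h => hi (hT i h)
      tauto
  have h5 : I ∪ J = (Finset.univ.filter fun i => f i ≠ i) ∪ T := by
    ext i
    simp only [Finset.mem_union, Finset.mem_filter, Finset.mem_univ, true_and]
    by_cases hi : f i = i
    · rw [h1 i, hi, h3 i hi]; simp
    · have := h2 i hi
      have := h1 i
      tauto
  have h6 : Disjoint (Finset.univ.filter fun i => f i ≠ i) T := by
    rw [Finset.disjoint_left]
    intro i hi hi'
    exact (Finset.mem_filter.1 hi).2 (hT i hi')
  rw [← Finset.card_union_add_card_inter I J, h4, h5, Finset.card_union_of_disjoint h6]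
  ring

variable {p} in
theorem Compat.card_add_card {I J : Finset (Fin n)} (h : p.Compat I J) :
    I.card = J.card ∧ I.card = k := by
  have h1 : I.card = J.card :=
    Finset.card_bij' (fun i _ => p.partner i) (fun i _ => p.partner i)
      (fun i hi => (h.1 _).2 (by rwa [p.involutive])) (fun i hi => (h.1 i).1 hi)
      (fun i _ => p.involutive i) (fun i _ => p.involutive i)
  have h2 := card_moved_add_two_mul_card h.1 h.2.1 h.2.2 p.disjoint
  have := p.size
  omega

theorem card_upper : p.upper.card = k := p.compat_upper_lower.card_add_card.2

theorem card_lower : p.lower.card = k :=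
  p.compat_upper_lower.card_add_card.1.symm.trans p.card_upper

theorem isStandardPair : IsStandardPair p.upper p.lower := by
  intro t
  refine Finset.card_le_card_of_injOn p.partner (fun i hi => ?_) (p.involutive.injective.injOn)
  simp only [Finset.coe_filter, Set.mem_ofPred_eq] at hi ⊢
  refine ⟨(p.compat_upper_lower.1 i).1 hi.1, hi.2.trans ?_⟩
  rcases p.mem_lower.1 hi.1 with h | h
  · rw [p.disjoint i h]
  · exact h.le

variable {p q} in
-- A non-crossing matching is determined by which points open and which close a chord. If two
-- matchings gave a closing point `c` different openers, the later opener would, in the matching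
-- that does not join it to `c`, be closed before `c`. By induction on `c` the other matching has
-- that same chord, yet there the opener is joined to `c`.
theorem partner_eq_of_upper_eq (hT : p.T = q.T) (hu : p.upper = q.upper) (hl : p.lower = q.lower) :
    p.partner = q.partner := by
  have clos : ∀ i, p.partner i < i ↔ q.partner i < i := by
    intro i
    have h1 := p.mem_upper (i := i)
    have h2 := q.mem_upper (i := i)
    rw [hu, h2, hT] at h1
    have h3 : i ∈ q.T → q.partner i = i := q.disjoint i
    have h4 : i ∈ q.T → p.partner i = i := fun h => p.disjoint i (hT ▸ h)
    by_cases h5 : i ∈ q.T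
    · rw [h3 h5, h4 h5]
    · tauto
  have opn : ∀ i, i < p.partner i ↔ i < q.partner i := by
    intro i
    have h1 := p.mem_lower (i := i)
    have h2 := q.mem_lower (i := i)
    rw [hl, h2, hT] at h1
    have h3 : i ∈ q.T → q.partner i = i := q.disjoint i
    have h4 : i ∈ q.T → p.partner i = i := fun h => p.disjoint i (hT ▸ h)
    by_cases h5 : i ∈ q.T
    · rw [h3 h5, h4 h5]
    · tauto
  have main : ∀ c, p.partner c < c → q.partner c = p.partner c := by
    intro c
    induction c using WellFoundedLT.induction with
    | ind c ih =>
      intro hc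
      have hc' := (clos c).1 hc
      rcases lt_trichotomy (q.partner c) (p.partner c) with h | h | h
      · exfalso
        have h1 : p.partner c < q.partner (p.partner c) :=
          (opn _).1 (by rwa [p.involutive])
        have h2 := q.noncrossing (q.partner c) (p.partner c)
        rw [q.involutive] at h2
        have h3 : q.partner (p.partner c) ≠ c := fun e => by
          have := q.involutive (p.partner c)
          rw [e] at this
          exact h.ne this
        have h4 : q.partner (p.partner c) < c :=
          lt_of_le_of_ne (not_lt.1 fun h' => h2 ⟨h, hc, h'⟩) h3
        have h5 := ih _ h4 ((clos _).2 (by rwa [q.involutive]))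
        rw [q.involutive] at h5
        have h6 := p.involutive.injective h5
        exact h3 h6.symm
      · exact h
      · exfalso
        have h1 : q.partner c < p.partner (q.partner c) :=
          (opn _).2 (by rwa [q.involutive])
        have h2 := p.noncrossing (p.partner c) (q.partner c)
        rw [p.involutive] at h2
        have h3 : p.partner (q.partner c) ≠ c := fun e => by
          have := p.involutive (q.partner c)
          rw [e] at this
          exact h.ne this
        have h4 : p.partner (q.partner c) < c :=
          lt_of_le_of_ne (not_lt.1 fun h' => h2 ⟨h, hc', h'⟩) h3
        have h5 := ih _ h4 (by rwa [p.involutive])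
        rw [p.involutive] at h5
        have h6 := q.involutive.injective h5
        exact h3 h6
  funext i
  rcases lt_trichotomy (p.partner i) i with h | h | h
  · exact (main i h).symm
  · have h1 := clos i
    have h2 := opn i
    rw [h] at h1 h2
    rw [h]
    exact le_antisymm (not_lt.1 (mt h1.2 (lt_irrefl i))) (not_lt.1 (mt h2.2 (lt_irrefl i)))
  · have h1 := main (p.partner i) (by rwa [p.involutive])
    rw [p.involutive] at h1
    have := q.involutive (p.partner i)
    rw [h1] at this
    exact this.symm

variable {p q} in
theorem eq_of_upper_eq_of_lower_eq (hu : p.upper = q.upper) (hl : p.lower = q.lower) : p = q := by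
  have hT : p.T = q.T := by
    ext i
    rw [p.compat_upper_lower.mem_T_iff, q.compat_upper_lower.mem_T_iff, hu, hl]
  exact PartialNCPairing.ext (partner_eq_of_upper_eq hT hu hl) hT

variable {p} in
-- Replacing each point of `I` by the larger end of its chord produces `p.upper`, so the sum
-- increases unless `I` consisted of larger ends already.
theorem Compat.sum_le {I J : Finset (Fin n)} (h : p.Compat I J) :
    I = p.upper ∨ ∑ i ∈ I, (i : ℕ) < ∑ i ∈ p.upper, (i : ℕ) := by
  have hinv := p.involutive
  have hs : ∑ i ∈ I, ((max i (p.partner i) : Fin n) : ℕ) = ∑ i ∈ p.upper, (i : ℕ) := by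
    refine Finset.sum_bij (fun i _ => max i (p.partner i)) ?_ ?_ ?_ (fun _ _ => rfl)
    · intro i hi
      rw [mem_upper]
      rcases lt_trichotomy (p.partner i) i with h1 | h1 | h1
      · right; rwa [max_eq_left h1.le]
      · left; rw [h1, max_self]; exact (h.2.2 i h1).1 hi
      · right; rwa [max_eq_right h1.le, hinv]
    · intro i hi j hj hij
      by_contra hne
      have hij' : p.partner i = j := by
        rcases max_choice i (p.partner i) with h1 | h1 <;>
          rcases max_choice j (p.partner j) with h2 | h2 <;> rw [h1, h2] at hij
        · exact absurd hij hne
        · rw [hij, hinv]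
        · exact hij
        · exact absurd (hinv.injective hij) hne
      exact (h.2.1 i (by rw [hij']; exact fun h => hne h.symm)).1 hi (hij' ▸ hj)
    · intro u hu
      by_cases huI : u ∈ I
      · refine ⟨u, huI, max_eq_left ?_⟩
        rcases p.mem_upper.1 hu with h1 | h1
        · rw [p.disjoint u h1]
        · exact h1.le
      · rcases p.mem_upper.1 hu with h1 | h1
        · exact absurd ((h.mem_T_iff u).1 h1).1 huI
        · refine ⟨p.partner u, ?_, ?_⟩
          · by_contra h2
            exact huI ((h.2.1 u h1.ne).2 h2)
          · rw [hinv, max_eq_right h1.le]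
  have hle : ∀ i ∈ I, (i : ℕ) ≤ ((max i (p.partner i) : Fin n) : ℕ) := fun i _ =>
    Fin.le_def.1 (le_max_left _ _)
  rcases (Finset.sum_le_sum hle).lt_or_eq with h1 | h1
  · right; rwa [← hs]
  · left
    rw [Finset.sum_eq_sum_iff_of_le hle] at h1
    refine Finset.eq_of_subset_of_card_le (fun i hi => ?_)
      (by rw [p.card_upper, h.card_add_card.2])
    have h2 : i = max i (p.partner i) := Fin.ext (h1 i hi)
    rw [mem_upper]
    rcases lt_or_eq_of_le (left_eq_sup.1 h2) with h3 | h3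
    · exact Or.inr h3
    · exact Or.inl ((h.2.2 i h3).1 hi)

/-- This is the triangularity of the compatibility matrix. -/
theorem eq_or_sum_upper_lt_of_compat (h : p.Compat q.upper q.lower) :
    q = p ∨ ∑ i ∈ q.upper, (i : ℕ) < ∑ i ∈ p.upper, (i : ℕ) := by
  refine h.sum_le.imp_left fun hu => eq_of_upper_eq_of_lower_eq hu ?_
  ext i
  rw [h.1 i, hu, p.compat_upper_lower.1 i]

end PartialNCPairing

/-! ### Standard pairs, non-crossing matchings and two-column tableaux. -/

section Matching

variable {n k : ℕ}

/-- Join the smallest closing point `c` to the nearest opening point `o` before it. No other point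
of `X` or `Y` lies in between, so this chord crosses none of those supplied by induction. -/
theorem exists_matching (m : ℕ) : ∀ X Y : Finset (Fin n), Disjoint X Y → X.card = m → Y.card = m →
    IsStandardPair X Y → ∃ f : Fin n → Fin n, Function.Involutive f ∧
      (∀ a b, ¬ (a < b ∧ b < f a ∧ f a < f b)) ∧ (∀ i, f i < i ↔ i ∈ X) ∧
        ∀ i, i < f i ↔ i ∈ Y := by
  induction m with
  | zero =>
    intro X Y _ hX hY _
    rw [Finset.card_eq_zero] at hX hY
    subst hX hY
    exact ⟨id, fun _ => rfl, fun a b h => lt_asymm h.1 h.2.1, by simp, by simp⟩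
  | succ m ih =>
    intro X Y hXY hX hY hs
    have hXne : X.Nonempty := Finset.card_pos.1 (by omega)
    have hYne : Y.Nonempty := Finset.card_pos.1 (by omega)
    set c := X.min' hXne with hc
    have hcX : c ∈ X := X.min'_mem hXne
    have hcmin : ∀ x ∈ X, c ≤ x := fun x hx => X.min'_le x hx
    -- Otherwise, with `min Y` as threshold, all `m + 1` points of `Y` would count, but not the
    -- point `c` of `X`.
    have hone : (Y.filter (· < c)).Nonempty := by
      by_contra hempty
      rw [Finset.not_nonempty_iff_eq_empty, Finset.filter_eq_empty_iff] at hempty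
      have h1 := hs (Y.min' hYne)
      rw [Finset.filter_true_of_mem fun y hy => Y.min'_le y hy] at h1
      have h2 : X.filter (Y.min' hYne ≤ ·) ⊆ X.erase c := by
        intro x hx
        rw [Finset.mem_filter] at hx
        rw [Finset.mem_erase]
        refine ⟨?_, hx.1⟩
        rintro rfl
        rcases hx.2.lt_or_eq with h | h
        · exact hempty (Y.min'_mem hYne) h
        · exact Finset.disjoint_left.1 hXY hx.1 (h ▸ Y.min'_mem hYne)
      have h3 := Finset.card_le_card h2
      rw [Finset.card_erase_of_mem hcX] at h3
      omega
    set o := (Y.filter (· < c)).max' hone with ho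
    have hoF := (Y.filter (· < c)).max'_mem hone
    rw [← ho, Finset.mem_filter] at hoF
    obtain ⟨hoY, hoc⟩ := hoF
    have homax : ∀ y ∈ Y, y < c → y ≤ o := fun y hy hyc =>
      (Y.filter (· < c)).le_max' y (Finset.mem_filter.2 ⟨hy, hyc⟩)
    obtain ⟨f, hinv, hnc, hfX, hfY⟩ := ih (X.erase c) (Y.erase o)
      (hXY.mono (Finset.erase_subset _ _) (Finset.erase_subset _ _))
      (by rw [Finset.card_erase_of_mem hcX, hX]; rfl)
      (by rw [Finset.card_erase_of_mem hoY, hY]; rfl) (by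
        intro t
        have h1 := hs t
        rw [Finset.filter_erase, Finset.filter_erase]
        by_cases hto : t ≤ o
        · rw [Finset.card_erase_of_mem (by simp [hoY, hto]),
            Finset.card_erase_of_mem (by simp [hcX, hto.trans hoc.le])]
          omega
        · rw [Finset.erase_eq_of_notMem (s := Y.filter _) (by simp [hto])]
          -- For a threshold between `o` and `c` all of `X` counts, so `m` points remain after
          -- removing `c`; at most `m` points of `Y` other than `o` can count.
          by_cases htc : t ≤ c
          · rw [Finset.filter_true_of_mem (s := X) fun x hx => htc.trans (hcmin x hx),
              Finset.card_erase_of_mem hcX, hX, Nat.add_sub_cancel]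
            have : Y.filter (t ≤ ·) ⊆ Y.erase o := by
              intro y hy
              rw [Finset.mem_filter] at hy
              exact Finset.mem_erase.2 ⟨fun h => hto (h ▸ hy.2), hy.1⟩
            have := Finset.card_le_card this
            rw [Finset.card_erase_of_mem hoY, hY] at this
            exact this
          · rw [Finset.erase_eq_of_notMem (s := X.filter _) (by simp [htc])]
            exact h1)
    have hoX : o ∉ X := fun h => Finset.disjoint_left.1 hXY h hoY
    have hcY : c ∉ Y := Finset.disjoint_left.1 hXY hcX
    have fix : ∀ i, i ∉ X.erase c → i ∉ Y.erase o → f i = i := fun i h1 h2 =>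
      le_antisymm (not_lt.1 (mt (hfY i).1 h2)) (not_lt.1 (mt (hfX i).1 h1))
    have hfo : f o = o := fix o (by simp [hoX]) (by simp)
    have hfc : f c = c := fix c (by simp) (by simp [hcY])
    have hbetween : ∀ i, o < i → i < c → f i = i := by
      intro i h1 h2
      apply fix
      · rw [Finset.mem_erase]; exact fun h => absurd (hcmin i h.2) (not_le.2 h2)
      · rw [Finset.mem_erase]; exact fun h => absurd (homax i h.2 h2) (not_le.2 h1)
    have hne : o ≠ c := hoc.ne
    have hfi : ∀ i, i ≠ o → i ≠ c → f i ≠ o ∧ f i ≠ c := fun i h1 h2 =>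
      ⟨fun h => h1 (hinv.injective (h.trans hfo.symm)),
        fun h => h2 (hinv.injective (h.trans hfc.symm))⟩
    set f' : Fin n → Fin n := fun i => if i = o then c else if i = c then o else f i with hf'
    have fo : f' o = c := by simp [hf']
    have fc : f' c = o := by simp [hf', hne.symm]
    have fe : ∀ i, i ≠ o → i ≠ c → f' i = f i := fun i h1 h2 => by simp [hf', h1, h2]
    refine ⟨f', ?_, ?_, ?_, ?_⟩
    · intro i
      by_cases h1 : i = o
      · subst h1; rw [fo, fc]
      · by_cases h2 : i = c
        · subst h2; rw [fc, fo]
        · rw [fe i h1 h2, fe _ (hfi i h1 h2).1 (hfi i h1 h2).2, hinv]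
    · rintro a b ⟨h1, h2, h3⟩
      by_cases ha : a = o
      · subst ha
        rw [fo] at h2 h3
        rw [fe b h1.ne' h2.ne, hbetween b h1 h2] at h3
        exact lt_asymm h2 h3
      by_cases ha' : a = c
      · subst ha'
        rw [fc] at h2
        exact lt_asymm h1 (h2.trans hoc)
      rw [fe a ha ha'] at h2 h3
      by_cases hb : b = o
      · subst hb
        rw [fo] at h3
        have := hbetween _ h2 h3
        rw [hinv] at this
        rw [← this] at h2
        exact lt_asymm h1 h2
      by_cases hb' : b = c
      · subst hb'
        rw [fc] at h3
        exact lt_asymm (hoc.trans h2) h3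
      rw [fe b hb hb'] at h3
      exact hnc a b ⟨h1, h2, h3⟩
    · intro i
      by_cases h1 : i = o
      · subst h1; rw [fo]; exact iff_of_false hoc.asymm hoX
      · by_cases h2 : i = c
        · subst h2; rw [fc]; exact iff_of_true hoc hcX
        · rw [fe i h1 h2, hfX, Finset.mem_erase]; tauto
    · intro i
      by_cases h1 : i = o
      · subst h1; rw [fo]; exact iff_of_true hoc hoY
      · by_cases h2 : i = c
        · subst h2; rw [fc]; exact iff_of_false hoc.asymm hcY
        · rw [fe i h1 h2, hfY, Finset.mem_erase]; tauto

namespace PartialNCPairing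

/-- The chords live on the symmetric difference, with larger ends `I \ J` and smaller ends `J \ I`;
the common points form `T`. -/
theorem exists_upper_lower {I J : Finset (Fin n)} (hI : I.card = k) (hJ : J.card = k)
    (hs : IsStandardPair I J) : ∃ p : PartialNCPairing k n, p.upper = I ∧ p.lower = J := by
  have h1 := Finset.card_sdiff_add_card_inter I J
  have h2 := Finset.card_sdiff_add_card_inter J I
  rw [Finset.inter_comm] at h2
  obtain ⟨f, hinv, hnc, hfX, hfY⟩ := exists_matching (I \ J).card (I \ J) (J \ I)
    disjoint_sdiff_sdiff rfl (by omega) (by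
      intro t
      have e : ∀ A B : Finset (Fin n), (A.filter (t ≤ ·)).card =
          ((A \ B).filter (t ≤ ·)).card + ((A ∩ B).filter (t ≤ ·)).card := fun A B => by
        rw [← Finset.card_union_of_disjoint (Finset.disjoint_filter_filter
          (Finset.disjoint_sdiff_inter A B)), ← Finset.filter_union, Finset.sdiff_union_inter]
      have h3 := hs t
      rw [e I J, e J I, Finset.inter_comm J I] at h3
      omega)
  have moved : ∀ i, f i ≠ i ↔ i ∈ I \ J ∨ i ∈ J \ I := fun i => by
    rw [← hfX, ← hfY]; exact lt_or_lt_iff_ne.symm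
  refine ⟨⟨f, I ∩ J, hinv, hnc, fun i hi => ?_, ?_⟩, ?_, ?_⟩
  · by_contra h
    rw [← ne_eq, moved] at h
    simp only [Finset.mem_inter, Finset.mem_sdiff] at h hi
    tauto
  · have : (Finset.univ.filter fun i => f i ≠ i) = (I \ J) ∪ (J \ I) := by
      ext i
      simp [moved]
    rw [this, Finset.card_union_of_disjoint disjoint_sdiff_sdiff]
    omega
  · ext i
    rw [mem_upper, hfX, Finset.mem_inter, Finset.mem_sdiff]
    tauto
  · ext i
    rw [mem_lower, hfY, Finset.mem_inter, Finset.mem_sdiff]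
    tauto

end PartialNCPairing

theorem IsStandardPair.orderEmbOfFin_le {I J : Finset (Fin n)} (hs : IsStandardPair I J)
    (hI : I.card = k) (hJ : J.card = k) (r : Fin k) : J.orderEmbOfFin hJ r ≤ I.orderEmbOfFin hI r := by
  by_contra hlt
  rw [not_le] at hlt
  have h1 := PartialNCPairing.posIn_eq_add_card_Ioo (s := I) hlt
  have h2 := hs (J.orderEmbOfFin hJ r)
  have e : ∀ (A : Finset (Fin n)) (t : Fin n), posIn A t + (A.filter (t ≤ ·)).card = A.card := by
    intro A t
    rw [posIn, ← Finset.card_filter_add_card_filter_not (s := A) (· < t)]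
    simp only [not_lt]
  have h3 := e I (J.orderEmbOfFin hJ r)
  have h4 := e J (J.orderEmbOfFin hJ r)
  rw [posIn_orderEmbOfFin] at h4
  rw [posIn_orderEmbOfFin, if_pos (Finset.orderEmbOfFin_mem I hI r)] at h1
  omega

theorem isStandardPair_of_orderEmb {f g : Fin k ↪o Fin n} (h : ∀ r, g r ≤ f r) :
    IsStandardPair (Finset.univ.map f.toEmbedding) (Finset.univ.map g.toEmbedding) := by
  intro t
  rw [Finset.filter_map, Finset.filter_map, Finset.card_map, Finset.card_map]
  refine Finset.card_le_card fun r => ?_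
  simp only [Finset.mem_filter, Finset.mem_univ, true_and, Function.comp_apply]
  exact fun hr => le_trans hr (h r)

theorem mem_twoColumnDiagram {i j : ℕ} : (i, j) ∈ twoColumnDiagram k ↔ i < k ∧ j < 2 := by
  rw [← YoungDiagram.mem_cells]
  simp [twoColumnDiagram]

/-- The semistandard tableau whose columns are the lower and the upper set of a pairing. -/
noncomputable def PartialNCPairing.toTableau (p : PartialNCPairing k n) : TwoColumnTableau k n :=
  -- Adding one passes from `Fin n` to `{1, ..., n}`; off the diagram a tableau has entry zero.
  ⟨{ entry := fun r c => if h : r < k then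
        (if c = 0 then (p.lower.orderEmbOfFin p.card_lower ⟨r, h⟩ : ℕ) + 1
          else if c = 1 then (p.upper.orderEmbOfFin p.card_upper ⟨r, h⟩ : ℕ) + 1 else 0) else 0
     row_weak' := by
      intro i j₁ j₂ hj hm
      obtain ⟨h1, h2⟩ := mem_twoColumnDiagram.1 hm
      obtain rfl : j₁ = 0 := by omega
      obtain rfl : j₂ = 1 := by omega
      simpa [h1] using p.isStandardPair.orderEmbOfFin_le p.card_upper p.card_lower ⟨i, h1⟩
     col_strict' := by
      intro i₁ i₂ j hi hm
      obtain ⟨h1, h2⟩ := mem_twoColumnDiagram.1 hm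
      have h3 : i₁ < k := hi.trans h1
      interval_cases j <;> simp [h1, h3, hi]
     zeros' := by
      intro i j hm
      rw [mem_twoColumnDiagram] at hm
      by_cases h : i < k
      · have h0 : j ≠ 0 := by omega
        have h1 : j ≠ 1 := by omega
        simp [h0, h1]
      · simp [h] }, by
    intro i j hm
    obtain ⟨h1, h2⟩ := mem_twoColumnDiagram.1 hm
    change 1 ≤ dite _ _ _ ∧ dite _ _ _ ≤ n
    interval_cases j <;> simp [h1]⟩

theorem PartialNCPairing.toTableau_zero (p : PartialNCPairing k n) (r : Fin k) :
    p.toTableau.1 r 0 = (p.lower.orderEmbOfFin p.card_lower r : ℕ) + 1 := by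
  change dite _ _ _ = _
  simp

theorem PartialNCPairing.toTableau_one (p : PartialNCPairing k n) (r : Fin k) :
    p.toTableau.1 r 1 = (p.upper.orderEmbOfFin p.card_upper r : ℕ) + 1 := by
  change dite _ _ _ = _
  simp

theorem orderEmbOfFin_injective {I J : Finset (Fin n)} (hI : I.card = k) (hJ : J.card = k)
    (h : ∀ r, I.orderEmbOfFin hI r = J.orderEmbOfFin hJ r) : I = J := by
  rw [← Finset.image_orderEmbOfFin_univ I hI, ← Finset.image_orderEmbOfFin_univ J hJ]
  exact Finset.image_congr fun r _ => h r

/-- Weak increase along the rows makes the two columns a standard pair, and `exists_upper_lower`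
realises every such pair. Injectivity holds because the upper and the lower set determine the
pairing. -/
theorem PartialNCPairing.toTableau_bijective :
    Function.Bijective (toTableau : PartialNCPairing k n → TwoColumnTableau k n) := by
  constructor
  · intro p q h
    apply eq_of_upper_eq_of_lower_eq
    · refine orderEmbOfFin_injective p.card_upper q.card_upper fun r => ?_
      have h1 := p.toTableau_one r
      rw [h, q.toTableau_one r] at h1
      exact Fin.ext (by omega)
    · refine orderEmbOfFin_injective p.card_lower q.card_lower fun r => ?_
      have h1 := p.toTableau_zero r
      rw [h, q.toTableau_zero r] at h1
      exact Fin.ext (by omega)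
  · rintro ⟨t, ht⟩
    have hmem : ∀ (r : Fin k) (j : ℕ), j < 2 → ((r : ℕ), j) ∈ twoColumnDiagram k := fun r j hj =>
      mem_twoColumnDiagram.2 ⟨r.2, hj⟩
    have hcol : ∀ j < 2, StrictMono fun r : Fin k => (⟨t r j - 1, by
        have := ht r j
        by_cases hj : j < 2
        · have := this (hmem r j hj); omega
        · rw [t.zeros (by rw [mem_twoColumnDiagram]; omega)]
          have := this
          have := ht r 0 (hmem r 0 (by omega))
          omega⟩ : Fin n) := by
      intro j hj r s hrs
      have h1 := t.col_strict (show (r : ℕ) < s from hrs) (hmem s j hj)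
      have h2 := ht r j (hmem r j hj)
      simp only [Fin.mk_lt_mk]
      omega
    set g := OrderEmbedding.ofStrictMono _ (hcol 0 (by omega)) with hg
    set f := OrderEmbedding.ofStrictMono _ (hcol 1 (by omega)) with hf
    have hgf : ∀ r, g r ≤ f r := by
      intro r
      have := t.row_weak (show 0 < 1 by omega) (hmem r 1 (by omega))
      simp only [hg, hf, OrderEmbedding.coe_ofStrictMono, Fin.mk_le_mk]
      omega
    obtain ⟨p, hp1, hp2⟩ := PartialNCPairing.exists_upper_lower (k := k) (by simp) (by simp)
      (isStandardPair_of_orderEmb hgf)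
    have e1 : f = p.upper.orderEmbOfFin p.card_upper :=
      Finset.orderEmbOfFin_unique' _ fun r => by rw [hp1]; simp
    have e0 : g = p.lower.orderEmbOfFin p.card_lower :=
      Finset.orderEmbOfFin_unique' _ fun r => by rw [hp2]; simp
    refine ⟨p, Subtype.ext (SemistandardYoungTableau.ext fun i j => ?_)⟩
    by_cases hm : (i, j) ∈ twoColumnDiagram k
    · obtain ⟨hi, hj⟩ := mem_twoColumnDiagram.1 hm
      have h2 := ht i j hm
      interval_cases j
      · rw [p.toTableau_zero ⟨i, hi⟩, ← e0]
        simp only [hg, OrderEmbedding.coe_ofStrictMono]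
        omega
      · rw [p.toTableau_one ⟨i, hi⟩, ← e1]
        simp only [hf, OrderEmbedding.coe_ofStrictMono]
        omega
    · rw [t.zeros hm, p.toTableau.1.zeros hm]

end Matching

/-! ### Curves in the disk that join alternating points of the circle. -/

section CrossingPaths

open Complex

/-- By the half-angle formulas `1 - exp (φ * I)` is `2 sin (φ / 2)` times the unit vector of
argument `(φ - π) / 2`. -/
theorem Complex.arg_one_sub_exp_of_pos {φ : ℝ} (h0 : 0 < φ) (h1 : φ < 2 * Real.pi) :
    (1 - exp (φ * I)).arg = (φ - Real.pi) / 2 := by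
  have hs : 0 < 2 * Real.sin (φ / 2) := by
    have := Real.sin_pos_of_pos_of_lt_pi (x := φ / 2) (by linarith) (by linarith)
    linarith
  have key : 1 - exp (φ * I) = ((2 * Real.sin (φ / 2) : ℝ) : ℂ) *
      (cos (((φ - Real.pi) / 2 : ℝ) : ℂ) + sin (((φ - Real.pi) / 2 : ℝ) : ℂ) * I) := by
    have e1 : ((φ - Real.pi) / 2 : ℝ) = φ / 2 - Real.pi / 2 := by ring
    rw [e1, ← ofReal_cos, ← ofReal_sin, Real.cos_sub_pi_div_two, Real.sin_sub_pi_div_two,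
      exp_mul_I, ← ofReal_cos, ← ofReal_sin]
    have hc : Real.cos φ = 1 - 2 * Real.sin (φ / 2) ^ 2 := by
      rw [Real.sin_sq_eq_half_sub]; ring_nf
    have hsn : Real.sin φ = 2 * Real.sin (φ / 2) * Real.cos (φ / 2) := by
      rw [← Real.sin_two_mul]; ring_nf
    rw [hc, hsn]
    push_cast
    ring
  rw [key]
  exact arg_mul_cos_add_sin_mul_I hs ⟨by linarith [Real.pi_pos], by linarith [Real.pi_pos]⟩

theorem Complex.arg_one_sub_exp_of_neg {φ : ℝ} (h0 : φ < 0) (h1 : -(2 * Real.pi) < φ) :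
    (1 - exp (φ * I)).arg = (φ + Real.pi) / 2 := by
  have := arg_one_sub_exp_of_pos (φ := φ + 2 * Real.pi) (by linarith) (by linarith)
  push_cast at this
  rw [add_mul, exp_add, exp_two_pi_mul_I, mul_one] at this
  rw [this]
  ring

theorem re_one_sub_pos {z : ℂ} (hz : ‖z‖ ≤ 1) (h1 : z ≠ 1) : 0 < (1 - z).re := by
  rw [sub_re, one_re, sub_pos]
  refine lt_of_le_of_ne ((re_le_norm z).trans hz) fun h => h1 ?_
  have h2 : z.re ^ 2 + z.im ^ 2 ≤ 1 := by
    have := Complex.sq_norm_sub_sq_re z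
    have h3 : ‖z‖ ^ 2 ≤ 1 := pow_le_one₀ (norm_nonneg z) hz
    linarith
  rw [h] at h2
  have : z.im = 0 := by nlinarith
  exact Complex.ext h this

/-- A continuous logarithm along a curve in the closed unit disk seen from a point of the unit
circle. -/
theorem log_sub_log_of_disk {γ : unitInterval → ℂ} (hγ : Continuous γ) (hd : ∀ t, ‖γ t‖ ≤ 1)
    {θ : ℝ} (hne : ∀ t, γ t ≠ exp (θ * I)) {c : ℂ} (hc : c ≠ 0) {L : unitInterval → ℂ}
    (hL : Continuous L)
    (hexp : ∀ t, exp (L t) = c * (exp (θ * I) - γ t)) :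
    L 1 - L 0 = log (1 - exp (-θ * I) * γ 1) - log (1 - exp (-θ * I) * γ 0) := by
  set z : unitInterval → ℂ := fun t => exp (-θ * I) * γ t with hz
  have hinv : exp (θ * I) * exp (-θ * I) = 1 := by rw [← exp_add]; simp
  have hzn : ∀ t, ‖z t‖ ≤ 1 := fun t => by
    have : ‖exp (-θ * I)‖ = 1 := by
      rw [show (-θ * I : ℂ) = ((-θ : ℝ) : ℂ) * I by push_cast; ring]
      exact norm_exp_ofReal_mul_I _
    rw [hz, norm_mul, this, one_mul]
    exact hd t
  have hz1 : ∀ t, z t ≠ 1 := fun t h => hne t (by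
    have : exp (θ * I) * z t = γ t := by rw [hz]; simp only; rw [← mul_assoc, hinv, one_mul]
    rw [← this, h, mul_one])
  -- After rotation the curve `1 - z t` stays in the right half plane, where the principal logarithm
  -- is continuous.
  have hre : ∀ t, 0 < (1 - z t).re := fun t => re_one_sub_pos (hzn t) (hz1 t)
  have hslit : ∀ t, 1 - z t ∈ slitPlane := fun t => Or.inl (hre t)
  have hcont : Continuous fun t => L t - log (1 - z t) :=
    hL.sub (Continuous.clog (continuous_const.sub (continuous_const.mul hγ)) hslit)
  have hconst : ∀ t, exp (L t - log (1 - z t)) = c * exp (θ * I) := fun t => by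
    rw [exp_sub, hexp, exp_log (slitPlane_ne_zero (hslit t)), div_eq_iff (slitPlane_ne_zero (hslit t))]
    simp only [hz]
    linear_combination c * γ t * hinv
  -- `L - log (1 - z)` lifts a constant through the covering `exp`, so it is constant.
  have key : L 0 - log (1 - z 0) = L 1 - log (1 - z 1) := by
    have hne' : c * exp (θ * I) ≠ 0 := mul_ne_zero hc (exp_ne_zero _)
    have := isCoveringMap_exp.eq_of_comp_eq (A := unitInterval)
      (g₁ := fun t => L t - log (1 - z t)) (g₂ := fun _ => L 0 - log (1 - z 0)) hcont
      continuous_const (by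
        funext t
        simp only [Function.comp, Subtype.mk.injEq]
        rw [hconst, hconst]) 0 rfl
    exact (congrFun this 1).symm
  linear_combination -key

/-- Two disjoint curves in the closed unit disk do not join alternating points of the circle. -/
theorem not_disjoint_of_alternate {θ₁ θ₂ θ₃ θ₄ : ℝ} (h12 : θ₂ < θ₁) (h23 : θ₃ < θ₂) (h34 : θ₄ < θ₃)
    (h41 : θ₁ < θ₄ + 2 * Real.pi) (α : Path (exp (θ₁ * I)) (exp (θ₃ * I)))
    (β : Path (exp (θ₂ * I)) (exp (θ₄ * I))) (hα : ∀ t, ‖α t‖ ≤ 1) (hβ : ∀ t, ‖β t‖ ≤ 1) :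
    ∃ s t, α s = β t := by
  by_contra! hne
  have hcontr := (convex_univ (𝕜 := ℝ) (E := ℝ × ℝ)).contractibleSpace Set.univ_nonempty
  -- For disjoint curves `α s - β t` never vanishes. Extended to the simply connected plane by
  -- clamping both parameters, it has a continuous logarithm `L`.
  obtain ⟨L, hLc, hL⟩ := exists_continuousOn_eqOn_exp_comp (X := ℝ × ℝ) (U := Set.univ)
    (SimplyConnectedSpace.ofContractible _) isOpen_univ
    (g := fun x => α (Set.projIcc 0 1 zero_le_one x.1) - β (Set.projIcc 0 1 zero_le_one x.2))
    (by fun_prop) (by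
      rintro ⟨x, -, hx⟩
      exact hne _ _ (sub_eq_zero.1 hx))
  rw [continuousOn_univ] at hLc
  have hL' : ∀ s t : unitInterval, exp (L (s, t)) = α s - β t := fun s t => by
    have := hL (Set.mem_univ ((s : ℝ), (t : ℝ)))
    simpa using this
  have bottom := log_sub_log_of_disk β.continuous hβ (θ := θ₁)
    (fun t h => hne 0 t (by rw [h, α.source])) one_ne_zero (L := fun t => L (0, (t : ℝ)))
    (by fun_prop) (fun t => by
      have := hL' 0 t
      rw [α.source] at this
      simpa using this)
  have top := log_sub_log_of_disk β.continuous hβ (θ := θ₃)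
    (fun t h => hne 1 t (by rw [h, α.target])) one_ne_zero (L := fun t => L (1, (t : ℝ)))
    (by fun_prop) (fun t => by
      have := hL' 1 t
      rw [α.target] at this
      simpa using this)
  have left := log_sub_log_of_disk α.continuous hα (θ := θ₂)
    (fun t h => hne t 0 (by rw [h, β.source])) (neg_ne_zero.2 one_ne_zero)
    (L := fun t => L ((t : ℝ), 0))
    (by fun_prop) (fun t => by
      have := hL' t 0
      rw [β.source] at this
      simpa using this)
  have right := log_sub_log_of_disk α.continuous hα (θ := θ₄)
    (fun t h => hne t 1 (by rw [h, β.target])) (neg_ne_zero.2 one_ne_zero)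
    (L := fun t => L ((t : ℝ), 1))
    (by fun_prop) (fun t => by
      have := hL' t 1
      rw [β.target] at this
      simpa using this)
  have e : ∀ x y : ℝ, exp (-x * I) * exp (y * I) = exp (((y - x : ℝ) : ℂ) * I) := fun x y => by
    rw [← exp_add]; push_cast; ring_nf
  rw [α.source, α.target, e, e] at left right
  rw [β.source, β.target, e, e] at bottom top
  have hb := congrArg Complex.im bottom
  have ht := congrArg Complex.im top
  have hl := congrArg Complex.im left
  have hr := congrArg Complex.im right
  simp only [sub_im, log_im, Set.Icc.coe_one, Set.Icc.coe_zero] at hb ht hl hr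
  -- On the sides seen from `θ₁` and `θ₄` the imaginary part of `L` changes by half the difference
  -- of the end angles; on those seen from `θ₂` and `θ₃` it changes by `π` more. The two routes from
  -- `(0, 0)` to `(1, 1)` along the square would then differ by `2 * π`.
  rw [arg_one_sub_exp_of_neg (by linarith) (by linarith),
    arg_one_sub_exp_of_neg (by linarith) (by linarith)] at hb
  rw [arg_one_sub_exp_of_neg (by linarith) (by linarith),
    arg_one_sub_exp_of_pos (by linarith) (by linarith)] at ht
  rw [arg_one_sub_exp_of_neg (by linarith) (by linarith),
    arg_one_sub_exp_of_pos (by linarith) (by linarith)] at hl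
  rw [arg_one_sub_exp_of_pos (by linarith) (by linarith),
    arg_one_sub_exp_of_pos (by linarith) (by linarith)] at hr
  linarith [Real.pi_pos]

end CrossingPaths

/-! ### Maximal chains, and the union of two dimer configurations. -/

/-- Take a longest injective chain through `a`. If an end can be continued, the next element is
already in the chain by maximality, and it must be the opposite end because `R` is functional in
both directions; then the chain closes up to a cycle, with `r + 1` wrapping around in `Fin (m + 1)`.
-/
theorem exists_maximal_chain {α : Type*} [Finite α] {R : α → α → Prop}
    (hf : ∀ a b c, R a b → R a c → b = c) (hi : ∀ a b c, R a c → R b c → a = b) (a : α) :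
    (∃ (m : ℕ) (c : Fin (m + 1) → α), Function.Injective c ∧ a ∈ Set.range c ∧
      ∀ r, R (c r) (c (r + 1))) ∨
    ∃ (m : ℕ) (c : Fin (m + 1) → α), Function.Injective c ∧ a ∈ Set.range c ∧
      (∀ r : Fin m, R (c r.castSucc) (c r.succ)) ∧ (∀ b, ¬ R b (c 0)) ∧
        ∀ b, ¬ R (c (Fin.last m)) b := by
  set M : Set ℕ := {m | ∃ c : Fin (m + 1) → α, Function.Injective c ∧ a ∈ Set.range c ∧
    ∀ r : Fin m, R (c r.castSucc) (c r.succ)} with hM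
  have hne : M.Nonempty := ⟨0, fun _ => a, fun x y _ => Fin.ext (by omega), ⟨0, rfl⟩,
    fun r => r.elim0⟩
  have hbd : BddAbove M := by
    refine ⟨Nat.card α, ?_⟩
    rintro m ⟨c, hc, -⟩
    have := Nat.card_le_card_of_injective c hc
    rw [Nat.card_fin] at this
    omega
  obtain ⟨m, ⟨c, hc, ha, hR⟩, hmax⟩ : ∃ m ∈ M, m + 1 ∉ M :=
    ⟨sSup M, Nat.sSup_mem hne hbd, fun h => absurd (le_csSup hbd h) (by omega)⟩
  have cyc : R (c (Fin.last m)) (c 0) → ∀ r, R (c r) (c (r + 1)) := by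
    intro h r
    induction r using Fin.lastCases with
    | last => simpa using h
    | cast r => simpa using hR r
  by_cases h1 : ∃ b, R (c (Fin.last m)) b
  · left
    obtain ⟨b, hb⟩ := h1
    refine ⟨m, c, hc, ha, cyc ?_⟩
    by_cases hbc : b ∈ Set.range c
    · obtain ⟨r, rfl⟩ := hbc
      induction r using Fin.cases with
      | zero => exact hb
      | succ r =>
        have := hc (hi _ _ _ hb (hR r))
        exact absurd this (Fin.castSucc_lt_last r).ne'
    · exfalso
      refine hmax ⟨Fin.snoc c b, Fin.snoc_injective_iff.2 ⟨hc, hbc⟩, ?_, fun r => ?_⟩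
      · obtain ⟨r, rfl⟩ := ha
        exact ⟨r.castSucc, by simp⟩
      · induction r using Fin.lastCases with
        | last => simpa using hb
        | cast r => rw [← Fin.castSucc_succ, Fin.snoc_castSucc, Fin.snoc_castSucc]; exact hR r
  by_cases h2 : ∃ b, R b (c 0)
  · left
    obtain ⟨b, hb⟩ := h2
    refine ⟨m, c, hc, ha, cyc ?_⟩
    by_cases hbc : b ∈ Set.range c
    · obtain ⟨r, rfl⟩ := hbc
      induction r using Fin.lastCases with
      | last => exact hb
      | cast r =>
        have := hc (hf _ _ _ hb (hR r))
        exact absurd this (Fin.succ_ne_zero r).symm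
    · exfalso
      refine hmax ⟨Fin.cons b c, Fin.cons_injective_iff.2 ⟨hbc, hc⟩, ?_, fun r => ?_⟩
      · obtain ⟨r, rfl⟩ := ha
        exact ⟨r.succ, by simp⟩
      · induction r using Fin.cases with
        | zero => simpa using hb
        | succ r => simpa using hR r
  · right
    push Not at h1 h2
    exact ⟨m, c, hc, ha, hR, h2, h1⟩

namespace DiskNetwork

open Classical

variable {n : ℕ} (N : DiskNetwork n)

theorem incident_black {e : N.E} {u : N.V ⊕ Fin n} (h : N.Incident e u) (hu : N.white u = false) :
    N.blackEnd e = u := by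
  rcases h with h | h
  · exact h
  · rw [← h, N.whiteEnd_color] at hu
    cases hu

theorem incident_white {e : N.E} {u : N.V ⊕ Fin n} (h : N.Incident e u) (hu : N.white u = true) :
    N.whiteEnd e = u := by
  rcases h with h | h
  · rw [← h, N.blackEnd_color] at hu
    cases hu
  · exact h

theorem eq_of_incident_boundary {e f : N.E} {i : Fin n} (he : N.Incident e (Sum.inr i))
    (hf : N.Incident f (Sum.inr i)) : e = f := (N.boundary_degree i).unique he hf

theorem exists_interior (e : N.E) : ∃ v, N.Incident e (Sum.inl v) := by
  rcases hb : N.blackEnd e with v | i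
  · exact ⟨v, Or.inl hb⟩
  · rcases hw : N.whiteEnd e with v | j
    · exact ⟨v, Or.inr hw⟩
    · exact absurd ⟨hb, hw⟩ (N.boundary_not_adjacent e i j)

/-- The component of the subgraph `S` that contains the edge `e`. -/
noncomputable def componentOf (S : Finset N.E) (e : N.E) : Finset N.E :=
  S.filter fun f => Relation.ReflTransGen (N.Touch S) e f

variable {N}

theorem mem_components {S C : Finset N.E} :
    C ∈ N.components S ↔ ∃ e ∈ S, N.componentOf S e = C := by
  simp only [components, componentOf, Finset.mem_image]

theorem mem_componentOf {S : Finset N.E} {e f : N.E} :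
    f ∈ N.componentOf S e ↔ f ∈ S ∧ Relation.ReflTransGen (N.Touch S) e f := by
  simp [componentOf]

theorem Touch.symm {S : Finset N.E} {e f : N.E} (h : N.Touch S e f) : N.Touch S f e := by
  obtain ⟨h1, h2, u, h3, h4⟩ := h
  exact ⟨h2, h1, u, h4, h3⟩

theorem reflTransGen_touch_symm {S : Finset N.E} {e f : N.E}
    (h : Relation.ReflTransGen (N.Touch S) e f) : Relation.ReflTransGen (N.Touch S) f e := by
  induction h with
  | refl => exact .refl
  | tail _ h ih => exact (Relation.ReflTransGen.single h.symm).trans ih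

theorem componentOf_eq_of_mem {S C : Finset N.E} (hC : C ∈ N.components S) {e : N.E} (he : e ∈ C) :
    N.componentOf S e = C := by
  obtain ⟨f, hf, rfl⟩ := mem_components.1 hC
  ext g
  rw [mem_componentOf] at he ⊢
  rw [mem_componentOf]
  exact and_congr_right fun _ => ⟨he.2.trans, (reflTransGen_touch_symm he.2).trans⟩

theorem component_subset {S C : Finset N.E} (hC : C ∈ N.components S) : C ⊆ S := by
  obtain ⟨f, hf, rfl⟩ := mem_components.1 hC
  exact Finset.filter_subset _ _

theorem mem_componentOf_self {S : Finset N.E} {e : N.E} (he : e ∈ S) : e ∈ N.componentOf S e :=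
  mem_componentOf.2 ⟨he, .refl⟩

theorem componentOf_mem {S : Finset N.E} {e : N.E} (he : e ∈ S) :
    N.componentOf S e ∈ N.components S := mem_components.2 ⟨e, he, rfl⟩

theorem component_nonempty {S C : Finset N.E} (hC : C ∈ N.components S) : C.Nonempty := by
  obtain ⟨f, hf, rfl⟩ := mem_components.1 hC
  exact ⟨f, mem_componentOf_self hf⟩

theorem component_eq_of_incident {S C C' : Finset N.E} (hC : C ∈ N.components S)
    (hC' : C' ∈ N.components S) {e f : N.E} (he : e ∈ C) (hf : f ∈ C') {u : N.V ⊕ Fin n}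
    (heu : N.Incident e u) (hfu : N.Incident f u) : C = C' := by
  rw [← componentOf_eq_of_mem hC he]
  refine componentOf_eq_of_mem hC' ?_ ▸ rfl
  rw [← componentOf_eq_of_mem hC' hf]
  exact mem_componentOf.2 ⟨component_subset hC he,
    .single ⟨component_subset hC' hf, component_subset hC he, u, hfu, heu⟩⟩

theorem mem_component_of_incident {S C : Finset N.E} (hC : C ∈ N.components S) {e f : N.E}
    (he : e ∈ C) (hf : f ∈ S) {u : N.V ⊕ Fin n} (heu : N.Incident e u) (hfu : N.Incident f u) :
    f ∈ C := by
  rw [component_eq_of_incident hC (componentOf_mem hf) he (mem_componentOf_self hf) heu hfu]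
  exact mem_componentOf_self hf

theorem componentOf_eq {S C : Finset N.E} {e : N.E} (hCS : C ⊆ S) (he : e ∈ C)
    (hcl : ∀ f ∈ C, ∀ g ∈ S, ∀ u, N.Incident f u → N.Incident g u → g ∈ C)
    (hcon : ∀ f ∈ C, Relation.ReflTransGen (N.Touch S) e f) : N.componentOf S e = C := by
  ext g
  rw [mem_componentOf]
  constructor
  · rintro ⟨-, h⟩
    induction h with
    | refl => exact he
    | tail _ h ih =>
      obtain ⟨_, h2, u, h3, h4⟩ := h
      exact hcl _ ih _ h2 u h3 h4
  · exact fun hg => ⟨hCS hg, hcon g hg⟩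

section Union

variable {P Q : Finset N.E}

variable (N) in
/-- The start of an edge when the edges in `P` are directed from white to black and all others from
black to white. -/
noncomputable def tail (P : Finset N.E) (e : N.E) : N.V ⊕ Fin n :=
  if e ∈ P then N.whiteEnd e else N.blackEnd e

variable (N) in
/-- The end of an edge when the edges in `P` are directed from white to black and all others from
black to white. -/
noncomputable def head (P : Finset N.E) (e : N.E) : N.V ⊕ Fin n :=
  if e ∈ P then N.blackEnd e else N.whiteEnd e

theorem joins_tail_head (e : N.E) : N.Joins e (N.tail P e) (N.head P e) := by
  unfold tail head
  split_ifs
  · exact Or.inr ⟨rfl, rfl⟩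
  · exact Or.inl ⟨rfl, rfl⟩

theorem incident_iff_tail_or_head (e : N.E) (u : N.V ⊕ Fin n) :
    N.Incident e u ↔ N.tail P e = u ∨ N.head P e = u := by
  unfold tail head Incident
  split_ifs
  · exact or_comm
  · rfl

theorem tail_ne_head (e : N.E) : N.tail P e ≠ N.head P e := by
  intro h
  have h1 := N.blackEnd_color e
  have h2 := N.whiteEnd_color e
  unfold tail head at h
  split_ifs at h
  · rw [h, h1] at h2; cases h2
  · rw [h, h2] at h1; cases h1

/-- An edge of the symmetric difference that starts at a white vertex is in `P`, one that starts at
a black vertex is in `Q`. Either configuration has only one edge at an interior vertex, and boundary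
vertices have degree one. -/
theorem tail_injOn (hP : N.IsDimer P) (hQ : N.IsDimer Q) {e f : N.E} (he : e ∈ symmDiff P Q)
    (hf : f ∈ symmDiff P Q) (h : N.tail P e = N.tail P f) : e = f := by
  have h1 : N.Incident e (N.tail P e) := (incident_iff_tail_or_head (P := P) e _).2 (Or.inl rfl)
  have h2 : N.Incident f (N.tail P e) := (incident_iff_tail_or_head (P := P) f _).2 (Or.inl h.symm)
  rw [Finset.mem_symmDiff] at he hf
  rcases hu : N.tail P e with v | i
  · rw [hu] at h1 h2 h
    have c1 := N.blackEnd_color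
    have c2 := N.whiteEnd_color
    by_cases heP : e ∈ P
    · by_cases hfP : f ∈ P
      · exact (hP v).unique ⟨heP, h1⟩ ⟨hfP, h2⟩
      · have := c1 f
        have := c2 e
        simp only [tail, heP, hfP, if_true, if_false] at hu h
        simp_all
    · by_cases hfP : f ∈ P
      · have := c1 e
        have := c2 f
        simp only [tail, heP, hfP, if_true, if_false] at hu h
        simp_all
      · exact (hQ v).unique ⟨by tauto, h1⟩ ⟨by tauto, h2⟩
  · rw [hu] at h1 h2
    exact N.eq_of_incident_boundary h1 h2

/-- Exchanging `P` and `Q` reverses all edges of the symmetric difference, so facts about tails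
yield facts about heads. -/
theorem head_eq_tail {e : N.E} (he : e ∈ symmDiff P Q) : N.head P e = N.tail Q e := by
  rw [Finset.mem_symmDiff] at he
  unfold head tail
  rcases he with ⟨h1, h2⟩ | ⟨h1, h2⟩ <;> simp [h1, h2]

theorem head_injOn (hP : N.IsDimer P) (hQ : N.IsDimer Q) {e f : N.E} (he : e ∈ symmDiff P Q)
    (hf : f ∈ symmDiff P Q) (h : N.head P e = N.head P f) : e = f := by
  rw [head_eq_tail he, head_eq_tail hf] at h
  rw [symmDiff_comm] at he hf
  exact tail_injOn hQ hP he hf h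

theorem exists_tail_eq_head (hP : N.IsDimer P) (hQ : N.IsDimer Q) {e : N.E}
    (he : e ∈ symmDiff P Q) {v : N.V} (hv : N.head P e = Sum.inl v) :
    ∃ f ∈ symmDiff P Q, N.tail P f = Sum.inl v := by
  have hinc : N.Incident e (Sum.inl v) := (incident_iff_tail_or_head (P := P) e _).2 (Or.inr hv)
  rw [Finset.mem_symmDiff] at he
  rcases he with ⟨h1, h2⟩ | ⟨h1, h2⟩
  · obtain ⟨f, ⟨hfQ, hfv⟩, -⟩ := hQ v
    have hfP : f ∉ P := fun h => h2 ((hP v).unique ⟨h, hfv⟩ ⟨h1, hinc⟩ ▸ hfQ)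
    refine ⟨f, Finset.mem_symmDiff.2 (Or.inr ⟨hfQ, hfP⟩), ?_⟩
    rw [tail, if_neg hfP]
    apply N.incident_black hfv
    rw [head, if_pos h1] at hv
    rw [← hv, N.blackEnd_color]
  · obtain ⟨f, ⟨hfP, hfv⟩, -⟩ := hP v
    have hfQ : f ∉ Q := fun h => h2 ((hQ v).unique ⟨h, hfv⟩ ⟨h1, hinc⟩ ▸ hfP)
    refine ⟨f, Finset.mem_symmDiff.2 (Or.inl ⟨hfP, hfQ⟩), ?_⟩
    rw [tail, if_pos hfP]
    apply N.incident_white hfv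
    rw [head, if_neg h2] at hv
    rw [← hv, N.whiteEnd_color]

theorem exists_head_eq_tail (hP : N.IsDimer P) (hQ : N.IsDimer Q) {e : N.E}
    (he : e ∈ symmDiff P Q) {v : N.V} (hv : N.tail P e = Sum.inl v) :
    ∃ f ∈ symmDiff P Q, N.head P f = Sum.inl v := by
  have he' := he
  rw [symmDiff_comm] at he'
  rw [← head_eq_tail he'] at hv
  obtain ⟨f, hf, h⟩ := exists_tail_eq_head hQ hP he' hv
  rw [symmDiff_comm] at hf
  exact ⟨f, hf, (head_eq_tail hf).trans h⟩

/-- At an interior vertex on an edge of the symmetric difference of two dimer configurations there is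
one further edge. -/
theorem eq_or_consecutive (hP : N.IsDimer P) (hQ : N.IsDimer Q) {e g : N.E}
    (he : e ∈ symmDiff P Q) (hg : g ∈ P ∪ Q) {v : N.V} (hev : N.Incident e (Sum.inl v))
    (hgv : N.Incident g (Sum.inl v)) : g = e ∨ g ∈ symmDiff P Q ∧
      ((N.head P e = Sum.inl v ∧ N.tail P g = Sum.inl v) ∨
        (N.head P g = Sum.inl v ∧ N.tail P e = Sum.inl v)) := by
  by_cases hge : g = e
  · exact Or.inl hge
  right
  have hgd : g ∈ symmDiff P Q := by
    rw [Finset.mem_symmDiff] at he ⊢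
    rw [Finset.mem_union] at hg
    by_contra hcon
    have hgPQ : g ∈ P ∧ g ∈ Q := by tauto
    rcases he with ⟨h1, -⟩ | ⟨h1, -⟩
    · exact hge ((hP v).unique ⟨hgPQ.1, hgv⟩ ⟨h1, hev⟩)
    · exact hge ((hQ v).unique ⟨hgPQ.2, hgv⟩ ⟨h1, hev⟩)
  refine ⟨hgd, ?_⟩
  rcases (incident_iff_tail_or_head (P := P) e _).1 hev with h1 | h1 <;>
    rcases (incident_iff_tail_or_head (P := P) g _).1 hgv with h2 | h2
  · exact absurd (tail_injOn hP hQ hgd he (h2.trans h1.symm)) hge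
  · exact Or.inr ⟨h2, h1⟩
  · exact Or.inl ⟨h1, h2⟩
  · exact absurd (head_injOn hP hQ hgd he (h2.trans h1.symm)) hge

theorem componentOf_eq_singleton (hP : N.IsDimer P) (hQ : N.IsDimer Q) {e : N.E} (heP : e ∈ P)
    (heQ : e ∈ Q) : N.componentOf (P ∪ Q) e = {e} := by
  refine componentOf_eq (by simp [heP]) (by simp) ?_ ?_
  · intro f hf g hg u hfu hgu
    rw [Finset.mem_singleton] at hf ⊢
    subst hf
    rcases u with v | i
    · rcases Finset.mem_union.1 hg with h | h
      · exact (hP v).unique ⟨h, hgu⟩ ⟨heP, hfu⟩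
      · exact (hQ v).unique ⟨h, hgu⟩ ⟨heQ, hfu⟩
    · exact N.eq_of_incident_boundary hgu hfu
  · intro f hf
    rw [Finset.mem_singleton] at hf
    rw [hf]

/-- At an interior vertex of the chain any other edge of `P ∪ Q` is a successor or a predecessor
(`eq_or_consecutive`), so a chain closed under both is a whole component. -/
theorem componentOf_eq_image (hP : N.IsDimer P) (hQ : N.IsDimer Q) {m : ℕ} {c : Fin (m + 1) → N.E}
    {e : N.E} (he : e ∈ Set.range c) (hc : ∀ r, c r ∈ symmDiff P Q)
    (hcon : ∀ r : Fin m, ∃ u, N.Incident (c r.castSucc) u ∧ N.Incident (c r.succ) u)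
    (hnext : ∀ r, ∀ g ∈ symmDiff P Q, ∀ v, N.head P (c r) = Sum.inl v → N.tail P g = Sum.inl v →
      g ∈ Set.range c)
    (hprev : ∀ r, ∀ g ∈ symmDiff P Q, ∀ v, N.head P g = Sum.inl v → N.tail P (c r) = Sum.inl v →
      g ∈ Set.range c) :
    N.componentOf (P ∪ Q) e = Finset.univ.image c := by
  have hsub : ∀ r, c r ∈ P ∪ Q := fun r => by
    have := hc r
    rw [Finset.mem_symmDiff] at this
    rw [Finset.mem_union]
    tauto
  have h0 : ∀ r, Relation.ReflTransGen (N.Touch (P ∪ Q)) (c 0) (c r) := by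
    intro r
    induction r using Fin.induction with
    | zero => exact .refl
    | succ r ih =>
      obtain ⟨u, h1, h2⟩ := hcon r
      exact ih.tail ⟨hsub _, hsub _, u, h1, h2⟩
  obtain ⟨s, rfl⟩ := he
  refine componentOf_eq ?_ (by simp) ?_ ?_
  · intro f hf
    obtain ⟨r, -, rfl⟩ := Finset.mem_image.1 hf
    exact hsub r
  · intro f hf g hg u hfu hgu
    obtain ⟨r, -, rfl⟩ := Finset.mem_image.1 hf
    rcases u with v | i
    · have : g ∈ Set.range c := by
        rcases eq_or_consecutive hP hQ (hc r) hg hfu hgu with rfl | ⟨hgd, ⟨h1, h2⟩ | ⟨h1, h2⟩⟩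
        · exact ⟨r, rfl⟩
        · exact hnext r g hgd v h1 h2
        · exact hprev r g hgd v h1 h2
      simpa using this
    · rw [N.eq_of_incident_boundary hgu hfu]
      simp
  · intro f hf
    obtain ⟨r, -, rfl⟩ := Finset.mem_image.1 hf
    exact (reflTransGen_touch_symm (h0 s)).trans (h0 r)

/-- The union of two dimer configurations is a Temperley-Lieb subgraph. -/
theorem isTLSubgraph_union (hP : N.IsDimer P) (hQ : N.IsDimer Q) : N.IsTLSubgraph (P ∪ Q) := by
  constructor
  · intro C hC
    obtain ⟨e, he, rfl⟩ := mem_components.1 hC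
    by_cases hed : e ∈ symmDiff P Q
    swap
    · have : e ∈ P ∧ e ∈ Q := by
        rw [Finset.mem_symmDiff] at hed
        rw [Finset.mem_union] at he
        tauto
      exact Or.inr (Or.inr ⟨e, componentOf_eq_singleton hP hQ this.1 this.2⟩)
    -- Two edges are related when the second follows the first at an interior vertex. The cyclic
    -- chains become interior cycles, the others boundary paths.
    set R : {e // e ∈ symmDiff P Q} → {e // e ∈ symmDiff P Q} → Prop := fun f g =>
      ∃ v, N.head P f.1 = Sum.inl v ∧ N.tail P g.1 = Sum.inl v with hR
    have hf : ∀ a b c, R a b → R a c → b = c := by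
      rintro a b c ⟨v, h1, h2⟩ ⟨w, h3, h4⟩
      rw [h1] at h3
      exact Subtype.ext (tail_injOn hP hQ b.2 c.2 (h2.trans (h3.trans h4.symm)))
    have hi : ∀ a b c, R a c → R b c → a = b := by
      rintro a b c ⟨v, h1, h2⟩ ⟨w, h3, h4⟩
      rw [h2] at h4
      exact Subtype.ext (head_injOn hP hQ a.2 b.2 (h1.trans (h4.trans h3.symm)))
    rcases exists_maximal_chain hf hi ⟨e, hed⟩ with ⟨m, c, hc, ⟨s, hs⟩, hcyc⟩ |
      ⟨m, c, hc, ⟨s, hs⟩, hpath, hstart, hend⟩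
    · right; left
      -- A cycle of length one would be a loop, which the colouring excludes.
      rcases m with _ | m
      · obtain ⟨v, h1, h2⟩ := hcyc 0
        exact absurd (h2.trans h1.symm) (tail_ne_head _)
      choose w hw1 hw2 using hcyc
      have hw3 : ∀ r, N.tail P (c r).1 = Sum.inl (w (r - 1)) := fun r => by
        have := hw2 (r - 1)
        rwa [sub_add_cancel] at this
      have hcomp := componentOf_eq_image hP hQ (c := fun r => (c r).1) (e := e) ⟨s, by simp [hs]⟩
        (fun r => (c r).2)
        (fun r => by
          have h1 := hw1 r.castSucc
          have h2 := hw2 r.castSucc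
          rw [Fin.coeSucc_eq_succ] at h2
          exact ⟨_, (incident_iff_tail_or_head (P := P) _ _).2 (Or.inr h1),
            (incident_iff_tail_or_head (P := P) _ _).2 (Or.inl h2)⟩)
        (fun r g hg v h1 h2 => ⟨r + 1, by
          have : c (r + 1) = ⟨g, hg⟩ := hf (c r) _ _ ⟨_, hw1 r, hw2 r⟩ ⟨v, h1, h2⟩
          simp [this]⟩)
        (fun r g hg v h1 h2 => ⟨r - 1, by
          have : c (r - 1) = ⟨g, hg⟩ := hi _ _ (c r) ⟨_, hw1 _, by rw [hw3]⟩ ⟨v, h1, h2⟩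
          simp [this]⟩)
      refine ⟨m, fun r => w (r - 1), fun r => (c r).1, ?_, ?_, ?_, ?_⟩
      · intro r s hrs
        apply hc
        apply Subtype.ext
        apply tail_injOn hP hQ (c r).2 (c s).2
        rw [hw3, hw3]; exact congrArg Sum.inl hrs
      · exact fun r s h => hc (Subtype.ext h)
      · intro r
        have := joins_tail_head (P := P) (c r).1
        rw [hw1, hw3] at this
        simpa using this
      · intro f
        rw [hcomp]
        simp
    · left
      have hcomp := componentOf_eq_image hP hQ (c := fun r => (c r).1) (e := e) ⟨s, by simp [hs]⟩
        (fun r => (c r).2)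
        (fun r => by
          obtain ⟨v, h1, h2⟩ := hpath r
          exact ⟨_, (incident_iff_tail_or_head (P := P) _ _).2 (Or.inr h1),
            (incident_iff_tail_or_head (P := P) _ _).2 (Or.inl h2)⟩)
        (fun r g hg v h1 h2 => by
          induction r using Fin.lastCases with
          | last => exact absurd ⟨v, h1, h2⟩ (hend ⟨g, hg⟩)
          | cast r => exact ⟨r.succ, congrArg Subtype.val (hf _ _ ⟨g, hg⟩ (hpath r) ⟨v, h1, h2⟩)⟩)
        (fun r g hg v h1 h2 => by
          induction r using Fin.cases with
          | zero => exact absurd ⟨v, h1, h2⟩ (hstart ⟨g, hg⟩)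
          | succ r => exact ⟨r.castSucc, congrArg Subtype.val (hi _ ⟨g, hg⟩ _ (hpath r) ⟨v, h1, h2⟩)⟩)
      -- At an interior vertex the chain could be prolonged, so a maximal chain starts and ends on
      -- the boundary.
      obtain ⟨i, hi0⟩ : ∃ i, N.tail P (c 0).1 = Sum.inr i := by
        rcases h : N.tail P (c 0).1 with v | i
        · obtain ⟨f, hf, h'⟩ := exists_head_eq_tail hP hQ (c 0).2 h
          exact absurd ⟨v, h', h⟩ (hstart ⟨f, hf⟩)
        · exact ⟨i, rfl⟩
      obtain ⟨j, hjm⟩ : ∃ j, N.head P (c (Fin.last m)).1 = Sum.inr j := by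
        rcases h : N.head P (c (Fin.last m)).1 with v | i
        · obtain ⟨f, hf, h'⟩ := exists_tail_eq_head hP hQ (c (Fin.last m)).2 h
          exact absurd ⟨v, h, h'⟩ (hend ⟨f, hf⟩)
        · exact ⟨i, rfl⟩
      refine ⟨i, j, m, Fin.snoc (fun r => N.tail P (c r).1) (Sum.inr j), fun r => (c r).1,
        ?_, ?_, by simp, ?_, ?_⟩
      · rw [Fin.snoc_injective_iff]
        constructor
        · intro r s hrs
          exact hc (Subtype.ext (tail_injOn hP hQ (c r).2 (c s).2 hrs))
        · rintro ⟨r, hr⟩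
          have h1 := N.eq_of_incident_boundary
            ((incident_iff_tail_or_head (P := P) _ _).2 (Or.inl hr))
            ((incident_iff_tail_or_head (P := P) _ _).2 (Or.inr hjm))
          simp only [h1] at hr
          exact tail_ne_head _ (hr.trans hjm.symm)
      · rw [← Fin.castSucc_zero, Fin.snoc_castSucc]
        exact hi0
      · intro r
        rw [Fin.snoc_castSucc]
        have h1 := joins_tail_head (P := P) (c r).1
        induction r using Fin.lastCases with
        | last => rw [Fin.succ_last, Fin.snoc_last, ← hjm]; exact h1
        | cast r =>
          rw [← Fin.castSucc_succ, Fin.snoc_castSucc]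
          obtain ⟨v, h2, h3⟩ := hpath r
          rw [h3, ← h2]
          exact h1
      · intro f
        rw [hcomp]
        simp
  · intro v
    obtain ⟨e, ⟨he, hv⟩, -⟩ := hP v
    exact ⟨e, Finset.mem_union_left _ he, hv⟩

end Union

end DiskNetwork

/-! ### Splitting a component between two dimer configurations. -/

namespace DiskNetwork

open Classical

variable {n : ℕ} {N : DiskNetwork n}

theorem Joins.incident_iff {e : N.E} {a b u : N.V ⊕ Fin n} (h : N.Joins e a b) :
    N.Incident e u ↔ u = a ∨ u = b := by
  unfold Incident
  rcases h with ⟨rfl, rfl⟩ | ⟨rfl, rfl⟩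
  · exact or_congr eq_comm eq_comm
  · rw [or_comm]; exact or_congr eq_comm eq_comm

theorem Joins.symm {e : N.E} {a b : N.V ⊕ Fin n} (h : N.Joins e a b) : N.Joins e b a := Or.symm h

theorem Joins.white_eq {e : N.E} {a b : N.V ⊕ Fin n} (h : N.Joins e a b) :
    N.white a = !N.white b := by
  rcases h with ⟨rfl, rfl⟩ | ⟨rfl, rfl⟩ <;> simp [N.blackEnd_color, N.whiteEnd_color]

theorem eq_of_incident_boundary_boundary {e : N.E} {i j : Fin n} (hi : N.Incident e (Sum.inr i))
    (hj : N.Incident e (Sum.inr j)) : i = j := by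
  rcases hi with hi | hi <;> rcases hj with hj | hj
  · exact Sum.inr_injective (hi.symm.trans hj)
  · exact absurd ⟨hi, hj⟩ (N.boundary_not_adjacent e i j)
  · exact absurd ⟨hj, hi⟩ (N.boundary_not_adjacent e j i)
  · exact Sum.inr_injective (hi.symm.trans hj)

theorem mem_boundarySubset {A : Finset N.E} {i : Fin n} : i ∈ N.boundarySubset A ↔
    (N.white (Sum.inr i) = false ∧ N.UsesBoundary A i) ∨
      (N.white (Sum.inr i) = true ∧ ¬ N.UsesBoundary A i) := by
  simp [boundarySubset]

theorem usesBoundary_iff {A : Finset N.E} {i : Fin n} {e : N.E} (h : N.Incident e (Sum.inr i)) :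
    N.UsesBoundary A i ↔ e ∈ A :=
  ⟨fun ⟨_, hf, hfi⟩ => N.eq_of_incident_boundary hfi h ▸ hf, fun he => ⟨e, he, h⟩⟩

/-- The sets `A` and `B` are the restrictions to `C` of two dimer configurations whose union has the
component `C`. -/
def IsLocalPair (N : DiskNetwork n) (C A B : Finset N.E) : Prop :=
  A ∪ B = C ∧ ∀ v, (∃ e ∈ C, N.Incident e (Sum.inl v)) →
    (∃! e, e ∈ A ∧ N.Incident e (Sum.inl v)) ∧ ∃! e, e ∈ B ∧ N.Incident e (Sum.inl v)

theorem IsLocalPair.symm {C A B : Finset N.E} (h : N.IsLocalPair C A B) : N.IsLocalPair C B A :=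
  ⟨by rw [Finset.union_comm]; exact h.1, fun v hv => (h.2 v hv).symm⟩

theorem isLocalPair_inter {P Q C : Finset N.E} (hP : N.IsDimer P) (hQ : N.IsDimer Q)
    (hC : C ∈ N.components (P ∪ Q)) : N.IsLocalPair C (P ∩ C) (Q ∩ C) := by
  refine ⟨?_, ?_⟩
  · rw [← Finset.union_inter_distrib_right, Finset.inter_eq_right]
    exact component_subset hC
  · rintro v ⟨e, he, hev⟩
    constructor
    · obtain ⟨f, ⟨hf, hfv⟩, huniq⟩ := hP v
      exact ⟨f, ⟨Finset.mem_inter.2 ⟨hf, mem_component_of_incident hC he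
        (Finset.mem_union_left _ hf) hev hfv⟩, hfv⟩,
        fun g hg => huniq g ⟨(Finset.mem_inter.1 hg.1).1, hg.2⟩⟩
    · obtain ⟨f, ⟨hf, hfv⟩, huniq⟩ := hQ v
      exact ⟨f, ⟨Finset.mem_inter.2 ⟨hf, mem_component_of_incident hC he
        (Finset.mem_union_right _ hf) hev hfv⟩, hfv⟩,
        fun g hg => huniq g ⟨(Finset.mem_inter.1 hg.1).1, hg.2⟩⟩

theorem IsLocalPair.subset_left {C A B : Finset N.E} (h : N.IsLocalPair C A B) : A ⊆ C :=
  h.1 ▸ Finset.subset_union_left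

theorem IsLocalPair.subset_right {C A B : Finset N.E} (h : N.IsLocalPair C A B) : B ⊆ C :=
  h.1 ▸ Finset.subset_union_right

/-- An edge common to `A` and `B` is the only edge of both at its interior ends, so no other edge
touches it and it is a component by itself. -/
theorem IsLocalPair.disjoint {S C A B : Finset N.E} (h : N.IsLocalPair C A B)
    (hC : C ∈ N.components S) (h1 : C.card ≠ 1) : Disjoint A B := by
  rw [Finset.disjoint_left]
  intro e heA heB
  apply h1
  rw [Finset.card_eq_one]
  refine ⟨e, ?_⟩
  rw [← componentOf_eq_of_mem hC (h.subset_left heA)]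
  refine componentOf_eq ?_ (by simp) ?_ ?_
  · rw [Finset.singleton_subset_iff]
    exact component_subset hC (h.subset_left heA)
  · intro f hf g hg u hfu hgu
    rw [Finset.mem_singleton] at hf ⊢
    subst hf
    rcases u with v | i
    · have hgC := mem_component_of_incident hC (h.subset_left heA) hg hfu hgu
      obtain ⟨h2, h3⟩ := h.2 v ⟨f, h.subset_left heA, hfu⟩
      rw [← h.1, Finset.mem_union] at hgC
      rcases hgC with hgA | hgB
      · exact h2.unique ⟨hgA, hgu⟩ ⟨heA, hfu⟩
      · exact h3.unique ⟨hgB, hgu⟩ ⟨heB, hfu⟩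
    · exact N.eq_of_incident_boundary hgu hfu
  · intro f hf
    rw [Finset.mem_singleton] at hf
    rw [hf]

theorem IsLocalPair.eq_sdiff {S C A B : Finset N.E} (h : N.IsLocalPair C A B)
    (hC : C ∈ N.components S) (h1 : C.card ≠ 1) : B = C \ A := by
  rw [← h.1, Finset.union_sdiff_left, Finset.sdiff_eq_self_of_disjoint (h.disjoint hC h1).symm]

/-- A component with more than one edge has at most two decompositions, which differ by a swap. -/
theorem IsLocalPair.eq_or_swap {S C A B A' B' : Finset N.E} (h : N.IsLocalPair C A B)
    (h' : N.IsLocalPair C A' B') (hC : C ∈ N.components S) (h1 : C.card ≠ 1) :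
    (A' = A ∧ B' = B) ∨ (A' = B ∧ B' = A) := by
  have hB := h.eq_sdiff hC h1
  have hB' := h'.eq_sdiff hC h1
  have alt : ∀ {A B}, N.IsLocalPair C A B → ∀ f ∈ C, ∀ g ∈ C, f ≠ g → ∀ v,
      N.Incident f (Sum.inl v) → N.Incident g (Sum.inl v) → (f ∈ A ↔ g ∉ A) := by
    intro A B h f hf g hg hfg v hfv hgv
    obtain ⟨h2, h3⟩ := h.2 v ⟨f, hf, hfv⟩
    constructor
    · exact fun hfA hgA => hfg (h2.unique ⟨hfA, hfv⟩ ⟨hgA, hgv⟩)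
    · intro hgA
      by_contra hfA
      rw [← h.1, Finset.mem_union] at hf hg
      exact hfg (h3.unique ⟨hf.resolve_left hfA, hfv⟩ ⟨hg.resolve_left hgA, hgv⟩)
  obtain ⟨e, he⟩ := component_nonempty hC
  -- Membership in `A` flips between two different touching edges, and so does membership in `A'`.
  -- Whether the two memberships agree is therefore constant on the component.
  have prop : ∀ g, Relation.ReflTransGen (N.Touch S) e g →
      g ∈ C ∧ ((g ∈ A ↔ g ∈ A') ↔ (e ∈ A ↔ e ∈ A')) := by
    intro g hg
    induction hg with
    | refl => exact ⟨he, Iff.rfl⟩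
    | @tail f g _ hfg ih =>
      obtain ⟨-, hgS, u, hfu, hgu⟩ := hfg
      have hgC := mem_component_of_incident hC ih.1 hgS hfu hgu
      refine ⟨hgC, ?_⟩
      rw [← ih.2]
      by_cases hfg : f = g
      · rw [hfg]
      · rcases u with v | i
        · have h2 := alt h f ih.1 g hgC hfg v hfu hgu
          have h3 := alt h' f ih.1 g hgC hfg v hfu hgu
          tauto
        · exact absurd (N.eq_of_incident_boundary hfu hgu) hfg
  have prop' : ∀ g ∈ C, ((g ∈ A ↔ g ∈ A') ↔ (e ∈ A ↔ e ∈ A')) := fun g hg => by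
    rw [← componentOf_eq_of_mem hC he, mem_componentOf] at hg
    exact (prop g hg.2).2
  have hAC := h.subset_left
  have hAC' := h'.subset_left
  by_cases hc : e ∈ A ↔ e ∈ A'
  · left
    have : A' = A := by
      ext g
      by_cases hg : g ∈ C
      · exact ((prop' g hg).2 hc).symm
      · exact iff_of_false (fun h => hg (hAC' h)) (fun h => hg (hAC h))
    exact ⟨this, by rw [hB, hB', this]⟩
  · right
    have : A' = C \ A := by
      ext g
      rw [Finset.mem_sdiff]
      by_cases hg : g ∈ C
      · have := prop' g hg
        tauto
      · exact iff_of_false (fun h => hg (hAC' h)) (fun h => hg h.1)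
    exact ⟨by rw [hB, this], by rw [hB', this, Finset.sdiff_sdiff_eq_self hAC]⟩

/-- The edges `e r`, directed from `src r` to `tgt r`, alternately belong to two dimer
configurations. -/
theorem isLocalPair_of_directed {ι : Type*} {C : Finset N.E} {e : ι → N.E}
    {src tgt : ι → N.V ⊕ Fin n} (he : Function.Injective e) (hsrc : Function.Injective src)
    (htgt : Function.Injective tgt) (hj : ∀ r, N.Joins (e r) (src r) (tgt r))
    (hC : ∀ f, f ∈ C ↔ ∃ r, e r = f)
    (hst : ∀ v, (∃ r, src r = Sum.inl v) ↔ ∃ r, tgt r = Sum.inl v) :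
    ∃ A B, N.IsLocalPair C A B ∧ (∀ r, e r ∈ A ↔ N.white (src r) = true) ∧
      ∀ r, e r ∈ B ↔ N.white (src r) = false := by
  have key : ∀ b r, e r ∈ C.filter (fun f => ∃ r, e r = f ∧ N.white (src r) = b) ↔
      N.white (src r) = b := by
    intro b r
    rw [Finset.mem_filter, hC]
    exact ⟨fun ⟨_, s, hs, h⟩ => he hs ▸ h, fun h => ⟨⟨r, rfl⟩, r, rfl, h⟩⟩
  refine ⟨C.filter fun f => ∃ r, e r = f ∧ N.white (src r) = true,
    C.filter fun f => ∃ r, e r = f ∧ N.white (src r) = false, ⟨?_, ?_⟩, key true, key false⟩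
  · rw [← Finset.filter_or, Finset.filter_eq_self]
    intro f hf
    obtain ⟨r, rfl⟩ := (hC f).1 hf
    cases h : N.white (src r)
    · exact Or.inr ⟨r, rfl, h⟩
    · exact Or.inl ⟨r, rfl, h⟩
  · rintro v ⟨f, hf, hfv⟩
    obtain ⟨r, rfl⟩ := (hC f).1 hf
    obtain ⟨⟨r₁, h₁⟩, ⟨r₂, h₂⟩⟩ : (∃ r, src r = Sum.inl v) ∧ ∃ r, tgt r = Sum.inl v := by
      rcases (hj r).incident_iff.1 hfv with h | h
      · exact ⟨⟨r, h.symm⟩, (hst v).1 ⟨r, h.symm⟩⟩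
      · exact ⟨(hst v).2 ⟨r, h.symm⟩, ⟨r, h.symm⟩⟩
    have i₁ : N.Incident (e r₁) (Sum.inl v) := (hj r₁).incident_iff.2 (Or.inl h₁.symm)
    have i₂ : N.Incident (e r₂) (Sum.inl v) := (hj r₂).incident_iff.2 (Or.inr h₂.symm)
    -- One edge leaves `v` and one enters it; their starting points have opposite colours, so
    -- exactly one of them lies in each of the two sets.
    have c₂ := (hj r₂).white_eq
    rw [h₂] at c₂
    have only : ∀ b, ∀ g ∈ C.filter (fun f => ∃ r, e r = f ∧ N.white (src r) = b),
        N.Incident g (Sum.inl v) → (g = e r₁ ∧ N.white (Sum.inl v) = b) ∨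
          (g = e r₂ ∧ (!N.white (Sum.inl v)) = b) := by
      intro b g hg hgv
      obtain ⟨s, rfl⟩ := (hC g).1 (Finset.mem_filter.1 hg).1
      rw [key] at hg
      rcases (hj s).incident_iff.1 hgv with h | h
      · left
        rw [hsrc (h₁.trans h), ← hg, ← h]
        exact ⟨rfl, rfl⟩
      · right
        have : r₂ = s := htgt (h₂.trans h)
        subst this
        exact ⟨rfl, by rw [← hg, ← c₂]⟩
    have main : ∀ b, ∃! g, g ∈ C.filter (fun f => ∃ r, e r = f ∧ N.white (src r) = b) ∧
        N.Incident g (Sum.inl v) := by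
      intro b
      by_cases hb : N.white (Sum.inl v) = b
      · refine ⟨e r₁, ⟨(key b r₁).2 (by rw [h₁, hb]), i₁⟩, fun g hg => ?_⟩
        rcases only b g hg.1 hg.2 with h | h
        · exact h.1
        · exfalso; have := h.2; rw [hb] at this; cases b <;> cases this
      · refine ⟨e r₂, ⟨(key b r₂).2 ?_, i₂⟩, fun g hg => ?_⟩
        · rw [c₂]; cases b <;> simpa using hb
        · rcases only b g hg.1 hg.2 with h | h
          · exact absurd h.2 hb
          · exact h.1
    exact ⟨main true, main false⟩

theorem IsInteriorCycle.not_incident_boundary {C : Finset N.E} (h : N.IsInteriorCycle C) {f : N.E}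
    (hf : f ∈ C) (i : Fin n) : ¬ N.Incident f (Sum.inr i) := by
  obtain ⟨m, v, e, -, -, hj, hC⟩ := h
  obtain ⟨r, rfl⟩ := (hC f).1 hf
  rw [(hj r).incident_iff]
  simp

theorem IsInteriorCycle.card_ne_one {C : Finset N.E} (h : N.IsInteriorCycle C) : C.card ≠ 1 := by
  obtain ⟨m, v, e, -, he, -, hC⟩ := h
  intro h1
  obtain ⟨f, hf⟩ := Finset.card_eq_one.1 h1
  have : ∀ r, e r = f := fun r => by
    have := (hC (e r)).2 ⟨r, rfl⟩
    rwa [hf, Finset.mem_singleton] at this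
  have := he ((this 0).trans (this (Fin.last _)).symm)
  exact absurd this (Fin.last_pos).ne

theorem IsInteriorCycle.exists_isLocalPair {C : Finset N.E} (h : N.IsInteriorCycle C) :
    ∃ A B, N.IsLocalPair C A B := by
  obtain ⟨m, v, e, hv, he, hj, hC⟩ := h
  obtain ⟨A, B, hAB, -⟩ := isLocalPair_of_directed (src := fun r => Sum.inl (v r))
    (tgt := fun r => Sum.inl (v (r + 1))) he (Sum.inl_injective.comp hv)
    (Sum.inl_injective.comp (hv.comp (add_left_injective 1))) hj hC (by
      intro w
      constructor
      · rintro ⟨r, hr⟩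
        exact ⟨r - 1, by simpa using hr⟩
      · rintro ⟨r, hr⟩
        exact ⟨r + 1, hr⟩)
  exact ⟨A, B, hAB⟩

theorem IsBoundaryPath.symm {C : Finset N.E} {i j : Fin n} (h : N.IsBoundaryPath C i j) :
    N.IsBoundaryPath C j i := by
  obtain ⟨m, v, e, hv, h0, hl, hj, hC⟩ := h
  refine ⟨m, v ∘ Fin.rev, e ∘ Fin.rev, hv.comp Fin.rev_injective, by simpa using hl,
    by simpa using h0, fun r => ?_, fun f => ?_⟩
  · simp only [Function.comp_apply, Fin.rev_castSucc, Fin.rev_succ]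
    exact (hj r.rev).symm
  · rw [hC]
    constructor
    · rintro ⟨r, rfl⟩; exact ⟨r.rev, by simp⟩
    · rintro ⟨r, rfl⟩; exact ⟨_, rfl⟩

theorem IsBoundaryPath.ne {C : Finset N.E} {i j : Fin n} (h : N.IsBoundaryPath C i j) : i ≠ j := by
  obtain ⟨m, v, e, hv, h0, hl, -⟩ := h
  rintro rfl
  exact absurd (hv (h0.trans hl.symm)) Fin.last_pos.ne

theorem IsBoundaryPath.exists_incident {C : Finset N.E} {i j : Fin n}
    (h : N.IsBoundaryPath C i j) : ∃ e ∈ C, N.Incident e (Sum.inr i) := by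
  obtain ⟨m, v, e, hv, h0, hl, hj, hC⟩ := h
  refine ⟨e 0, (hC _).2 ⟨0, rfl⟩, ?_⟩
  rw [(hj 0).incident_iff, Fin.castSucc_zero, h0]
  exact Or.inl rfl

theorem IsBoundaryPath.card_ne_one {C : Finset N.E} {i j : Fin n} (h : N.IsBoundaryPath C i j) :
    C.card ≠ 1 := by
  intro h1
  obtain ⟨f, hf⟩ := Finset.card_eq_one.1 h1
  obtain ⟨e, he, hi⟩ := h.exists_incident
  obtain ⟨e', he', hj⟩ := h.symm.exists_incident
  rw [hf, Finset.mem_singleton] at he he'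
  rw [he] at hi
  rw [he'] at hj
  exact h.ne (eq_of_incident_boundary_boundary hi hj)

theorem edge_injective_of_path {m : ℕ} {v : Fin (m + 2) → N.V ⊕ Fin n} {e : Fin (m + 1) → N.E}
    (hv : Function.Injective v) (hj : ∀ r, N.Joins (e r) (v r.castSucc) (v r.succ)) :
    Function.Injective e := by
  intro r s hrs
  have h1 : N.Incident (e s) (v r.castSucc) := hrs ▸ (hj r).incident_iff.2 (Or.inl rfl)
  have h2 : N.Incident (e s) (v r.succ) := hrs ▸ (hj r).incident_iff.2 (Or.inr rfl)
  rw [(hj s).incident_iff] at h1 h2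
  rcases h1 with h1 | h1
  · exact Fin.castSucc_injective _ (hv h1)
  · rcases h2 with h2 | h2
    · have h3 := Fin.ext_iff.1 (hv h1)
      have h4 := Fin.ext_iff.1 (hv h2)
      simp only [Fin.val_castSucc, Fin.val_succ] at h3 h4
      omega
    · exact Fin.succ_injective _ (hv h2)

theorem IsBoundaryPath.eq_or_eq_of_incident {C : Finset N.E} {i j l : Fin n}
    (h : N.IsBoundaryPath C i j) {f : N.E} (hf : f ∈ C) (hl : N.Incident f (Sum.inr l)) :
    l = i ∨ l = j := by
  obtain ⟨m, v, e, hv, h0, hlast, hj, hC⟩ := h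
  have hinj := edge_injective_of_path hv hj
  obtain ⟨r, rfl⟩ := (hC f).1 hf
  rcases (hj r).incident_iff.1 hl with h | h
  · induction r using Fin.cases with
    | zero =>
      rw [Fin.castSucc_zero, h0] at h
      exact Or.inl (Sum.inr_injective h)
    | succ r =>
      have h2 : N.Incident (e r.castSucc) (Sum.inr l) :=
        (hj r.castSucc).incident_iff.2 (Or.inr (by rw [h, Fin.castSucc_succ]))
      exact absurd (hinj (N.eq_of_incident_boundary hl h2)) (Fin.castSucc_lt_succ).ne'
  · induction r using Fin.lastCases with
    | last =>
      rw [Fin.succ_last, hlast] at h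
      exact Or.inr (Sum.inr_injective h)
    | cast r =>
      have h2 : N.Incident (e r.succ) (Sum.inr l) :=
        (hj r.succ).incident_iff.2 (Or.inl (by rw [h, Fin.castSucc_succ]))
      exact absurd (hinj (N.eq_of_incident_boundary hl h2)) (Fin.castSucc_lt_succ).ne

/-- A path between boundary vertices has a decomposition for which the start belongs to the second
boundary subset only, and the end to the first one only. -/
theorem IsBoundaryPath.exists_isLocalPair {C : Finset N.E} {i j : Fin n}
    (h : N.IsBoundaryPath C i j) : ∃ A B, N.IsLocalPair C A B ∧ i ∉ N.boundarySubset A ∧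
      i ∈ N.boundarySubset B ∧ j ∈ N.boundarySubset A ∧ j ∉ N.boundarySubset B := by
  obtain ⟨m, v, e, hv, h0, hlast, hj, hC⟩ := h
  obtain ⟨A, B, hAB, hA, hB⟩ := isLocalPair_of_directed (src := fun r => v r.castSucc)
    (tgt := fun r => v r.succ) (edge_injective_of_path hv hj)
    (fun _ _ h => Fin.castSucc_injective _ (hv h)) (fun _ _ h => Fin.succ_injective _ (hv h)) hj hC (by
      intro w
      constructor
      · rintro ⟨r, hr⟩
        induction r using Fin.cases with
        | zero => rw [Fin.castSucc_zero, h0] at hr; cases hr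
        | succ r => exact ⟨r.castSucc, by rw [← hr, Fin.castSucc_succ]⟩
      · rintro ⟨r, hr⟩
        induction r using Fin.lastCases with
        | last => rw [Fin.succ_last, hlast] at hr; cases hr
        | cast r => exact ⟨r.succ, by rw [← hr, Fin.castSucc_succ]⟩)
  have hi : N.Incident (e 0) (Sum.inr i) := (hj 0).incident_iff.2 (Or.inl h0.symm)
  have hjl : N.Incident (e (Fin.last m)) (Sum.inr j) :=
    (hj _).incident_iff.2 (Or.inr (by rw [Fin.succ_last, hlast]))
  have c := (hj (Fin.last m)).white_eq
  rw [Fin.succ_last, hlast] at c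
  have a0 := hA 0
  have b0 := hB 0
  have al := hA (Fin.last m)
  have bl := hB (Fin.last m)
  rw [Fin.castSucc_zero, h0] at a0 b0
  rw [c] at al bl
  refine ⟨A, B, hAB, ?_⟩
  -- The first edge lies in `A` exactly when `i` is white, the last one exactly when `j` is black.
  -- So `i` is outside the boundary subset of `A` and `j` is inside, whatever their colours.
  simp only [mem_boundarySubset, usesBoundary_iff hi, usesBoundary_iff hjl, a0, b0, al, bl]
  cases N.white (Sum.inr i) <;> cases N.white (Sum.inr j) <;> simp

end DiskNetwork

namespace DiskNetwork

open Classical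

variable {n : ℕ} {N : DiskNetwork n}

/-! ### The rank -/

/-- Every edge has exactly one end of colour `b`, so `P` can be counted by these ends: one at each
interior vertex of that colour and one at each used boundary vertex. It is applied to both colours.
-/
theorem card_dimer_eq {P : Finset N.E} (hP : N.IsDimer P) (b : Bool) (endOf : N.E → N.V ⊕ Fin n)
    (hend : ∀ e u, endOf e = u ↔ N.Incident e u ∧ N.white u = b) :
    P.card = (Finset.univ.filter fun v : N.V => N.white (Sum.inl v) = b).card +
      (Finset.univ.filter fun i : Fin n => N.white (Sum.inr i) = b ∧ N.UsesBoundary P i).card := by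
  rw [Finset.card_eq_sum_card_fiberwise (f := endOf) (t := Finset.univ) (by simp),
    Fintype.sum_sum_type, Finset.card_filter, Finset.card_filter]
  congr 1
  · refine Finset.sum_congr rfl fun v _ => ?_
    split_ifs with hv
    · rw [Finset.card_eq_one]
      obtain ⟨e, he, huniq⟩ := hP v
      refine ⟨e, Finset.ext fun f => ?_⟩
      rw [Finset.mem_filter, Finset.mem_singleton, hend]
      exact ⟨fun h => huniq f ⟨h.1, h.2.1⟩, fun h => h ▸ ⟨he.1, he.2, hv⟩⟩
    · rw [Finset.card_eq_zero, Finset.filter_eq_empty_iff]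
      exact fun e _ h => hv ((hend _ _).1 h).2
  · refine Finset.sum_congr rfl fun i _ => ?_
    split_ifs with hi
    · rw [Finset.card_eq_one]
      obtain ⟨e, heP, he⟩ := hi.2
      refine ⟨e, Finset.ext fun f => ?_⟩
      rw [Finset.mem_filter, Finset.mem_singleton, hend]
      exact ⟨fun h => N.eq_of_incident_boundary h.2.1 he, fun h => h ▸ ⟨heP, he, hi.1⟩⟩
    · rw [Finset.card_eq_zero, Finset.filter_eq_empty_iff]
      exact fun e he h => hi ⟨((hend _ _).1 h).2, e, he, ((hend _ _).1 h).1⟩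

/-- Compare the counts of `P` by black ends and by white ends, and add the unused white boundary
vertices. -/
theorem card_boundarySubset {P : Finset N.E} (hP : N.IsDimer P) {k : ℕ} (hk : N.HasRank k) :
    (N.boundarySubset P).card = k := by
  have h1 := card_dimer_eq hP false N.blackEnd fun e u =>
    ⟨fun h => ⟨Or.inl h, h ▸ N.blackEnd_color e⟩, fun h => N.incident_black h.1 h.2⟩
  have h2 := card_dimer_eq hP true N.whiteEnd fun e u =>
    ⟨fun h => ⟨Or.inr h, h ▸ N.whiteEnd_color e⟩, fun h => N.incident_white h.1 h.2⟩
  have h3 : (N.boundarySubset P).card =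
      (Finset.univ.filter fun i : Fin n => N.white (Sum.inr i) = false ∧ N.UsesBoundary P i).card +
      (Finset.univ.filter fun i : Fin n =>
        N.white (Sum.inr i) = true ∧ ¬ N.UsesBoundary P i).card := by
    rw [← Finset.card_union_of_disjoint, ← Finset.filter_or]
    · rfl
    · rw [Finset.disjoint_filter]
      intro i _ h h'
      rw [h.1] at h'
      cases h'.1
  have h4 : (Finset.univ.filter fun i : Fin n => N.white (Sum.inr i) = true).card =
      (Finset.univ.filter fun i : Fin n => N.white (Sum.inr i) = true ∧ N.UsesBoundary P i).card +
      (Finset.univ.filter fun i : Fin n =>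
        N.white (Sum.inr i) = true ∧ ¬ N.UsesBoundary P i).card := by
    rw [← Finset.card_filter_add_card_filter_not (fun i => N.UsesBoundary P i),
      Finset.filter_filter, Finset.filter_filter]
  unfold HasRank at hk
  have h5 : (Finset.univ.filter fun i : Fin n => N.white (Sum.inr i) = true).card =
    Fintype.card {i : Fin n // N.white (Sum.inr i) = true} := (Fintype.card_subtype _).symm
  omega

/-! ### Disjointness of components in the disk -/

theorem arc_eq_pos_or (e : N.E) (t : unitInterval) :
    t ∈ Set.Ioo (0 : unitInterval) 1 ∨ ∃ u, N.Incident e u ∧ N.arc e t = N.pos u := by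
  by_cases h0 : t = 0
  · exact Or.inr ⟨_, Or.inl rfl, by rw [h0, (N.arc e).source]⟩
  by_cases h1 : t = 1
  · exact Or.inr ⟨_, Or.inr rfl, by rw [h1, (N.arc e).target]⟩
  · exact Or.inl ⟨unitInterval.pos_iff_ne_zero.2 h0, unitInterval.lt_one_iff_ne_one.2 h1⟩

theorem norm_arc_le (e : N.E) (t : unitInterval) : ‖N.arc e t‖ ≤ 1 := by
  rcases arc_eq_pos_or e t with h | ⟨u, -, h⟩
  · exact (N.arc_interior e t h).le
  · rw [h]
    rcases u with v | i
    · exact (N.interior_pos v).le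
    · rw [N.boundary_pos]
      exact (Complex.norm_exp_ofReal_mul_I _).le

theorem exists_incident_of_arc_eq {e f : N.E} (hef : e ≠ f) {s t : unitInterval}
    (h : N.arc e s = N.arc f t) : ∃ u, N.Incident e u ∧ N.Incident f u := by
  rcases arc_eq_pos_or e s with hs | ⟨u, hu, hus⟩
  · rcases arc_eq_pos_or f t with ht | ⟨w, -, hwt⟩
    · exact absurd h (N.arc_disjoint e f hef s hs t ht)
    · exact absurd (h.trans hwt) (N.arc_avoids_vertices e w s hs)
  · rcases arc_eq_pos_or f t with ht | ⟨w, hw, hwt⟩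
    · exact absurd (h.symm.trans hus) (N.arc_avoids_vertices f u t ht)
    · have : u = w := N.pos_injective (hus.symm.trans (h.trans hwt))
      exact ⟨u, hu, this ▸ hw⟩

theorem Joins.joinedIn {e : N.E} {a b : N.V ⊕ Fin n} (h : N.Joins e a b) {U : Set ℂ}
    (hU : ∀ t, N.arc e t ∈ U) : JoinedIn U (N.pos a) (N.pos b) := by
  rcases h with ⟨rfl, rfl⟩ | ⟨rfl, rfl⟩
  · exact ⟨N.arc e, hU⟩
  · exact JoinedIn.symm ⟨N.arc e, hU⟩

theorem IsBoundaryPath.joinedIn {C : Finset N.E} {i j : Fin n} (h : N.IsBoundaryPath C i j) :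
    JoinedIn {z | ∃ e ∈ C, ∃ t, N.arc e t = z} (N.pos (Sum.inr i)) (N.pos (Sum.inr j)) := by
  obtain ⟨m, v, e, hv, h0, hlast, hj, hC⟩ := h
  have step : ∀ r : Fin (m + 1), JoinedIn {z | ∃ e ∈ C, ∃ t, N.arc e t = z} (N.pos (v r.castSucc))
      (N.pos (v r.succ)) := fun r =>
    (hj r).joinedIn fun t => ⟨e r, (hC _).2 ⟨r, rfl⟩, t, rfl⟩
  have main : ∀ r, JoinedIn {z | ∃ e ∈ C, ∃ t, N.arc e t = z} (N.pos (v 0)) (N.pos (v r)) := by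
    intro r
    induction r using Fin.induction with
    | zero => exact JoinedIn.refl (step 0).source_mem
    | succ r ih => exact ih.trans (step r)
  rw [← h0, ← hlast]
  exact main _

/-- Arcs of different edges meet only at common vertices, and different components share none.
Crossing paths would thus give disjoint curves between alternating boundary points. -/
theorem not_cross {S C C' : Finset N.E} (hC : C ∈ N.components S) (hC' : C' ∈ N.components S)
    (hne : C ≠ C') {a b a' b' : Fin n} (ha : N.IsBoundaryPath C a a')
    (hb : N.IsBoundaryPath C' b b') : ¬ (a < b ∧ b < a' ∧ a' < b') := by
  rintro ⟨h1, h2, h3⟩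
  obtain ⟨α, hα⟩ := ha.joinedIn
  obtain ⟨β, hβ⟩ := hb.joinedIn
  have hdisk : ∀ {C : Finset N.E} {z : ℂ}, z ∈ {z | ∃ e ∈ C, ∃ t, N.arc e t = z} → ‖z‖ ≤ 1 := by
    rintro C z ⟨e, -, t, rfl⟩
    exact norm_arc_le e t
  obtain ⟨s, t, hst⟩ := not_disjoint_of_alternate (N.angle_strictAnti h1) (N.angle_strictAnti h2)
    (N.angle_strictAnti h3) (N.angle_lt a b')
    (α.cast (N.boundary_pos a).symm (N.boundary_pos a').symm)
    (β.cast (N.boundary_pos b).symm (N.boundary_pos b').symm)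
    (fun t => hdisk (hα t)) (fun t => hdisk (hβ t))
  obtain ⟨e, he, x, hx⟩ := hα s
  obtain ⟨f, hf, y, hy⟩ := hβ t
  have hef : e ≠ f := by
    rintro rfl
    exact hne ((componentOf_eq_of_mem hC he).symm.trans (componentOf_eq_of_mem hC' hf))
  obtain ⟨u, hu, hu'⟩ := exists_incident_of_arc_eq hef (hx.trans (Eq.trans hst hy.symm))
  exact hne (component_eq_of_incident hC hC' he hf hu hu')

/-! ### The pairing of the union of two dimer configurations -/

variable {P Q : Finset N.E}

theorem mem_boundarySubset_inter {C : Finset N.E} {e : N.E}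
    (he : e ∈ C) {i : Fin n} (hi : N.Incident e (Sum.inr i)) :
    i ∈ N.boundarySubset (P ∩ C) ↔ i ∈ N.boundarySubset P := by
  simp [mem_boundarySubset, usesBoundary_iff hi, he]

/-- The restriction of `(P, Q)` to the path is the alternating decomposition of `exists_isLocalPair`
or its swap, and the claim is symmetric under the swap. -/
theorem IsBoundaryPath.boundarySubset {C : Finset N.E} {i j : Fin n} (h : N.IsBoundaryPath C i j)
    (hP : N.IsDimer P) (hQ : N.IsDimer Q) (hC : C ∈ N.components (P ∪ Q)) :
    (i ∈ N.boundarySubset P ↔ i ∉ N.boundarySubset Q) ∧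
      (j ∈ N.boundarySubset P ↔ i ∈ N.boundarySubset Q) ∧
        (j ∈ N.boundarySubset Q ↔ i ∈ N.boundarySubset P) := by
  obtain ⟨A, B, hAB, h1, h2, h3, h4⟩ := h.exists_isLocalPair
  obtain ⟨e, he, hi⟩ := h.exists_incident
  obtain ⟨f, hf, hj⟩ := h.symm.exists_incident
  rw [← mem_boundarySubset_inter he hi (P := P), ← mem_boundarySubset_inter he hi (P := Q),
    ← mem_boundarySubset_inter hf hj (P := P), ← mem_boundarySubset_inter hf hj (P := Q)]
  rcases hAB.eq_or_swap (isLocalPair_inter hP hQ hC) hC h.card_ne_one with ⟨e1, e2⟩ | ⟨e1, e2⟩ <;>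
    rw [e1, e2] <;> tauto

theorem IsTLSubgraph.component_cases {S : Finset N.E} (hS : N.IsTLSubgraph S) {e : N.E}
    (he : e ∈ S) {i : Fin n} (hi : N.Incident e (Sum.inr i)) :
    (∃ j, N.IsBoundaryPath (N.componentOf S e) i j) ∨ N.componentOf S e = {e} := by
  have hm := mem_componentOf_self he
  rcases hS.1 _ (componentOf_mem he) with ⟨a, b, hab⟩ | hcyc | ⟨f, hf⟩
  · left
    rcases hab.eq_or_eq_of_incident hm hi with rfl | rfl
    · exact ⟨b, hab⟩
    · exact ⟨a, hab.symm⟩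
  · exact absurd hi (hcyc.not_incident_boundary hm i)
  · right
    rw [hf, Finset.mem_singleton] at hm
    rw [hf, hm]

/-- Every edge has an interior end, and both configurations must cover that vertex. -/
theorem mem_of_componentOf_eq_singleton (hP : N.IsDimer P) (hQ : N.IsDimer Q) {e : N.E}
    (he : e ∈ P ∪ Q) (hs : N.componentOf (P ∪ Q) e = {e}) : e ∈ P ∧ e ∈ Q := by
  obtain ⟨v, hv⟩ := N.exists_interior e
  have key : ∀ f ∈ P ∪ Q, N.Incident f (Sum.inl v) → f = e := by
    intro f hf hfv
    have := mem_component_of_incident (componentOf_mem he) (mem_componentOf_self he) hf hv hfv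
    rwa [hs, Finset.mem_singleton] at this
  obtain ⟨f, ⟨hf, hfv⟩, -⟩ := hP v
  obtain ⟨g, ⟨hg, hgv⟩, -⟩ := hQ v
  exact ⟨key f (Finset.mem_union_left _ hf) hfv ▸ hf, key g (Finset.mem_union_right _ hg) hgv ▸ hg⟩

/-- These are the clauses of `Compat`, for a map `f` and a set `T` not yet bundled as a pairing,
since `exists_hasPairing` needs them to obtain `size`. -/
theorem compat_boundarySubset {f : Fin n → Fin n} {T : Finset (Fin n)} (hP : N.IsDimer P)
    (hQ : N.IsDimer Q)
    (hf : ∀ i j, (i ≠ j ∧ f i = j) ↔ ∃ C ∈ N.components (P ∪ Q), N.IsBoundaryPath C i j)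
    (hT : ∀ i, i ∈ T ↔ (N.white (Sum.inr i) = false ∧
      ∃ e, {e} ∈ N.components (P ∪ Q) ∧ N.Incident e (Sum.inr i)) ∨
        (N.white (Sum.inr i) = true ∧ ¬ N.UsesBoundary (P ∪ Q) i)) :
    (∀ i, i ∈ N.boundarySubset Q ↔ f i ∈ N.boundarySubset P) ∧
      (∀ i, f i ≠ i → (i ∈ N.boundarySubset P ↔ f i ∉ N.boundarySubset P)) ∧
        ∀ i, f i = i → (i ∈ N.boundarySubset P ↔ i ∈ T) := by
  have moved : ∀ i, f i ≠ i → (i ∈ N.boundarySubset P ↔ i ∉ N.boundarySubset Q) ∧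
      (f i ∈ N.boundarySubset P ↔ i ∈ N.boundarySubset Q) := by
    intro i hi
    obtain ⟨C, hC, hp⟩ := (hf i (f i)).1 ⟨hi.symm, rfl⟩
    have := hp.boundarySubset hP hQ hC
    exact ⟨this.1, this.2.1⟩
  have fixed : ∀ i, f i = i → (i ∈ N.boundarySubset P ↔ i ∈ T) ∧
      (i ∈ N.boundarySubset Q ↔ i ∈ T) := by
    intro i hi
    obtain ⟨e, he, -⟩ := N.boundary_degree i
    change N.Incident e (Sum.inr i) at he
    rw [hT]
    simp only [mem_boundarySubset, usesBoundary_iff he]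
    by_cases heS : e ∈ P ∪ Q
    · rcases (isTLSubgraph_union hP hQ).component_cases heS he with ⟨j, hj⟩ | hs
      · have := (hf i j).2 ⟨_, componentOf_mem heS, hj⟩
        exact absurd (hi.symm.trans this.2) this.1
      · obtain ⟨h1, h2⟩ := mem_of_componentOf_eq_singleton hP hQ heS hs
        have h3 : ∃ e, {e} ∈ N.components (P ∪ Q) ∧ N.Incident e (Sum.inr i) :=
          ⟨e, hs ▸ componentOf_mem heS, he⟩
        simp [h1, h2, h3]
    · have h3 : ¬ ∃ e, {e} ∈ N.components (P ∪ Q) ∧ N.Incident e (Sum.inr i) := by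
        rintro ⟨g, hg, hgi⟩
        rw [N.eq_of_incident_boundary hgi he] at hg
        exact heS (component_subset hg (Finset.mem_singleton_self e))
      have h1 : e ∉ P := fun h => heS (Finset.mem_union_left _ h)
      have h2 : e ∉ Q := fun h => heS (Finset.mem_union_right _ h)
      simp [h1, h2, h3]
  refine ⟨fun i => ?_, fun i hi => ?_, fun i hi => (fixed i hi).1⟩
  · by_cases hi : f i = i
    · rw [hi, (fixed i hi).1, (fixed i hi).2]
    · exact (moved i hi).2.symm
  · rw [(moved i hi).1, (moved i hi).2]

theorem HasPairing.unique {k : ℕ} {S : Finset N.E} {p q : PartialNCPairing k n}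
    (hp : N.HasPairing S p) (hq : N.HasPairing S q) : p = q := by
  apply PartialNCPairing.ext
  · funext i
    by_cases h : p.partner i = i
    · by_contra hne
      have h1 := (hp.1 i _).2 ((hq.1 i (q.partner i)).1 ⟨fun e => hne (h.trans e), rfl⟩)
      exact hne h1.2
    · exact ((hq.1 i _).2 ((hp.1 i _).1 ⟨fun e => h e.symm, rfl⟩)).2.symm
  · ext i
    rw [hp.2, hq.2]

/-- The union of two dimer configurations determines a partial non-crossing pairing. -/
theorem exists_hasPairing (hP : N.IsDimer P) (hQ : N.IsDimer Q) {k : ℕ} (hk : N.HasRank k) :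
    ∃ p : PartialNCPairing k n, N.HasPairing (P ∪ Q) p := by
  set S := P ∪ Q with hS
  have huniq : ∀ {i j j' C C'}, C ∈ N.components S → C' ∈ N.components S →
      N.IsBoundaryPath C i j → N.IsBoundaryPath C' i j' → C = C' ∧ j = j' := by
    intro i j j' C C' hC hC' h h'
    obtain ⟨e, he, hi⟩ := h.exists_incident
    obtain ⟨e', he', hi'⟩ := h'.exists_incident
    have hCC := component_eq_of_incident hC hC' he he' hi hi'
    subst hCC
    obtain ⟨g, hg, hj⟩ := h.symm.exists_incident
    exact ⟨rfl, (h'.eq_or_eq_of_incident hg hj).resolve_left h.ne.symm⟩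
  set f : Fin n → Fin n := fun i =>
    if h : ∃ j, ∃ C ∈ N.components S, N.IsBoundaryPath C i j then h.choose else i with hf
  have hfp : ∀ i j, (i ≠ j ∧ f i = j) ↔ ∃ C ∈ N.components S, N.IsBoundaryPath C i j := by
    intro i j
    constructor
    · rintro ⟨hij, rfl⟩
      by_cases h : ∃ j, ∃ C ∈ N.components S, N.IsBoundaryPath C i j
      · simp only [hf, dif_pos h]
        exact h.choose_spec
      · exact absurd (by simp only [hf, dif_neg h]) hij
    · rintro ⟨C, hC, hp⟩
      have h : ∃ j, ∃ C ∈ N.components S, N.IsBoundaryPath C i j := ⟨j, C, hC, hp⟩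
      refine ⟨hp.ne, ?_⟩
      simp only [hf, dif_pos h]
      obtain ⟨C', hC', hp'⟩ := h.choose_spec
      exact (huniq hC' hC hp' hp).2
  set T : Finset (Fin n) := Finset.univ.filter fun i => (N.white (Sum.inr i) = false ∧
      ∃ e, {e} ∈ N.components S ∧ N.Incident e (Sum.inr i)) ∨
        (N.white (Sum.inr i) = true ∧ ¬ N.UsesBoundary S i) with hT
  have hTp : ∀ i, i ∈ T ↔ (N.white (Sum.inr i) = false ∧
      ∃ e, {e} ∈ N.components S ∧ N.Incident e (Sum.inr i)) ∨
        (N.white (Sum.inr i) = true ∧ ¬ N.UsesBoundary S i) := fun i => by simp [hT]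
  have hdisj : ∀ i ∈ T, f i = i := by
    intro i hi
    by_contra hne
    obtain ⟨C, hC, hp⟩ := (hfp i (f i)).1 ⟨fun h => hne h.symm, rfl⟩
    obtain ⟨e, he, hei⟩ := hp.exists_incident
    rcases (hTp i).1 hi with ⟨-, g, hg, hgi⟩ | ⟨-, h⟩
    · have := component_eq_of_incident hC hg he (Finset.mem_singleton_self g) hei hgi
      exact hp.card_ne_one (by rw [this, Finset.card_singleton])
    · exact h ⟨e, component_subset hC he, hei⟩
  obtain ⟨c1, c2, c3⟩ := compat_boundarySubset hP hQ hfp hTp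
  refine ⟨⟨f, T, fun i => ?_, ?_, hdisj, ?_⟩, hfp, hTp⟩
  · by_cases h : f i = i
    · rw [h, h]
    · obtain ⟨C, hC, hp⟩ := (hfp i (f i)).1 ⟨fun h' => h h'.symm, rfl⟩
      exact ((hfp (f i) i).2 ⟨C, hC, hp.symm⟩).2
  · rintro a b ⟨h1, h2, h3⟩
    obtain ⟨C, hC, hp⟩ := (hfp a (f a)).1 ⟨(h1.trans h2).ne, rfl⟩
    obtain ⟨C', hC', hp'⟩ := (hfp b (f b)).1 ⟨(h2.trans h3).ne, rfl⟩
    refine not_cross hC hC' ?_ hp hp' ⟨h1, h2, h3⟩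
    rintro rfl
    obtain ⟨e, he, hei⟩ := hp'.exists_incident
    rcases hp.eq_or_eq_of_incident he hei with h | h
    · exact h1.ne' h
    · exact h2.ne h
  · rw [PartialNCPairing.card_moved_add_two_mul_card c1 c2 c3 hdisj, card_boundarySubset hP hk,
      card_boundarySubset hQ hk]
    ring

end DiskNetwork

noncomputable instance (k n : ℕ) : Fintype (PartialNCPairing k n) := Fintype.ofFinite _

/-! ### The product of two boundary measurements. -/

namespace DiskNetwork

open Classical

variable {n k : ℕ} {N : DiskNetwork n}

/-- The product of the weights of a set of edges. -/
noncomputable def edgeWeight (N : DiskNetwork n) (A : Finset N.E) : ℝ := ∏ e ∈ A, N.weight e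

/-- The decompositions of a component that agree with the boundary subsets `I` and `J`. -/
noncomputable def localPairs (N : DiskNetwork n) (I J : Finset (Fin n)) (C : Finset N.E) :
    Finset (Finset N.E × Finset N.E) :=
  Finset.univ.filter fun x => N.IsLocalPair C x.1 x.2 ∧
    ∀ i, (∃ e ∈ C, N.Incident e (Sum.inr i)) →
      (i ∈ I ↔ i ∈ N.boundarySubset x.1) ∧ (i ∈ J ↔ i ∈ N.boundarySubset x.2)

theorem mem_localPairs {I J : Finset (Fin n)} {C : Finset N.E} {x : Finset N.E × Finset N.E} :
    x ∈ N.localPairs I J C ↔ N.IsLocalPair C x.1 x.2 ∧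
      ∀ i, (∃ e ∈ C, N.Incident e (Sum.inr i)) →
        (i ∈ I ↔ i ∈ N.boundarySubset x.1) ∧ (i ∈ J ↔ i ∈ N.boundarySubset x.2) := by
  simp [localPairs]

theorem isLocalPair_singleton_iff {e : N.E} {A B : Finset N.E} :
    N.IsLocalPair {e} A B ↔ A = {e} ∧ B = {e} := by
  constructor
  · intro h
    obtain ⟨v, hv⟩ := N.exists_interior e
    obtain ⟨⟨f, hf, -⟩, ⟨g, hg, -⟩⟩ := h.2 v ⟨e, Finset.mem_singleton_self e, hv⟩
    have hA := h.subset_left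
    have hB := h.subset_right
    have hfe := Finset.mem_singleton.1 (hA hf.1)
    have hge := Finset.mem_singleton.1 (hB hg.1)
    exact ⟨hA.antisymm (Finset.singleton_subset_iff.2 (hfe ▸ hf.1)),
      hB.antisymm (Finset.singleton_subset_iff.2 (hge ▸ hg.1))⟩
  · rintro ⟨rfl, rfl⟩
    refine ⟨Finset.union_self _, ?_⟩
    rintro v ⟨f, hf, hfv⟩
    rw [Finset.mem_singleton] at hf
    subst hf
    have : ∃! g, g ∈ ({f} : Finset N.E) ∧ N.Incident g (Sum.inl v) :=
      ⟨f, ⟨Finset.mem_singleton_self f, hfv⟩, fun g hg => Finset.mem_singleton.1 hg.1⟩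
    exact ⟨this, this⟩

variable {S : Finset N.E} {p : PartialNCPairing k n} {I J : Finset (Fin n)}

theorem HasPairing.mem_iff_of_singleton (hp : N.HasPairing S p) (hc : p.Compat I J) {e : N.E}
    (he : {e} ∈ N.components S) {i : Fin n} (hi : N.Incident e (Sum.inr i)) :
    (i ∈ I ↔ N.white (Sum.inr i) = false) ∧ (i ∈ J ↔ N.white (Sum.inr i) = false) := by
  have hfix : p.partner i = i := by
    by_contra h
    obtain ⟨C, hC, hpath⟩ := (hp.1 i _).1 ⟨fun h' => h h'.symm, rfl⟩
    obtain ⟨f, hf, hfi⟩ := hpath.exists_incident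
    have := component_eq_of_incident hC he hf (Finset.mem_singleton_self e) hfi hi
    exact hpath.card_ne_one (by rw [this, Finset.card_singleton])
  have h1 : ∃ e, {e} ∈ N.components S ∧ N.Incident e (Sum.inr i) := ⟨e, he, hi⟩
  have h2 : N.UsesBoundary S i := ⟨e, component_subset he (Finset.mem_singleton_self e), hi⟩
  have h3 := hc.2.2 i hfix
  have h4 := hc.1 i
  rw [hp.2] at h3
  rw [hfix] at h4
  rw [h4, h3]
  simp [h1, h2]

theorem HasPairing.mem_iff_of_notMem (hp : N.HasPairing S p) (hc : p.Compat I J) {e : N.E}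
    (he : e ∉ S) {i : Fin n} (hi : N.Incident e (Sum.inr i)) :
    (i ∈ I ↔ N.white (Sum.inr i) = true) ∧ (i ∈ J ↔ N.white (Sum.inr i) = true) := by
  have hfix : p.partner i = i := by
    by_contra h
    obtain ⟨C, hC, hpath⟩ := (hp.1 i _).1 ⟨fun h' => h h'.symm, rfl⟩
    obtain ⟨f, hf, hfi⟩ := hpath.exists_incident
    exact he (N.eq_of_incident_boundary hi hfi ▸ component_subset hC hf)
  have h1 : ¬ ∃ e, {e} ∈ N.components S ∧ N.Incident e (Sum.inr i) := by
    rintro ⟨f, hf, hfi⟩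
    rw [N.eq_of_incident_boundary hfi hi] at hf
    exact he (component_subset hf (Finset.mem_singleton_self e))
  have h2 : ¬ N.UsesBoundary S i := fun h => he ((usesBoundary_iff hi).1 h)
  have h3 := hc.2.2 i hfix
  have h4 := hc.1 i
  rw [hp.2] at h3
  rw [hfix] at h4
  rw [h4, h3]
  simp [h1, h2]

theorem IsLocalPair.edgeWeight_mul {C A B : Finset N.E} (h : N.IsLocalPair C A B)
    (hC : C ∈ N.components S) (h1 : C.card ≠ 1) :
    N.edgeWeight A * N.edgeWeight B = ∏ e ∈ C, N.weight e := by
  rw [← h.1, Finset.prod_union (h.disjoint hC h1)]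
  rfl

theorem sum_localPairs (hS : N.IsTLSubgraph S) (hp : N.HasPairing S p) (hc : p.Compat I J)
    {C : Finset N.E} (hC : C ∈ N.components S) :
    ∑ x ∈ N.localPairs I J C, N.edgeWeight x.1 * N.edgeWeight x.2 = N.componentWeight C := by
  rcases hS.1 C hC with ⟨i, j, h⟩ | h | ⟨e, rfl⟩
  · have hcard := h.card_ne_one
    have hcyc : ¬ N.IsInteriorCycle C := by
      intro hcyc
      obtain ⟨e, he, hi⟩ := h.exists_incident
      exact hcyc.not_incident_boundary he i hi
    rw [componentWeight, if_neg hcard, if_neg hcyc]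
    obtain ⟨hij, hpij⟩ := (hp.1 i j).2 ⟨C, hC, h⟩
    have hpji : p.partner j = i := by rw [← hpij, p.involutive]
    have c1 := hc.1 i
    have c2 := hc.1 j
    have c3 := hc.2.1 i (by rw [hpij]; exact hij.symm)
    rw [hpij] at c1 c3
    rw [hpji] at c2
    obtain ⟨A, B, hAB, e1, e2, e3, e4⟩ : ∃ A B, N.IsLocalPair C A B ∧
        (i ∈ I ↔ i ∈ N.boundarySubset A) ∧ (i ∈ J ↔ i ∈ N.boundarySubset B) ∧
        (j ∈ I ↔ j ∈ N.boundarySubset A) ∧ (j ∈ J ↔ j ∈ N.boundarySubset B) := by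
      obtain ⟨A, B, hAB, h1, h2, h3, h4⟩ := h.exists_isLocalPair
      by_cases hi : i ∈ I
      · exact ⟨B, A, hAB.symm, by tauto⟩
      · exact ⟨A, B, hAB, by tauto⟩
    have : N.localPairs I J C = {(A, B)} := by
      ext ⟨A', B'⟩
      rw [mem_localPairs, Finset.mem_singleton, Prod.mk.injEq]
      constructor
      · rintro ⟨h1, h2⟩
        refine (hAB.eq_or_swap h1 hC hcard).resolve_right ?_
        rintro ⟨rfl, rfl⟩
        have := h2 i h.exists_incident
        tauto
      · rintro ⟨rfl, rfl⟩
        refine ⟨hAB, ?_⟩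
        rintro l ⟨e, he, hel⟩
        rcases h.eq_or_eq_of_incident he hel with rfl | rfl
        · exact ⟨e1, e2⟩
        · exact ⟨e3, e4⟩
    rw [this, Finset.sum_singleton, hAB.edgeWeight_mul hC hcard]
  · have hcard := h.card_ne_one
    rw [componentWeight, if_neg hcard, if_pos h]
    obtain ⟨A, B, hAB⟩ := h.exists_isLocalPair
    have hne : (A, B) ≠ (B, A) := by
      intro heq
      rw [Prod.mk.injEq] at heq
      have h1 := hAB.disjoint hC hcard
      rw [← heq.1, disjoint_self] at h1
      obtain ⟨e, he⟩ := component_nonempty hC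
      rw [← hAB.1, ← heq.1, h1] at he
      simp at he
    have : N.localPairs I J C = {(A, B), (B, A)} := by
      ext ⟨A', B'⟩
      rw [mem_localPairs, Finset.mem_insert, Finset.mem_singleton, Prod.mk.injEq, Prod.mk.injEq]
      constructor
      · exact fun h1 => hAB.eq_or_swap h1.1 hC hcard
      · intro h1
        refine ⟨?_, fun i ⟨e, he, hi⟩ => absurd hi (h.not_incident_boundary he i)⟩
        rcases h1 with ⟨rfl, rfl⟩ | ⟨rfl, rfl⟩
        · exact hAB
        · exact hAB.symm
    rw [this, Finset.sum_pair hne, hAB.edgeWeight_mul hC hcard, hAB.symm.edgeWeight_mul hC hcard]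
    ring
  · rw [componentWeight, if_pos (Finset.card_singleton e)]
    have : N.localPairs I J {e} = {({e}, {e})} := by
      ext ⟨A', B'⟩
      rw [mem_localPairs, Finset.mem_singleton, Prod.mk.injEq, isLocalPair_singleton_iff]
      constructor
      · exact fun h => h.1
      · rintro ⟨rfl, rfl⟩
        refine ⟨⟨rfl, rfl⟩, ?_⟩
        rintro i ⟨f, hf, hi⟩
        rw [Finset.mem_singleton] at hf
        subst hf
        obtain ⟨h1, h2⟩ := hp.mem_iff_of_singleton hc hC hi
        rw [h1, h2]
        simp [mem_boundarySubset, usesBoundary_iff hi]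
    rw [this, Finset.sum_singleton]
    simp [edgeWeight, sq]

section Glue

variable {A : {C // C ∈ N.components S} → Finset N.E}

theorem mem_biUnion_iff (hA : ∀ C, A C ⊆ C.1) (C : {C // C ∈ N.components S}) {f : N.E}
    (hf : f ∈ C.1) : f ∈ Finset.univ.biUnion A ↔ f ∈ A C := by
  rw [Finset.mem_biUnion]
  constructor
  · rintro ⟨C', -, h⟩
    have : C' = C := Subtype.ext
      ((componentOf_eq_of_mem C'.2 (hA C' h)).symm.trans (componentOf_eq_of_mem C.2 hf))
    exact this ▸ h
  · exact fun h => ⟨C, Finset.mem_univ _, h⟩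

theorem biUnion_subset_of_components (hA : ∀ C, A C ⊆ C.1) : Finset.univ.biUnion A ⊆ S := by
  intro f hf
  obtain ⟨C, -, h⟩ := Finset.mem_biUnion.1 hf
  exact component_subset C.2 (hA C h)

theorem isDimer_biUnion (hS : N.IsTLSubgraph S) (hA : ∀ C, A C ⊆ C.1)
    (hloc : ∀ (C : {C // C ∈ N.components S}) (v : N.V), (∃ e ∈ C.1, N.Incident e (Sum.inl v)) →
      ∃! e, e ∈ A C ∧ N.Incident e (Sum.inl v)) : N.IsDimer (Finset.univ.biUnion A) := by
  intro v
  obtain ⟨e, he, hev⟩ := hS.2 v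
  set C : {C // C ∈ N.components S} := ⟨_, componentOf_mem he⟩
  have heC : e ∈ C.1 := mem_componentOf_self he
  obtain ⟨g, ⟨hg, hgv⟩, huniq⟩ := hloc C v ⟨e, heC, hev⟩
  refine ⟨g, ⟨Finset.mem_biUnion.2 ⟨C, Finset.mem_univ _, hg⟩, hgv⟩, ?_⟩
  rintro f ⟨hf, hfv⟩
  have hfC := mem_component_of_incident C.2 heC (biUnion_subset_of_components hA hf) hev hfv
  exact huniq f ⟨(mem_biUnion_iff hA C hfC).1 hf, hfv⟩

theorem boundarySubset_biUnion {I : Finset (Fin n)} (hA : ∀ C, A C ⊆ C.1)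
    (hin : ∀ (C : {C // C ∈ N.components S}) (i : Fin n), (∃ e ∈ C.1, N.Incident e (Sum.inr i)) →
      (i ∈ I ↔ i ∈ N.boundarySubset (A C)))
    (hout : ∀ e ∉ S, ∀ i, N.Incident e (Sum.inr i) → (i ∈ I ↔ N.white (Sum.inr i) = true)) :
    N.boundarySubset (Finset.univ.biUnion A) = I := by
  ext i
  obtain ⟨e, he, -⟩ := N.boundary_degree i
  change N.Incident e (Sum.inr i) at he
  by_cases heS : e ∈ S
  · rw [hin ⟨_, componentOf_mem heS⟩ i ⟨e, mem_componentOf_self heS, he⟩, mem_boundarySubset,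
      mem_boundarySubset, usesBoundary_iff he, usesBoundary_iff he,
      mem_biUnion_iff hA ⟨_, componentOf_mem heS⟩ (mem_componentOf_self heS)]
  · rw [hout e heS i he, mem_boundarySubset, usesBoundary_iff he]
    have : e ∉ Finset.univ.biUnion A := fun h => heS (biUnion_subset_of_components hA h)
    simp only [this, and_false, not_false_iff, and_true, false_or]

theorem edgeWeight_biUnion (hA : ∀ C, A C ⊆ C.1) :
    N.edgeWeight (Finset.univ.biUnion A) = ∏ C, N.edgeWeight (A C) := by
  refine Finset.prod_biUnion fun C _ C' _ hne => ?_
  rw [Function.onFun, Finset.disjoint_left]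
  intro f hf hf'
  exact hne (Subtype.ext
    ((componentOf_eq_of_mem C.2 (hA C hf)).symm.trans (componentOf_eq_of_mem C'.2 (hA C' hf'))))

theorem biUnion_inter_components {P : Finset N.E} (hP : P ⊆ S) :
    (Finset.univ.biUnion fun C : {C // C ∈ N.components S} => P ∩ C.1) = P := by
  ext f
  rw [Finset.mem_biUnion]
  constructor
  · rintro ⟨C, -, h⟩
    exact (Finset.mem_inter.1 h).1
  · exact fun h => ⟨⟨_, componentOf_mem (hP h)⟩, Finset.mem_univ _,
      Finset.mem_inter.2 ⟨h, mem_componentOf_self (hP h)⟩⟩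

theorem biUnion_inter_eq (hA : ∀ C, A C ⊆ C.1) (C : {C // C ∈ N.components S}) :
    Finset.univ.biUnion A ∩ C.1 = A C := by
  ext f
  rw [Finset.mem_inter]
  constructor
  · rintro ⟨h1, h2⟩
    exact (mem_biUnion_iff hA C h2).1 h1
  · exact fun h => ⟨(mem_biUnion_iff hA C (hA C h)).2 h, hA C h⟩

end Glue

/-- Pairs of configurations with union `S` correspond to independent choices of a decomposition on
each component, by restriction and gluing; the sum then factors as a product over the components. -/
theorem sum_dimer_pairs (hS : N.IsTLSubgraph S) (hp : N.HasPairing S p) (hc : p.Compat I J) :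
    ∑ x ∈ Finset.univ.filter (fun x : Finset N.E × Finset N.E =>
      (N.IsDimer x.1 ∧ N.boundarySubset x.1 = I) ∧ (N.IsDimer x.2 ∧ N.boundarySubset x.2 = J) ∧
        x.1 ∪ x.2 = S), N.edgeWeight x.1 * N.edgeWeight x.2 = N.tlWeight S := by
  rw [tlWeight, ← Finset.prod_coe_sort]
  have h1 : ∀ C : {C // C ∈ N.components S}, N.componentWeight C.1 =
      ∑ x ∈ N.localPairs I J C.1, N.edgeWeight x.1 * N.edgeWeight x.2 :=
    fun C => (sum_localPairs hS hp hc C.2).symm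
  rw [Finset.prod_congr rfl fun C _ => h1 C, Finset.prod_univ_sum]
  refine Finset.sum_bij' (fun x _ C => (x.1 ∩ C.1, x.2 ∩ C.1))
    (fun y _ => (Finset.univ.biUnion fun C => (y C).1, Finset.univ.biUnion fun C => (y C).2))
    ?_ ?_ ?_ ?_ ?_
  · rintro ⟨P, Q⟩ hx
    obtain ⟨⟨hP, hPI⟩, ⟨hQ, hQJ⟩, rfl⟩ := (Finset.mem_filter.1 hx).2
    rw [Fintype.mem_piFinset]
    intro C
    rw [mem_localPairs]
    refine ⟨isLocalPair_inter hP hQ C.2, ?_⟩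
    rintro i ⟨e, he, hi⟩
    rw [mem_boundarySubset_inter he hi, mem_boundarySubset_inter he hi]
    exact ⟨by rw [← hPI], by rw [← hQJ]⟩
  · intro y hy
    rw [Fintype.mem_piFinset] at hy
    have hl := fun C => (mem_localPairs.1 (hy C)).1
    have hb := fun C => (mem_localPairs.1 (hy C)).2
    have hA : ∀ C, (y C).1 ⊆ C.1 := fun C => (hl C).subset_left
    have hB : ∀ C, (y C).2 ⊆ C.1 := fun C => (hl C).subset_right
    rw [Finset.mem_filter]
    refine ⟨Finset.mem_univ _, ⟨isDimer_biUnion hS hA fun C v hv => ((hl C).2 v hv).1,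
      boundarySubset_biUnion hA (fun C i hi => (hb C i hi).1)
        fun e he i hi => (hp.mem_iff_of_notMem hc he hi).1⟩,
      ⟨isDimer_biUnion hS hB fun C v hv => ((hl C).2 v hv).2,
      boundarySubset_biUnion hB (fun C i hi => (hb C i hi).2)
        fun e he i hi => (hp.mem_iff_of_notMem hc he hi).2⟩, ?_⟩
    refine (Finset.union_subset (biUnion_subset_of_components hA)
      (biUnion_subset_of_components hB)).antisymm fun f hf => ?_
    have hfC := mem_componentOf_self hf
    rw [Finset.mem_union, mem_biUnion_iff hA ⟨_, componentOf_mem hf⟩ hfC,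
      mem_biUnion_iff hB ⟨_, componentOf_mem hf⟩ hfC, ← Finset.mem_union, (hl _).1]
    exact hfC
  · rintro ⟨P, Q⟩ hx
    obtain ⟨-, -, rfl⟩ := (Finset.mem_filter.1 hx).2
    exact Prod.ext (biUnion_inter_components Finset.subset_union_left)
      (biUnion_inter_components Finset.subset_union_right)
  · intro y hy
    rw [Fintype.mem_piFinset] at hy
    have hl := fun C => (mem_localPairs.1 (hy C)).1
    funext C
    exact Prod.ext (biUnion_inter_eq (fun C => (hl C).subset_left) C)
      (biUnion_inter_eq (fun C => (hl C).subset_right) C)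
  · rintro ⟨P, Q⟩ hx
    obtain ⟨-, -, rfl⟩ := (Finset.mem_filter.1 hx).2
    rw [Finset.prod_mul_distrib, ← edgeWeight_biUnion fun C => Finset.inter_subset_right,
      ← edgeWeight_biUnion fun C => Finset.inter_subset_right,
      biUnion_inter_components Finset.subset_union_left,
      biUnion_inter_components Finset.subset_union_right]

/-- The product of two boundary measurements is a sum of Temperley-Lieb immanants. -/
theorem boundaryMeasurement_mul (hk : N.HasRank k) (I J : Finset (Fin n)) :
    N.boundaryMeasurement I * N.boundaryMeasurement J =
      ∑ p : PartialNCPairing k n, if p.Compat I J then N.tlImmanant p else 0 := by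
  have hR : ∀ p : PartialNCPairing k n, (if p.Compat I J then N.tlImmanant p else 0) =
      ∑ S : Finset N.E, if N.IsTLSubgraph S ∧ N.HasPairing S p ∧ p.Compat I J
        then N.tlWeight S else 0 := by
    intro p
    split_ifs with h
    · rw [tlImmanant, Finset.sum_filter]
      simp [h]
    · simp [h]
  -- Group the pairs of configurations by their union `S`.
  rw [Finset.sum_congr rfl fun p _ => hR p, Finset.sum_comm, boundaryMeasurement,
    boundaryMeasurement, Finset.sum_mul_sum, ← Finset.sum_product',
    ← Finset.sum_fiberwise _ (fun x : Finset N.E × Finset N.E => x.1 ∪ x.2)]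
  refine Finset.sum_congr rfl fun S _ => ?_
  have hL : ((Finset.univ.filter (fun P : Finset N.E => N.IsDimer P ∧ N.boundarySubset P = I) ×ˢ
      Finset.univ.filter (fun P : Finset N.E => N.IsDimer P ∧ N.boundarySubset P = J)).filter
        fun x => x.1 ∪ x.2 = S) = Finset.univ.filter (fun x : Finset N.E × Finset N.E =>
      (N.IsDimer x.1 ∧ N.boundarySubset x.1 = I) ∧ (N.IsDimer x.2 ∧ N.boundarySubset x.2 = J) ∧
        x.1 ∪ x.2 = S) := by
    ext x
    simp only [Finset.mem_filter, Finset.mem_product, Finset.mem_univ, true_and, and_assoc]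
  rw [hL]
  -- A subgraph has at most one pairing. If it has no compatible one, it is not the union of
  -- configurations with boundary subsets `I` and `J`.
  by_cases h : ∃ p : PartialNCPairing k n, N.IsTLSubgraph S ∧ N.HasPairing S p ∧ p.Compat I J
  · obtain ⟨p, hS, hp, hc⟩ := h
    rw [Finset.sum_eq_single p, if_pos ⟨hS, hp, hc⟩]
    · exact sum_dimer_pairs hS hp hc
    · intro q _ hq
      exact if_neg fun h => hq (h.2.1.unique hp)
    · exact fun h => absurd (Finset.mem_univ p) h
  · rw [Finset.sum_eq_zero fun p _ => if_neg fun hp => h ⟨p, hp⟩]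
    refine Finset.sum_eq_zero fun x hx => ?_
    obtain ⟨⟨hP, rfl⟩, ⟨hQ, rfl⟩, rfl⟩ := (Finset.mem_filter.1 hx).2
    obtain ⟨p, hp⟩ := exists_hasPairing hP hQ hk
    exact absurd ⟨p, isTLSubgraph_union hP hQ, hp, compat_boundarySubset hP hQ hp.1 hp.2⟩ h

end DiskNetwork

/-! ### Disjoint chords and radial segments in the disk. -/

namespace PartialNCPairing

open Complex

variable {k n : ℕ} (p : PartialNCPairing k n)

section Geometry

/-- The arguments of the boundary points. -/
noncomputable def boundaryAngle (i : Fin n) : ℝ := -(i : ℝ) / (n + 1)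

/-- The boundary points on the unit circle. -/
noncomputable def boundaryPoint (i : Fin n) : ℂ := exp (boundaryAngle i * I)

theorem boundaryAngle_lt {i j : Fin n} (h : i < j) :
    boundaryAngle j + 1 / (n + 1) ≤ boundaryAngle i := by
  unfold boundaryAngle
  rw [← add_div]
  have : (i : ℝ) + 1 ≤ j := by exact_mod_cast h
  gcongr
  linarith

theorem boundaryAngle_strictAnti : StrictAnti (boundaryAngle : Fin n → ℝ) := fun i j h => by
  have := boundaryAngle_lt h
  have : (0 : ℝ) < 1 / (n + 1) := by positivity
  linarith

theorem boundaryAngle_nonpos (i : Fin n) : boundaryAngle i ≤ 0 := by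
  unfold boundaryAngle
  rw [neg_div]
  have : (0 : ℝ) ≤ i / (n + 1) := by positivity
  linarith

theorem neg_one_lt_boundaryAngle (i : Fin n) : -1 < boundaryAngle i := by
  unfold boundaryAngle
  rw [neg_div, neg_lt_neg_iff, div_lt_one (by positivity)]
  have : (i : ℝ) < n := by exact_mod_cast i.2
  linarith

theorem norm_boundaryPoint (i : Fin n) : ‖boundaryPoint i‖ = 1 := norm_exp_ofReal_mul_I _

/-- The projection of the plane to the line of direction `φ`. -/
noncomputable def project (φ : ℝ) (z : ℂ) : ℝ := (z * exp ((-φ : ℝ) * I)).re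

theorem project_lineMap (φ : ℝ) (a b : ℂ) (t : ℝ) :
    project φ (AffineMap.lineMap a b t) = (1 - t) * project φ a + t * project φ b := by
  simp only [project, AffineMap.lineMap_apply, vsub_eq_sub, vadd_eq_add, real_smul]
  rw [show ((t : ℂ) * (b - a) + a) * exp ((-φ : ℝ) * I) =
    ((1 - t : ℝ) : ℂ) * (a * exp ((-φ : ℝ) * I)) + (t : ℂ) * (b * exp ((-φ : ℝ) * I)) by
      push_cast; ring]
  rw [add_re, re_ofReal_mul, re_ofReal_mul]

theorem project_boundaryPoint (φ : ℝ) (i : Fin n) :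
    project φ (boundaryPoint i) = Real.cos (boundaryAngle i - φ) := by
  rw [project, boundaryPoint, ← exp_add, ← add_mul, ← ofReal_add, exp_ofReal_mul_I_re,
    sub_eq_add_neg]

theorem boundaryPoint_injective : Function.Injective (boundaryPoint : Fin n → ℂ) := by
  intro i j hij
  by_contra hne
  wlog h : i < j generalizing i j
  · exact this hij.symm (Ne.symm hne) (lt_of_le_of_ne (not_lt.1 h) (Ne.symm hne))
  have h1 := congrArg (project (boundaryAngle i)) hij
  rw [project_boundaryPoint, project_boundaryPoint, sub_self, ← Real.cos_abs (_ - _)] at h1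
  have h2 := boundaryAngle_strictAnti h
  have h3 := boundaryAngle_nonpos i
  have h4 := neg_one_lt_boundaryAngle j
  have h5 : |boundaryAngle j - boundaryAngle i| = boundaryAngle i - boundaryAngle j := by
    rw [abs_sub_comm, abs_of_pos (by linarith)]
  have := Real.cos_lt_cos_of_nonneg_of_le_pi le_rfl (y := |boundaryAngle j - boundaryAngle i|)
    (by rw [h5]; linarith [Real.pi_gt_three]) (by rw [h5]; linarith)
  linarith

/-- The cosine of the smallest angle between boundary points. -/
noncomputable def gapCos (n : ℕ) : ℝ := Real.cos (1 / (n + 1))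

/-- The distance from the origin of the inner end of the block at an unmatched point. -/
noncomputable def innerRadius (n : ℕ) : ℝ := (1 + gapCos n) / 2

theorem gap_le_one : (1 : ℝ) / (n + 1) ≤ 1 := by
  rw [div_le_one (by positivity)]
  have : (0 : ℝ) ≤ n := by positivity
  linarith

theorem gapCos_lt_one : gapCos n < 1 := by
  have h1 : (0 : ℝ) < 1 / (n + 1) := by positivity
  have h2 : (1 : ℝ) / (n + 1) ≤ 1 := gap_le_one
  have h3 := Real.cos_lt_cos_of_nonneg_of_le_pi le_rfl (by linarith [Real.pi_gt_three]) h1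
  rwa [Real.cos_zero] at h3

theorem gapCos_nonneg : 0 ≤ gapCos n := by
  have h1 : (0 : ℝ) < 1 / (n + 1) := by positivity
  have h2 : (1 : ℝ) / (n + 1) ≤ 1 := gap_le_one
  exact Real.cos_nonneg_of_neg_pi_div_two_le_of_le (by linarith [Real.pi_gt_three])
    (by linarith [Real.pi_gt_three])

theorem gapCos_lt_innerRadius : gapCos n < innerRadius n := by
  have := gapCos_lt_one (n := n)
  unfold innerRadius
  linarith

theorem innerRadius_lt_one : innerRadius n < 1 := by
  have := gapCos_lt_one (n := n)
  unfold innerRadius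
  linarith

theorem innerRadius_pos : 0 < innerRadius n := by
  have := gapCos_nonneg (n := n)
  unfold innerRadius
  linarith

theorem cos_le_gapCos {i j : Fin n} (h : i ≠ j) :
    Real.cos (boundaryAngle i - boundaryAngle j) ≤ gapCos n := by
  wlog hij : i < j generalizing i j
  · rw [← Real.cos_neg, neg_sub]
    exact this h.symm (lt_of_le_of_ne (not_lt.1 hij) h.symm)
  have h1 := boundaryAngle_lt hij
  have h2 := boundaryAngle_nonpos i
  have h3 := neg_one_lt_boundaryAngle j
  exact Real.cos_le_cos_of_nonneg_of_le_pi (by positivity) (by linarith [Real.pi_gt_three])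
    (by linarith)

/-- The end of the block at `i` other than the boundary point `i`. -/
noncomputable def blockEnd (i : Fin n) : ℂ :=
  if p.partner i = i then innerRadius n * boundaryPoint i else boundaryPoint (p.partner i)

/-- The chord that joins matched boundary points, or a short radial segment at an unmatched one. -/
noncomputable def block (i : Fin n) : ℝ →ᵃ[ℝ] ℂ :=
  AffineMap.lineMap (boundaryPoint i) (p.blockEnd i)

theorem norm_blockEnd_le (i : Fin n) : ‖p.blockEnd i‖ ≤ 1 := by
  unfold blockEnd
  split_ifs
  · rw [norm_mul, norm_boundaryPoint, mul_one, norm_real, Real.norm_eq_abs,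
      abs_of_pos innerRadius_pos]
    exact innerRadius_lt_one.le
  · exact (norm_boundaryPoint _).le

theorem boundaryPoint_ne_blockEnd (i : Fin n) : boundaryPoint i ≠ p.blockEnd i := by
  unfold blockEnd
  split_ifs with h
  · intro he
    have := congrArg norm he
    rw [norm_mul, norm_boundaryPoint, mul_one, norm_real, Real.norm_eq_abs,
      abs_of_pos innerRadius_pos] at this
    exact innerRadius_lt_one.ne' this
  · exact fun he => h (boundaryPoint_injective he).symm

theorem block_injective (i : Fin n) : Function.Injective (p.block i) :=
  AffineMap.lineMap_injective ℝ (p.boundaryPoint_ne_blockEnd i)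

theorem norm_block_lt (i : Fin n) {s : ℝ} (h0 : 0 < s) (h1 : s < 1) : ‖p.block i s‖ < 1 := by
  have h := (strictConvex_closedBall ℝ (0 : ℂ) 1).openSegment_subset
    (x := boundaryPoint i) (y := p.blockEnd i)
    (by simp [norm_boundaryPoint]) (by simpa using p.norm_blockEnd_le i)
    (p.boundaryPoint_ne_blockEnd i)
  rw [interior_closedBall _ one_ne_zero] at h
  have : p.block i s ∈ openSegment ℝ (boundaryPoint i) (p.blockEnd i) := by
    rw [openSegment_eq_image_lineMap]
    exact ⟨s, ⟨h0, h1⟩, rfl⟩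
  simpa using h this

theorem convex_combination_le {a b c t : ℝ} (ha : a ≤ c) (hb : b ≤ c) (h0 : 0 ≤ t) (h1 : t ≤ 1) :
    (1 - t) * a + t * b ≤ c := by
  nlinarith [mul_le_mul_of_nonneg_left ha (sub_nonneg.2 h1), mul_le_mul_of_nonneg_left hb h0]

theorem convex_combination_lt {a b c t : ℝ} (ha : a < c) (hb : b < c) (h0 : 0 ≤ t) (h1 : t ≤ 1) :
    (1 - t) * a + t * b < c :=
  (convex_combination_le (le_max_left a b) (le_max_right a b) h0 h1).trans_lt (max_lt ha hb)

theorem lt_convex_combination {a b c t : ℝ} (ha : c < a) (hb : c < b) (h0 : 0 ≤ t) (h1 : t ≤ 1) :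
    c < (1 - t) * a + t * b := by
  have := convex_combination_lt (neg_lt_neg ha) (neg_lt_neg hb) h0 h1
  linarith

/-- Project to the direction of the point `i`. The radial segment stays above `gapCos n`, and every
other block stays at or below it. -/
theorem block_ne_of_unmatched {i j : Fin n} (hij : i ≠ j) (hi : p.partner i = i) {s t : ℝ}
    (hs1 : s ≤ 1) (ht0 : 0 ≤ t) (ht1 : t ≤ 1) : p.block i s ≠ p.block j t := by
  intro h
  have h1 := congrArg (project (boundaryAngle i)) h
  rw [block, block, project_lineMap, project_lineMap, project_boundaryPoint, sub_self,
    Real.cos_zero, project_boundaryPoint] at h1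
  have hr : ∀ l : Fin n, project (boundaryAngle i) (innerRadius n * boundaryPoint l) =
      innerRadius n * Real.cos (boundaryAngle l - boundaryAngle i) := fun l => by
    rw [← project_boundaryPoint, project, project, mul_assoc, re_ofReal_mul]
  have h2 : project (boundaryAngle i) (p.blockEnd i) = innerRadius n := by
    rw [blockEnd, if_pos hi, hr, sub_self, Real.cos_zero, mul_one]
  have h3 : project (boundaryAngle i) (p.blockEnd j) ≤ gapCos n := by
    rw [blockEnd]
    split_ifs with hj
    · rw [hr]
      have a1 := cos_le_gapCos hij.symm
      have a2 := gapCos_nonneg (n := n)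
      have a3 := innerRadius_lt_one (n := n)
      have a4 := innerRadius_pos (n := n)
      nlinarith
    · rw [project_boundaryPoint]
      refine cos_le_gapCos fun h => hij ?_
      rw [← hi, ← h, p.involutive]
  rw [h2] at h1
  have h4 := convex_combination_le (cos_le_gapCos hij.symm) h3 ht0 ht1
  have h5 := gapCos_lt_innerRadius (n := n)
  have h6 := innerRadius_lt_one (n := n)
  nlinarith

/-- Project to the bisector of the chord at `i`, on which this chord is constant. Boundary points
strictly between its ends project higher and points outside lower; by non-crossing both ends of the
other chord are on the same side. -/
theorem block_ne_of_matched {i j : Fin n} (hij : i ≠ j) (hi : i < p.partner i)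
    (hj : j < p.partner j) {s t : ℝ} (ht0 : 0 ≤ t) (ht1 : t ≤ 1) : p.block i s ≠ p.block j t := by
  intro h
  set a := boundaryAngle i with ha
  set b := boundaryAngle (p.partner i) with hb
  have hba : b < a := boundaryAngle_strictAnti hi
  have ha0 : a ≤ 0 := boundaryAngle_nonpos i
  have hb1 : -1 < b := neg_one_lt_boundaryAngle _
  have hpi := Real.pi_gt_three
  have h1 := congrArg (project ((a + b) / 2)) h
  rw [block, block, project_lineMap, project_lineMap, blockEnd, blockEnd, if_neg hi.ne',
    if_neg hj.ne', project_boundaryPoint, project_boundaryPoint, project_boundaryPoint,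
    project_boundaryPoint, ← ha, ← hb, show a - (a + b) / 2 = (a - b) / 2 by ring,
    show b - (a + b) / 2 = -((a - b) / 2) by ring, Real.cos_neg] at h1
  have inside : ∀ l : Fin n, i < l → l < p.partner i →
      Real.cos ((a - b) / 2) < Real.cos (boundaryAngle l - (a + b) / 2) := by
    intro l h1 h2
    have l1 : boundaryAngle l < a := boundaryAngle_strictAnti h1
    have l2 : b < boundaryAngle l := boundaryAngle_strictAnti h2
    rw [← Real.cos_abs (boundaryAngle l - _)]
    apply Real.cos_lt_cos_of_nonneg_of_le_pi (abs_nonneg _) (by linarith)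
    rw [abs_lt]
    constructor <;> linarith
  have outside : ∀ l : Fin n, (l < i ∨ p.partner i < l) →
      Real.cos (boundaryAngle l - (a + b) / 2) < Real.cos ((a - b) / 2) := by
    intro l hl
    have l0 := boundaryAngle_nonpos l
    have l1 := neg_one_lt_boundaryAngle l
    rw [← Real.cos_abs (boundaryAngle l - _)]
    apply Real.cos_lt_cos_of_nonneg_of_le_pi (by linarith)
    · rw [abs_le]
      constructor <;> linarith
    · rw [lt_abs]
      rcases hl with hl | hl
      · have : a < boundaryAngle l := boundaryAngle_strictAnti hl
        left; linarith
      · have : boundaryAngle l < b := boundaryAngle_strictAnti hl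
        right; linarith
  have h2 : (1 - s) * Real.cos ((a - b) / 2) + s * Real.cos ((a - b) / 2) =
    Real.cos ((a - b) / 2) := by ring
  rw [h2] at h1
  have n1 : p.partner j ≠ i := fun h => by
    have := p.involutive j
    rw [h] at this
    rw [this] at hi
    rw [h] at hj
    exact lt_asymm hi hj
  have n2 : j ≠ p.partner i := fun h => n1 (by rw [h, p.involutive])
  have n3 : p.partner j ≠ p.partner i := fun h => hij (p.involutive.injective h).symm
  by_cases hin : j ∈ Finset.Ioo i (p.partner i)
  · have hin' := p.partner_mem_Ioo hin
    rw [Finset.mem_Ioo] at hin hin'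
    exact (lt_convex_combination (inside _ hin.1 hin.2) (inside _ hin'.1 hin'.2) ht0 ht1).ne h1
  · have hout : p.partner j ∉ Finset.Ioo i (p.partner i) := fun h => hin (by
      have := p.partner_mem_Ioo h
      rwa [p.involutive] at this)
    have conv : ∀ l, l ∉ Finset.Ioo i (p.partner i) → l ≠ i → l ≠ p.partner i →
        l < i ∨ p.partner i < l := by
      intro l hl h1 h2
      rw [Finset.mem_Ioo, not_and_or, not_lt, not_lt] at hl
      exact hl.imp (fun h => lt_of_le_of_ne h h1) (fun h => lt_of_le_of_ne h h2.symm)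
    exact (convex_combination_lt (outside _ (conv _ hin hij.symm n2))
      (outside _ (conv _ hout n1 n3)) ht0 ht1).ne' h1

theorem block_ne {i j : Fin n} (hij : i ≠ j) (hi : i ≤ p.partner i) (hj : j ≤ p.partner j)
    {s t : ℝ} (hs0 : 0 ≤ s) (hs1 : s ≤ 1) (ht0 : 0 ≤ t) (ht1 : t ≤ 1) :
    p.block i s ≠ p.block j t := by
  rcases hi.lt_or_eq with h | h
  · rcases hj.lt_or_eq with h' | h'
    · exact p.block_ne_of_matched hij h h' ht0 ht1
    · exact (p.block_ne_of_unmatched hij.symm h'.symm ht1 hs0 hs1).symm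
  · exact p.block_ne_of_unmatched hij h.symm hs1 ht0 ht1

end Geometry

end PartialNCPairing

/-! ### The model network of a pairing. -/

namespace PartialNCPairing

variable {k n : ℕ} (p : PartialNCPairing k n)

/-- The smaller end of the edge at `i`, or `i` itself if it is unmatched. -/
def rep (i : Fin n) : Fin n := if i ≤ p.partner i then i else p.partner i

theorem rep_le (i : Fin n) : p.rep i ≤ p.partner (p.rep i) := by
  unfold rep
  split_ifs with h
  · exact h
  · rw [p.involutive]
    exact (not_le.1 h).le

theorem rep_of_le {i : Fin n} (h : i ≤ p.partner i) : p.rep i = i := if_pos h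

theorem rep_of_fixed {i : Fin n} (h : p.partner i = i) : p.rep i = i := p.rep_of_le h.ge

theorem rep_partner (i : Fin n) : p.rep (p.partner i) = p.rep i := by
  unfold rep
  rw [p.involutive]
  split_ifs with h1 h2 h2
  · exact h1.antisymm h2
  · rfl
  · rfl
  · exact absurd (le_of_not_ge h1) h2

theorem rep_eq_rep_iff {i j : Fin n} : p.rep i = p.rep j ↔ j = i ∨ j = p.partner i := by
  constructor
  · unfold rep
    split_ifs <;> intro h
    · exact Or.inl h.symm
    · right; rw [h, p.involutive]
    · exact Or.inr h.symm
    · exact Or.inl (p.involutive.injective h).symm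
  · rintro (rfl | rfl)
    · rfl
    · exact (p.rep_partner i).symm

/-- The points that are neither matched nor in `T`. -/
def IsFree (i : Fin n) : Prop := p.partner i = i ∧ i ∉ p.T

instance (i : Fin n) : Decidable (p.IsFree i) := inferInstanceAs (Decidable (_ ∧ _))

theorem isFree_rep {i : Fin n} : p.IsFree (p.rep i) ↔ p.IsFree i := by
  by_cases h : p.partner i = i
  · rw [p.rep_of_fixed h]
  · constructor
    · intro h'
      refine absurd ?_ h
      have := h'.1
      rw [rep] at this
      split_ifs at this
      · exact this
      · exact (p.involutive.injective this)
    · exact fun h' => absurd h'.1 h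

/-- The blocks of the partial pairing, each given by its smallest element. -/
abbrev BlockIndex : Type := {i : Fin n // i ≤ p.partner i}

/-- The block on which a vertex of the model network lies. -/
def vertexBlock : p.BlockIndex ⊕ Fin n → Fin n
  | Sum.inl v => v.1
  | Sum.inr i => p.rep i

/-- The position of a vertex of the model network on its block. -/
noncomputable def vertexParam : p.BlockIndex ⊕ Fin n → ℝ
  -- Interior vertices sit at midpoints; on a radial segment only the half next to the circle is
  -- used.
  | Sum.inl _ => 1 / 2
  | Sum.inr i => if i ≤ p.partner i then 0 else 1

theorem vertexBlock_le (u : p.BlockIndex ⊕ Fin n) : p.vertexBlock u ≤ p.partner (p.vertexBlock u) := by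
  rcases u with v | i
  · exact v.2
  · exact p.rep_le i

theorem vertexParam_cases (u : p.BlockIndex ⊕ Fin n) :
    p.vertexParam u = 0 ∨ p.vertexParam u = 1 / 2 ∨ p.vertexParam u = 1 := by
  rcases u with v | i
  · exact Or.inr (Or.inl rfl)
  · simp only [vertexParam]
    split_ifs <;> simp

theorem vertexParam_nonneg (u : p.BlockIndex ⊕ Fin n) : 0 ≤ p.vertexParam u := by
  rcases p.vertexParam_cases u with h | h | h <;> rw [h] <;> norm_num

theorem vertexParam_le_one (u : p.BlockIndex ⊕ Fin n) : p.vertexParam u ≤ 1 := by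
  rcases p.vertexParam_cases u with h | h | h <;> rw [h] <;> norm_num

/-- The position of a vertex of the model network. -/
noncomputable def vertexPos (u : p.BlockIndex ⊕ Fin n) : ℂ := p.block (p.vertexBlock u) (p.vertexParam u)

theorem vertexPos_injective : Function.Injective p.vertexPos := by
  intro u w h
  have hb : p.vertexBlock u = p.vertexBlock w := by
    by_contra hne
    exact p.block_ne hne (p.vertexBlock_le u) (p.vertexBlock_le w) (p.vertexParam_nonneg u)
      (p.vertexParam_le_one u) (p.vertexParam_nonneg w) (p.vertexParam_le_one w) h
  unfold vertexPos at h
  rw [hb] at h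
  have hp := p.block_injective _ h
  rcases u with v | i <;> rcases w with w | j
  · exact congrArg Sum.inl (Subtype.ext hb)
  · exfalso
    simp only [vertexParam] at hp
    split_ifs at hp <;> norm_num at hp
  · exfalso
    simp only [vertexParam] at hp
    split_ifs at hp <;> norm_num at hp
  · congr 1
    simp only [vertexParam, vertexBlock, rep] at hp hb
    split_ifs at hp hb
    · exact hb
    · norm_num at hp
    · norm_num at hp
    · exact p.involutive.injective hb

theorem vertexPos_inr (i : Fin n) : p.vertexPos (Sum.inr i) = boundaryPoint i := by
  simp only [vertexPos, vertexBlock, vertexParam, rep, block]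
  split_ifs with h
  · rw [AffineMap.lineMap_apply_zero]
  · rw [AffineMap.lineMap_apply_one, blockEnd, p.involutive, if_neg]
    intro h'
    exact h h'.le

/-- The interior vertex joined to the boundary vertex `i`. -/
def interiorEnd (i : Fin n) : p.BlockIndex := ⟨p.rep i, p.rep_le i⟩

/-- The black end of the edge at the boundary vertex `i`. -/
def modelBlack (i : Fin n) : p.BlockIndex ⊕ Fin n :=
  if p.IsFree i then Sum.inl (p.interiorEnd i) else Sum.inr i

/-- The white end of the edge at the boundary vertex `i`. -/
def modelWhite (i : Fin n) : p.BlockIndex ⊕ Fin n :=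
  if p.IsFree i then Sum.inr i else Sum.inl (p.interiorEnd i)

theorem vertexBlock_modelBlack (i : Fin n) : p.vertexBlock (p.modelBlack i) = p.rep i := by
  unfold modelBlack
  split_ifs <;> rfl

theorem vertexBlock_modelWhite (i : Fin n) : p.vertexBlock (p.modelWhite i) = p.rep i := by
  unfold modelWhite
  split_ifs <;> rfl

/-- The parametrization of the edge at the boundary vertex `i`. -/
noncomputable def edgeParam (i : Fin n) (t : ℝ) : ℝ :=
  AffineMap.lineMap (p.vertexParam (p.modelBlack i)) (p.vertexParam (p.modelWhite i)) t

/-- An edge fills the open half of its block next to its boundary vertex, so the two edges of a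
chord meet only at the midpoint. -/
theorem edgeParam_mem {i : Fin n} {t : ℝ} (h0 : 0 < t) (h1 : t < 1) :
    (i ≤ p.partner i ∧ 0 < p.edgeParam i t ∧ p.edgeParam i t < 1 / 2) ∨
      (¬ i ≤ p.partner i ∧ 1 / 2 < p.edgeParam i t ∧ p.edgeParam i t < 1) := by
  unfold edgeParam modelBlack modelWhite
  rw [AffineMap.lineMap_apply_ring']
  by_cases hf : p.IsFree i <;> by_cases hi : i ≤ p.partner i <;>
    simp only [hf, hi, if_true, if_false, vertexParam, true_and, not_true, not_false_eq_true,
      false_and, or_false, false_or] <;> constructor <;> linarith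

theorem edgeParam_injective (i : Fin n) : Function.Injective (p.edgeParam i) := by
  apply AffineMap.lineMap_injective
  unfold modelBlack modelWhite
  split_ifs <;> simp only [vertexParam] <;> split_ifs <;> norm_num

/-- The curve along which the edge at the boundary vertex `i` is drawn. -/
noncomputable def modelArc (i : Fin n) :
    Path (p.vertexPos (p.modelBlack i)) (p.vertexPos (p.modelWhite i)) where
  toFun t := p.block (p.rep i) (p.edgeParam i t)
  continuous_toFun := by
    have h1 : Continuous (p.block (p.rep i)) := AffineMap.lineMap_continuous
    have h2 : Continuous (p.edgeParam i) := AffineMap.lineMap_continuous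
    exact h1.comp (h2.comp continuous_subtype_val)
  source' := by
    simp [edgeParam, vertexPos, vertexBlock_modelBlack]
  target' := by
    simp [edgeParam, vertexPos, vertexBlock_modelWhite]

theorem modelArc_apply (i : Fin n) (t : unitInterval) :
    p.modelArc i t = p.block (p.rep i) (p.edgeParam i t) := rfl

/-- The network whose interior vertices are the blocks of the partial pairing, with an edge from
each block to each of its boundary vertices. -/
@[reducible] noncomputable def modelNetwork : DiskNetwork n where
  V := p.BlockIndex
  E := Fin n
  fintypeV := inferInstance
  fintypeE := inferInstance
  -- The edge at an unmatched point is in every dimer configuration. A used black boundary vertex is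
  -- in the boundary subset and a used white one is not, so points of `T` are black and free points
  -- white.
  white := Sum.elim (fun v => !decide (p.IsFree v.1)) fun i => decide (p.IsFree i)
  blackEnd := p.modelBlack
  whiteEnd := p.modelWhite
  blackEnd_color i := by
    unfold modelBlack
    split_ifs with h
    · simpa [interiorEnd, isFree_rep] using h
    · simpa using h
  whiteEnd_color i := by
    unfold modelWhite
    split_ifs with h
    · simpa using h
    · simpa [interiorEnd, isFree_rep] using h
  weight _ := 1
  weight_nonneg _ := zero_le_one
  boundary_degree i := by
    refine ⟨i, ?_, ?_⟩
    · dsimp only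
      unfold modelBlack modelWhite
      split_ifs <;> simp
    · intro e he
      unfold modelBlack modelWhite at he
      split_ifs at he <;> simpa using he
  boundary_not_adjacent e i j := by
    unfold modelBlack modelWhite
    split_ifs <;> simp
  pos := p.vertexPos
  pos_injective := p.vertexPos_injective
  interior_pos v := p.norm_block_lt _ (by norm_num [vertexParam]) (by norm_num [vertexParam])
  angle := boundaryAngle
  angle_strictAnti := boundaryAngle_strictAnti
  angle_lt i j := by
    have h1 := boundaryAngle_nonpos i
    have h2 := neg_one_lt_boundaryAngle j
    linarith [Real.pi_gt_three]
  boundary_pos := p.vertexPos_inr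
  arc := p.modelArc
  arc_injective i s t h := by
    rw [modelArc_apply, modelArc_apply] at h
    exact Subtype.ext (p.edgeParam_injective i (p.block_injective _ h))
  arc_interior i t ht := by
    rw [modelArc_apply]
    rcases p.edgeParam_mem (i := i) (t := t) ht.1 ht.2 with h | h
    · exact p.norm_block_lt _ h.2.1 (by linarith [h.2.2])
    · exact p.norm_block_lt _ (by linarith [h.2.1]) h.2.2
  arc_avoids_vertices i u t ht h := by
    rw [modelArc_apply, vertexPos] at h
    have hp := p.edgeParam_mem (i := i) (t := t) ht.1 ht.2
    have hm : 0 < p.edgeParam i t ∧ p.edgeParam i t ≠ 1 / 2 ∧ p.edgeParam i t < 1 := by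
      rcases hp with ⟨-, h1, h2⟩ | ⟨-, h1, h2⟩
      · exact ⟨h1, h2.ne, by linarith⟩
      · exact ⟨by linarith, h1.ne', h2⟩
    by_cases hb : p.rep i = p.vertexBlock u
    · rw [hb] at h
      have := p.block_injective _ h
      rcases p.vertexParam_cases u with h' | h' | h' <;> rw [h'] at this
      · exact hm.1.ne' this
      · exact hm.2.1 this
      · exact hm.2.2.ne this
    · exact p.block_ne hb (p.rep_le i) (p.vertexBlock_le u) hm.1.le hm.2.2.le
        (p.vertexParam_nonneg u) (p.vertexParam_le_one u) h
  arc_disjoint i j hij s hs t ht h := by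
    rw [modelArc_apply, modelArc_apply] at h
    have h1 := p.edgeParam_mem (i := i) (t := s) hs.1 hs.2
    have h2 := p.edgeParam_mem (i := j) (t := t) ht.1 ht.2
    by_cases hb : p.rep i = p.rep j
    · rw [hb] at h
      have he := p.block_injective _ h
      rcases p.rep_eq_rep_iff.1 hb with rfl | rfl
      · exact hij rfl
      · rw [p.involutive] at h2
        rcases h1 with ⟨a1, a2, a3⟩ | ⟨a1, a2, a3⟩ <;> rcases h2 with ⟨b1, b2, b3⟩ | ⟨b1, b2, b3⟩
        · exact hij (a1.antisymm b1)
        · linarith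
        · linarith
        · exact a1 (le_of_not_ge b1)
    · refine p.block_ne hb (p.rep_le i) (p.rep_le j) ?_ ?_ ?_ ?_ h
      · rcases h1 with h1 | h1 <;> linarith [h1.2.1]
      · rcases h1 with h1 | h1 <;> linarith [h1.2.2]
      · rcases h2 with h2 | h2 <;> linarith [h2.2.1]
      · rcases h2 with h2 | h2 <;> linarith [h2.2.2]

end PartialNCPairing

/-! ### Boundary measurements of the model network. -/

namespace PartialNCPairing

variable {k n : ℕ} (p : PartialNCPairing k n)

theorem modelNetwork_incident_inl {i : p.modelNetwork.E} {v : p.modelNetwork.V} :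
    p.modelNetwork.Incident i (Sum.inl v) ↔ p.rep i = v.1 := by
  change p.modelBlack i = _ ∨ p.modelWhite i = _ ↔ _
  unfold modelBlack modelWhite
  split_ifs <;> simp [interiorEnd, Subtype.ext_iff]

theorem modelNetwork_incident_inr {i : p.modelNetwork.E} {j : Fin n} :
    p.modelNetwork.Incident i (Sum.inr j) ↔ i = j := by
  change p.modelBlack i = _ ∨ p.modelWhite i = _ ↔ _
  unfold modelBlack modelWhite
  split_ifs <;> simp

theorem modelNetwork_white_inr {i : Fin n} :
    p.modelNetwork.white (Sum.inr i) = true ↔ p.IsFree i := by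
  change decide (p.IsFree i) = true ↔ _
  simp

theorem modelNetwork_usesBoundary {P : Finset p.modelNetwork.E} {i : Fin n} :
    p.modelNetwork.UsesBoundary P i ↔ i ∈ P := by
  unfold DiskNetwork.UsesBoundary
  constructor
  · rintro ⟨e, he, h⟩
    rw [modelNetwork_incident_inr] at h
    exact h ▸ he
  · exact fun h => ⟨i, h, p.modelNetwork_incident_inr.2 rfl⟩

/-- A free point contributes a white boundary vertex and a black interior one, which cancel. The
other blocks are white and correspond to the points of `p.lower`. -/
theorem modelNetwork_hasRank : p.modelNetwork.HasRank k := by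
  have h1 : (Finset.univ.filter fun i : Fin n => p.modelNetwork.white (Sum.inr i) = true) =
      Finset.univ.filter p.IsFree :=
    Finset.filter_congr fun i _ => p.modelNetwork_white_inr
  have h2 : (Finset.univ.filter fun v : p.modelNetwork.V =>
      p.modelNetwork.white (Sum.inl v) = true).map (Function.Embedding.subtype _) = p.lower := by
    ext i
    rw [mem_lower, Finset.mem_map]
    simp only [Finset.mem_filter, Finset.mem_univ, true_and, Function.Embedding.subtype_apply,
      Subtype.exists, exists_and_right, exists_eq_right, Sum.elim_inl, Bool.not_eq_true',
      decide_eq_false_iff_not]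
    simp only [IsFree, not_and, not_not]
    constructor
    · rintro ⟨h1, h2⟩
      rcases h1.lt_or_eq with h | h
      · exact Or.inr h
      · exact Or.inl (h2 h.symm)
    · rintro (h | h)
      · exact ⟨(p.disjoint i h).ge, fun _ => h⟩
      · exact ⟨h.le, fun h' => absurd h' h.ne'⟩
  have h3 : (Finset.univ.filter fun v : p.modelNetwork.V =>
      p.modelNetwork.white (Sum.inl v) = false).map (Function.Embedding.subtype _) =
        Finset.univ.filter p.IsFree := by
    ext i
    rw [Finset.mem_map]
    simp only [Finset.mem_filter, Finset.mem_univ, true_and, Function.Embedding.subtype_apply,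
      Subtype.exists, exists_and_right, exists_eq_right, Sum.elim_inl, Bool.not_eq_false',
      decide_eq_true_eq]
    exact ⟨fun h => h.2, fun h => ⟨h.1.ge, h⟩⟩
  have h4 := congrArg Finset.card h2
  have h5 := congrArg Finset.card h3
  rw [Finset.card_map] at h4 h5
  unfold DiskNetwork.HasRank
  rw [h1, h4, h5, card_lower]
  ring

/-- The sets that contain one end of every edge, all points of `T` and no other unmatched point. -/
def IsTransversal (I : Finset (Fin n)) : Prop :=
  (∀ i, p.partner i ≠ i → (i ∈ I ↔ p.partner i ∉ I)) ∧ ∀ i, p.partner i = i → (i ∈ I ↔ i ∈ p.T)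

/-- A configuration picks exactly one edge in every block: either half of a chord, or the only edge
at an unmatched point. -/
theorem modelNetwork_isDimer {P : Finset p.modelNetwork.E} :
    p.modelNetwork.IsDimer P ↔ (∀ i : Fin n, p.partner i ≠ i → (i ∈ P ↔ p.partner i ∉ P)) ∧
      ∀ i : Fin n, p.partner i = i → i ∈ P := by
  have key : p.modelNetwork.IsDimer P ↔
      ∀ v : p.BlockIndex, ∃! i : Fin n, i ∈ P ∧ p.rep i = v.1 := by
    refine forall_congr' fun v => existsUnique_congr fun i => ?_
    rw [modelNetwork_incident_inl]
  rw [key]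
  constructor
  · intro h
    constructor
    · intro i hi
      obtain ⟨j, ⟨hj, hji⟩, hu⟩ := h (p.interiorEnd i)
      constructor
      · intro h1 h2
        exact hi ((hu _ ⟨h2, p.rep_partner i⟩).trans (hu _ ⟨h1, rfl⟩).symm)
      · intro h2
        rcases p.rep_eq_rep_iff.1 hji.symm with rfl | rfl
        · exact hj
        · exact absurd hj h2
    · intro i hi
      obtain ⟨j, ⟨hj, hji⟩, hu⟩ := h (p.interiorEnd i)
      rcases p.rep_eq_rep_iff.1 hji.symm with rfl | rfl
      · exact hj
      · rwa [hi] at hj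
  · rintro ⟨h1, h2⟩ ⟨i, hi⟩
    have hr := p.rep_of_le hi
    by_cases hf : p.partner i = i
    · refine ⟨i, ⟨h2 i hf, hr⟩, ?_⟩
      rintro j ⟨-, hj⟩
      rcases p.rep_eq_rep_iff.1 (hr.trans hj.symm) with h | h
      · exact h
      · rwa [hf] at h
    · by_cases hP : i ∈ P
      · refine ⟨i, ⟨hP, hr⟩, ?_⟩
        rintro j ⟨hjP, hj⟩
        rcases p.rep_eq_rep_iff.1 (hr.trans hj.symm) with h | h
        · exact h
        · rw [h] at hjP
          exact absurd hjP ((h1 i hf).1 hP)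
      · refine ⟨p.partner i, ⟨not_not.1 fun h => hP ((h1 i hf).2 h), (p.rep_partner i).trans hr⟩, ?_⟩
        rintro j ⟨hjP, hj⟩
        rcases p.rep_eq_rep_iff.1 (hr.trans hj.symm) with h | h
        · rw [h] at hjP
          exact absurd hjP hP
        · exact h

theorem mem_boundarySubset_modelNetwork {P : Finset p.modelNetwork.E} {i : Fin n} :
    i ∈ p.modelNetwork.boundarySubset P ↔ (p.IsFree i ↔ i ∉ P) := by
  have h := p.modelNetwork_white_inr (i := i)
  rw [DiskNetwork.mem_boundarySubset, ← Bool.not_eq_true, h, modelNetwork_usesBoundary]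
  tauto

-- All weights are one, so the measurement counts configurations and only their existence matters.
open Classical in
theorem boundaryMeasurement_modelNetwork (I : Finset (Fin n)) :
    p.modelNetwork.boundaryMeasurement I ≠ 0 ↔ p.IsTransversal I := by
  have hw : ∀ P : Finset p.modelNetwork.E, ∏ e ∈ P, p.modelNetwork.weight e = 1 := fun P =>
    Finset.prod_eq_one fun e _ => rfl
  unfold DiskNetwork.boundaryMeasurement
  simp only [hw, Finset.sum_const, nsmul_eq_mul, mul_one, ne_eq, Nat.cast_eq_zero,
    Finset.card_eq_zero, ← Finset.nonempty_iff_ne_empty]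
  constructor
  · rintro ⟨P, hP⟩
    rw [Finset.mem_filter] at hP
    obtain ⟨-, hP, rfl⟩ := hP
    rw [modelNetwork_isDimer] at hP
    constructor
    · intro i hi
      have hi' : p.partner (p.partner i) ≠ p.partner i := fun h => hi (p.involutive.injective h)
      have := hP.1 i hi
      rw [mem_boundarySubset_modelNetwork, mem_boundarySubset_modelNetwork]
      simp only [IsFree, hi, hi', false_and, false_iff, not_not]
      exact this
    · intro i hi
      have := hP.2 i hi
      rw [mem_boundarySubset_modelNetwork]
      simp only [IsFree, hi, this, true_and, not_true, iff_false, not_not]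
  · rintro ⟨h1, h2⟩
    -- The boundary vertex of a free point is white and is kept out of the boundary subset by being
    -- used, so its edge is added to `I`.
    let P : Finset (Fin n) := Finset.univ.filter fun i => p.IsFree i ∨ i ∈ I
    have hmem : ∀ i : Fin n, i ∈ P ↔ p.IsFree i ∨ i ∈ I := fun i => by simp [P]
    refine ⟨P, Finset.mem_filter.2 ⟨Finset.mem_univ _, p.modelNetwork_isDimer.2 ⟨?_, ?_⟩, ?_⟩⟩
    · intro i hi
      have hi' : p.partner (p.partner i) ≠ p.partner i := fun h => hi (p.involutive.injective h)
      rw [hmem, hmem]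
      simp only [IsFree, hi, hi', false_and, false_or]
      exact h1 i hi
    · intro i hi
      rw [hmem, h2 i hi]
      simp only [IsFree, hi, true_and]
      tauto
    · ext i
      rw [mem_boundarySubset_modelNetwork, hmem]
      by_cases hi : p.partner i = i
      · rw [h2 i hi]
        simp only [IsFree, hi, true_and]
        tauto
      · simp only [IsFree, hi, false_and, false_or, false_iff, not_not]

theorem isTransversal_upper : p.IsTransversal p.upper := by
  have h := p.compat_upper_lower
  exact ⟨h.2.1, h.2.2⟩

theorem isTransversal_lower : p.IsTransversal p.lower := by
  have h := p.compat_upper_lower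
  constructor
  · intro i hi
    rw [h.1, h.1, p.involutive]
    have := h.2.1 i hi
    tauto
  · intro i hi
    rw [h.1, hi]
    exact h.2.2 i hi

/-- Transversals of `p` contain `p.T`, so `p.T ⊆ q.T`. If the two sets are equal, the upper and
lower sets of `q` take opposite ends of every chord of `p`; they are then compatible with `p`, and
the triangularity of compatibility applies. -/
theorem eq_or_lt_of_isTransversal (p q : PartialNCPairing k n) (h1 : p.IsTransversal q.upper)
    (h2 : p.IsTransversal q.lower) : q = p ∨ p.T.card < q.T.card ∨
      (p.T.card = q.T.card ∧ ∑ i ∈ q.upper, (i : ℕ) < ∑ i ∈ p.upper, (i : ℕ)) := by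
  have hT : ∀ i, i ∈ q.T ↔ i ∈ q.upper ∧ i ∈ q.lower := q.compat_upper_lower.mem_T_iff
  have hsub : p.T ⊆ q.T := by
    intro i hi
    have hf := p.disjoint i hi
    rw [hT]
    exact ⟨(h1.2 i hf).2 hi, (h2.2 i hf).2 hi⟩
  rcases (Finset.card_le_card hsub).lt_or_eq with hlt | heq
  · exact Or.inr (Or.inl hlt)
  have hTT : p.T = q.T := Finset.eq_of_subset_of_card_le hsub heq.ge
  have hnT : ∀ i, p.partner i ≠ i → ¬ (i ∈ q.upper ∧ i ∈ q.lower) := by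
    intro i hi h
    rw [← hT, ← hTT] at h
    exact hi (p.disjoint i h)
  have hc : p.Compat q.upper q.lower := by
    refine ⟨fun i => ?_, h1.1, h1.2⟩
    by_cases hi : p.partner i = i
    · rw [hi, h1.2 i hi, h2.2 i hi]
    · have hi' : p.partner (p.partner i) ≠ p.partner i := fun h => hi (p.involutive.injective h)
      have a1 := hnT i hi
      have a2 := hnT _ hi'
      have a3 := h1.1 i hi
      have a4 := h2.1 i hi
      tauto
  rcases eq_or_sum_upper_lt_of_compat p q hc with h | h
  · exact Or.inl h
  · exact Or.inr (Or.inr ⟨heq, h⟩)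

end PartialNCPairing

open Classical in
/-- A matrix with nonzero diagonal that is triangular for a ranking of its index set is injective. -/
theorem eq_zero_of_triangular {ι α : Type*} [Fintype ι] [Preorder α] (M : ι → ι → ℂ) (r : ι → α)
    (hd : ∀ q, M q q ≠ 0) (ht : ∀ q p, M q p ≠ 0 → p = q ∨ r q < r p) (v : ι → ℂ)
    (hv : ∀ q, ∑ p, M q p * v p = 0) : v = 0 := by
  have hw : WellFounded fun p q : ι => r q < r p := by
    have : IsTrans ι fun p q => r q < r p := ⟨fun _ _ _ h1 h2 => h2.trans h1⟩
    have : Std.Irrefl fun p q : ι => r q < r p := ⟨fun _ => lt_irrefl _⟩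
    exact Finite.wellFounded_of_trans_of_irrefl _
  funext q
  induction q using hw.induction with
  | _ q ih =>
    have h := hv q
    rw [Finset.sum_eq_single q] at h
    · exact (mul_eq_zero.1 h).resolve_left (hd q)
    · intro p _ hp
      by_cases hM : M q p = 0
      · rw [hM, zero_mul]
      · rw [show v p = 0 from ih p ((ht q p hM).resolve_left hp), mul_zero]
    · exact fun h => absurd (Finset.mem_univ q) h

/-! ### Plücker coordinates and the degree-two part of the coordinate ring. -/

section CoordinateRing

variable {k n : ℕ}

/-- A Plücker coordinate of a vector, zero for subsets that do not have `k` elements. -/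
def coordValue (x : PluckerIndex k n → ℂ) (I : Finset (Fin n)) : ℂ :=
  if h : I.card = k then x ⟨I, h⟩ else 0

/-- A Plücker coordinate, zero for subsets that do not have `k` elements. -/
noncomputable def pluckerCoord (k : ℕ) (I : Finset (Fin n)) : GrCoordinateRing k n :=
  if h : I.card = k then Ideal.Quotient.mk _ (MvPolynomial.X ⟨I, h⟩) else 0

theorem grEval_pluckerCoord {x : PluckerIndex k n → ℂ} (hx : x ∈ pluckerCone k n)
    (I : Finset (Fin n)) : grEval x hx (pluckerCoord k I) = coordValue x I := by
  unfold pluckerCoord coordValue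
  split_ifs with h
  · exact MvPolynomial.aeval_X x _
  · exact map_zero _

theorem ext_of_grEval {f g : GrCoordinateRing k n} (h : ∀ x hx, grEval x hx f = grEval x hx g) :
    f = g := by
  obtain ⟨f, rfl⟩ := Ideal.Quotient.mk_surjective f
  obtain ⟨g, rfl⟩ := Ideal.Quotient.mk_surjective g
  rw [Ideal.Quotient.eq, MvPolynomial.mem_vanishingIdeal_iff]
  intro x hx
  rw [map_sub, sub_eq_zero]
  exact h x hx

theorem mk_X (I : PluckerIndex k n) :
    Ideal.Quotient.mk (MvPolynomial.vanishingIdeal ℂ (pluckerCone k n)) (MvPolynomial.X I) =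
      pluckerCoord k I.1 := by
  rw [pluckerCoord, dif_pos I.2]

theorem grDegreePart_two (k n : ℕ) : grDegreePart k n 2 = Submodule.span ℂ
    (Set.range fun x : PluckerIndex k n × PluckerIndex k n =>
      pluckerCoord k x.1.1 * pluckerCoord k x.2.1) := by
  rw [grDegreePart, ← MvPolynomial.homogeneousSubmodule_one_pow,
    MvPolynomial.homogeneousSubmodule_one_eq_span_X, pow_two, Submodule.span_mul_span,
    Submodule.map_span]
  congr 1
  ext g
  constructor
  · rintro ⟨_, ⟨_, ⟨I, rfl⟩, _, ⟨J, rfl⟩, rfl⟩, rfl⟩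
    refine ⟨(I, J), ?_⟩
    dsimp only
    rw [← mk_X, ← mk_X, ← map_mul]
    rfl
  · rintro ⟨⟨I, J⟩, rfl⟩
    refine ⟨_, ⟨_, ⟨I, rfl⟩, _, ⟨J, rfl⟩, rfl⟩, ?_⟩
    dsimp only
    rw [← mk_X, ← mk_X, ← map_mul]
    rfl

end CoordinateRing

/-! ### Immanants as elements of the coordinate ring. -/

namespace PartialNCPairing

open Classical

variable {k n : ℕ}

/-- The compatibility matrix of the partial non-crossing pairings with the standard monomials. -/
noncomputable def compatMatrix (k n : ℕ) :
    Matrix (PartialNCPairing k n) (PartialNCPairing k n) ℂ :=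
  fun q p => if p.Compat q.upper q.lower then 1 else 0

/-- Ones on the diagonal and triangularity for the sum over `upper`. -/
theorem isUnit_det_compatMatrix : IsUnit (compatMatrix k n).det := by
  rw [isUnit_iff_ne_zero]
  intro h0
  obtain ⟨v, hv, h⟩ := Matrix.exists_mulVec_eq_zero_iff.2 h0
  refine hv (eq_zero_of_triangular (compatMatrix k n) (fun p => ∑ i ∈ p.upper, (i : ℕ)) ?_ ?_ v
    fun q => congrFun h q)
  · intro q
    simp [compatMatrix, q.compat_upper_lower]
  · intro q p hqp
    have hc : p.Compat q.upper q.lower := by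
      by_contra hc
      exact hqp (if_neg hc)
    exact (eq_or_sum_upper_lt_of_compat p q hc).imp_left Eq.symm

theorem inv_mul_compatMatrix : (compatMatrix k n)⁻¹ * compatMatrix k n = 1 :=
  Matrix.nonsing_inv_mul _ isUnit_det_compatMatrix

theorem compatMatrix_mul_inv : compatMatrix k n * (compatMatrix k n)⁻¹ = 1 :=
  Matrix.mul_nonsing_inv _ isUnit_det_compatMatrix

theorem sum_inv_mul_sum_compat (a : PartialNCPairing k n → ℂ) (p : PartialNCPairing k n) :
    ∑ q, (compatMatrix k n)⁻¹ p q * ∑ r, (if r.Compat q.upper q.lower then a r else 0) = a p := by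
  have h : (compatMatrix k n)⁻¹.mulVec ((compatMatrix k n).mulVec a) p = a p := by
    rw [Matrix.mulVec_mulVec, inv_mul_compatMatrix, Matrix.one_mulVec]
  rw [← h]
  refine Finset.sum_congr rfl fun q _ => congrArg _ (Finset.sum_congr rfl fun r _ => ?_)
  simp [compatMatrix]

theorem sum_compat_sum_inv_mul (a : PartialNCPairing k n → ℂ) (q : PartialNCPairing k n) :
    ∑ p, (if p.Compat q.upper q.lower then ∑ r, (compatMatrix k n)⁻¹ p r * a r else 0) = a q := by
  have h : (compatMatrix k n).mulVec ((compatMatrix k n)⁻¹.mulVec a) q = a q := by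
    rw [Matrix.mulVec_mulVec, compatMatrix_mul_inv, Matrix.one_mulVec]
  rw [← h]
  refine Finset.sum_congr rfl fun p _ => ?_
  simp [compatMatrix, Matrix.mulVec, dotProduct]

/-- The monomial of degree two in the Plücker coordinates that corresponds to a partial pairing. -/
noncomputable def standardMonomial (q : PartialNCPairing k n) : GrCoordinateRing k n :=
  pluckerCoord k q.upper * pluckerCoord k q.lower

/-- The Temperley-Lieb immanant as an element of the coordinate ring. -/
noncomputable def immanant (p : PartialNCPairing k n) : GrCoordinateRing k n :=
  ∑ q, (compatMatrix k n)⁻¹ p q • standardMonomial q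

theorem standardMonomial_mem (q : PartialNCPairing k n) :
    standardMonomial q ∈ grDegreePart k n 2 := by
  rw [grDegreePart_two]
  exact Submodule.subset_span ⟨(⟨q.upper, q.card_upper⟩, ⟨q.lower, q.card_lower⟩), rfl⟩

theorem immanant_mem (p : PartialNCPairing k n) : immanant p ∈ grDegreePart k n 2 :=
  Submodule.sum_mem _ fun q _ => Submodule.smul_mem _ _ (standardMonomial_mem q)

theorem grEval_standardMonomial {x : PluckerIndex k n → ℂ} (hx : x ∈ pluckerCone k n)
    (q : PartialNCPairing k n) :
    grEval x hx (standardMonomial q) = coordValue x q.upper * coordValue x q.lower := by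
  rw [standardMonomial, map_mul, grEval_pluckerCoord, grEval_pluckerCoord]

theorem grEval_immanant {x : PluckerIndex k n → ℂ} (hx : x ∈ pluckerCone k n)
    (p : PartialNCPairing k n) : grEval x hx (immanant p) =
      ∑ q, (compatMatrix k n)⁻¹ p q * (coordValue x q.upper * coordValue x q.lower) := by
  rw [immanant, map_sum]
  refine Finset.sum_congr rfl fun q _ => ?_
  rw [map_smul, grEval_standardMonomial, smul_eq_mul]

theorem isExchange_sum_compat (a : PartialNCPairing k n → ℂ) :
    IsExchange k fun I J => ∑ p, if p.Compat I J then a p else 0 := by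
  intro K L hK hL
  have h : ∀ p : PartialNCPairing k n, ∑ i ∈ K \ L, (-1) ^ (posIn K i + posIn L i) *
      (if p.Compat (K.erase i) (insert i L) then a p else 0) = 0 := by
    intro p
    have := congrArg (· * a p) (p.isExchange_compat K L hK hL)
    simp only [zero_mul, Finset.sum_mul] at this
    refine Eq.trans (Finset.sum_congr rfl fun i _ => ?_) this
    split_ifs <;> ring
  simp only [Finset.mul_sum]
  rw [Finset.sum_comm]
  exact Finset.sum_eq_zero fun p _ => h p

/-- At every point of the cone both sides satisfy the exchange relations. They agree on standard
pairs, since the immanants are defined by inverting exactly those equations; hence they agree for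
all `I` and `J`. -/
theorem pluckerCoord_mul {I J : Finset (Fin n)} (hI : I.card = k) (hJ : J.card = k) :
    pluckerCoord k I * pluckerCoord k J =
      ∑ p : PartialNCPairing k n, if p.Compat I J then immanant p else 0 := by
  apply ext_of_grEval
  intro x hx
  rw [map_mul, grEval_pluckerCoord, grEval_pluckerCoord, map_sum, ← sub_eq_zero]
  simp only [apply_ite (grEval x hx), map_zero]
  refine IsExchange.eq_zero_of_isStandardPair (k := k) (h := fun I J =>
    coordValue x I * coordValue x J -
      ∑ p : PartialNCPairing k n, if p.Compat I J then grEval x hx (immanant p) else 0)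
    ?_ ?_ hI hJ
  · intro K L hK hL
    simp only [mul_sub, Finset.sum_sub_distrib]
    rw [isExchange_sum_compat _ K L hK hL, sub_zero]
    exact isExchange_of_mem_pluckerCone hx K L hK hL
  · intro I J hI hJ hs
    obtain ⟨q, rfl, rfl⟩ := exists_upper_lower hI hJ hs
    simp only [grEval_immanant]
    rw [sum_compat_sum_inv_mul (fun q => coordValue x q.upper * coordValue x q.lower) q, sub_self]

theorem grDegreePart_two_eq_span_immanant :
    grDegreePart k n 2 = Submodule.span ℂ (Set.range (immanant (k := k) (n := n))) := by
  apply le_antisymm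
  · rw [grDegreePart_two, Submodule.span_le]
    rintro _ ⟨⟨I, J⟩, rfl⟩
    dsimp only
    rw [SetLike.mem_coe, pluckerCoord_mul I.2 J.2]
    refine Submodule.sum_mem _ fun p _ => ?_
    split_ifs
    · exact Submodule.subset_span ⟨p, rfl⟩
    · exact Submodule.zero_mem _
  · rw [Submodule.span_le]
    rintro _ ⟨p, rfl⟩
    exact immanant_mem p

theorem exists_eq_sum_standardMonomial {g : GrCoordinateRing k n} (hg : g ∈ grDegreePart k n 2) :
    ∃ c : PartialNCPairing k n → ℂ, g = ∑ q, c q • standardMonomial q := by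
  rw [grDegreePart_two_eq_span_immanant, Submodule.mem_span_range_iff_exists_fun] at hg
  obtain ⟨c, rfl⟩ := hg
  refine ⟨fun q => ∑ p, c p * (compatMatrix k n)⁻¹ p q, ?_⟩
  simp only [immanant, Finset.smul_sum, Finset.sum_smul, smul_smul]
  rw [Finset.sum_comm]

/-- A measurement of the model network of `p` is nonzero only at transversals, so
`eq_or_lt_of_isTransversal` makes the matrix of values triangular. -/
theorem eq_zero_of_sum_measurement (c : PartialNCPairing k n → ℂ)
    (h : ∀ p : PartialNCPairing k n, ∑ q : PartialNCPairing k n,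
      c q * ((p.modelNetwork.boundaryMeasurement q.upper : ℂ) *
        (p.modelNetwork.boundaryMeasurement q.lower : ℂ)) = 0) : c = 0 := by
  refine eq_zero_of_triangular (fun p q : PartialNCPairing k n =>
    (p.modelNetwork.boundaryMeasurement q.upper : ℂ) * p.modelNetwork.boundaryMeasurement q.lower)
    -- The order on the second component is reversed because, for equal sizes of `T`, the sum over
    -- `upper` decreases while the rank has to grow.
    (fun p => toLex (p.T.card, OrderDual.toDual (∑ i ∈ p.upper, (i : ℕ)))) ?_ ?_ c ?_
  · intro p
    exact mul_ne_zero
      (Complex.ofReal_ne_zero.2 ((p.boundaryMeasurement_modelNetwork _).2 p.isTransversal_upper))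
      (Complex.ofReal_ne_zero.2 ((p.boundaryMeasurement_modelNetwork _).2 p.isTransversal_lower))
  · intro p q hpq
    have h1 := (p.boundaryMeasurement_modelNetwork _).1
      (Complex.ofReal_ne_zero.1 (left_ne_zero_of_mul hpq))
    have h2 := (p.boundaryMeasurement_modelNetwork _).1
      (Complex.ofReal_ne_zero.1 (right_ne_zero_of_mul hpq))
    refine (eq_or_lt_of_isTransversal p q h1 h2).imp_right fun h => ?_
    rw [Prod.Lex.toLex_lt_toLex]
    exact h
  · intro p
    simpa only [mul_comm (c _)] using h p

end PartialNCPairing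

/-! ### Values of the immanants at networks. -/

namespace DiskNetwork

open Classical

variable {k n : ℕ} {N : DiskNetwork n}

theorem boundaryMeasurement_mul_complex (hk : N.HasRank k) (I J : Finset (Fin n)) :
    (N.boundaryMeasurement I : ℂ) * N.boundaryMeasurement J =
      ∑ p : PartialNCPairing k n, if p.Compat I J then (N.tlImmanant p : ℂ) else 0 := by
  rw [← Complex.ofReal_mul, boundaryMeasurement_mul hk, Complex.ofReal_sum]
  refine Finset.sum_congr rfl fun p _ => ?_
  split_ifs <;> simp

/-- By the product formula the measurements inherit the Plücker relations from the compatibility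
indicators. -/
theorem boundaryVector_mem (hk : N.HasRank k) : N.boundaryVector k ∈ pluckerCone k n := by
  refine mem_pluckerCone_of_isExchange (fun I => (N.boundaryMeasurement I : ℂ)) ?_
  simp only [boundaryMeasurement_mul_complex hk]
  exact PartialNCPairing.isExchange_sum_compat _

theorem coordValue_boundaryVector {I : Finset (Fin n)} (hI : I.card = k) :
    coordValue (N.boundaryVector k) I = N.boundaryMeasurement I := dif_pos hI

theorem grEval_boundaryVector_standardMonomial (hx : N.boundaryVector k ∈ pluckerCone k n)
    (q : PartialNCPairing k n) : grEval _ hx (PartialNCPairing.standardMonomial q) =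
      (N.boundaryMeasurement q.upper : ℂ) * N.boundaryMeasurement q.lower := by
  rw [PartialNCPairing.grEval_standardMonomial, coordValue_boundaryVector q.card_upper,
    coordValue_boundaryVector q.card_lower]

/-- Restricted to standard pairs, the product formula says that `compatMatrix` maps the immanants of
`N` to the values of the standard monomials; apply the inverse matrix. -/
theorem grEval_boundaryVector_immanant (hk : N.HasRank k)
    (hx : N.boundaryVector k ∈ pluckerCone k n) (p : PartialNCPairing k n) :
    grEval _ hx (PartialNCPairing.immanant p) = (N.tlImmanant p : ℂ) := by
  rw [PartialNCPairing.immanant, map_sum]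
  simp only [map_smul, grEval_boundaryVector_standardMonomial, smul_eq_mul,
    boundaryMeasurement_mul_complex hk]
  exact PartialNCPairing.sum_inv_mul_sum_compat (fun r => (N.tlImmanant r : ℂ)) p

end DiskNetwork

/-! ### Uniqueness and the basis. -/

namespace PartialNCPairing

variable {k n : ℕ}

theorem eq_zero_of_grEval_modelNetwork (c : PartialNCPairing k n → ℂ)
    (h : ∀ p : PartialNCPairing k n, grEval _ (DiskNetwork.boundaryVector_mem
      p.modelNetwork_hasRank) (∑ q, c q • standardMonomial q) = 0) : c = 0 := by
  refine eq_zero_of_sum_measurement c fun p => ?_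
  have := h p
  simpa only [map_sum, map_smul, DiskNetwork.grEval_boundaryVector_standardMonomial,
    smul_eq_mul] using this

/-- The difference is a combination of standard monomials, whose coefficients are already determined
by the values at the model networks. -/
theorem eq_of_grEval_boundaryVector {f g : GrCoordinateRing k n} (hf : f ∈ grDegreePart k n 2)
    (hg : g ∈ grDegreePart k n 2) (h : ∀ (N : DiskNetwork n) (hN : N.HasRank k),
      grEval _ (DiskNetwork.boundaryVector_mem hN) f =
        grEval _ (DiskNetwork.boundaryVector_mem hN) g) : f = g := by
  rw [← sub_eq_zero]
  obtain ⟨c, hc⟩ := exists_eq_sum_standardMonomial (Submodule.sub_mem _ hf hg)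
  rw [hc, eq_zero_of_grEval_modelNetwork c]
  · simp
  · intro p
    rw [← hc, map_sub, sub_eq_zero]
    exact h _ p.modelNetwork_hasRank

/-- The model networks show that the standard monomials are independent, and an invertible matrix
carries them to the immanants. -/
theorem linearIndependent_immanant : LinearIndependent ℂ (immanant (k := k) (n := n)) := by
  classical
  rw [Fintype.linearIndependent_iff]
  intro c hc
  have h1 : (∑ q, (∑ p, c p * (compatMatrix k n)⁻¹ p q) • standardMonomial q) = 0 := by
    rw [← hc]
    simp only [immanant, Finset.smul_sum, Finset.sum_smul, smul_smul]
    rw [Finset.sum_comm]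
  have h2 : Matrix.vecMul c (compatMatrix k n)⁻¹ = 0 :=
    eq_zero_of_grEval_modelNetwork _ fun p => by
      rw [show (∑ q, Matrix.vecMul c (compatMatrix k n)⁻¹ q • standardMonomial q) = 0 from h1,
        map_zero]
  have h3 : c = 0 := by
    rw [← Matrix.vecMul_one c, ← inv_mul_compatMatrix, ← Matrix.vecMul_vecMul, h2,
      Matrix.zero_vecMul]
  exact fun p => congrFun h3 p

/-- The basis of Temperley-Lieb immanants. -/
noncomputable def immanantBasis (k n : ℕ) :
    Module.Basis (PartialNCPairing k n) ℂ (grDegreePart k n 2) :=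
  Module.Basis.mk (v := fun p => ⟨immanant p, immanant_mem p⟩)
    (LinearIndependent.of_comp (grDegreePart k n 2).subtype linearIndependent_immanant) (by
      rintro ⟨g, hg⟩ -
      have hg' := hg
      rw [grDegreePart_two_eq_span_immanant, Submodule.mem_span_range_iff_exists_fun] at hg'
      rw [Submodule.mem_span_range_iff_exists_fun]
      obtain ⟨c, hc⟩ := hg'
      refine ⟨c, Subtype.ext ?_⟩
      simpa using hc)

theorem coe_immanantBasis (p : PartialNCPairing k n) :
    (immanantBasis k n p : GrCoordinateRing k n) = immanant p := by
  rw [immanantBasis, Module.Basis.mk_apply]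

end PartialNCPairing

theorem mainTheorem10 (k n : ℕ) :
    (∃ hN : ∀ N : DiskNetwork n, N.HasRank k → N.boundaryVector k ∈ pluckerCone k n,
      ∃ F : Module.Basis (PartialNCPairing k n) ℂ (grDegreePart k n 2),
        ∀ (p : PartialNCPairing k n) (g : grDegreePart k n 2),
          g = F p ↔ ∀ (N : DiskNetwork n) (h : N.HasRank k),
            grEval (N.boundaryVector k) (hN N h) (g : GrCoordinateRing k n) = (N.tlImmanant p : ℂ)) ∧
    Nat.card (PartialNCPairing k n) = Nat.card (TwoColumnTableau k n) := by
  refine ⟨⟨fun N h => DiskNetwork.boundaryVector_mem h, PartialNCPairing.immanantBasis k n,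
    fun p g => ⟨?_, fun h => ?_⟩⟩,
    Nat.card_congr (Equiv.ofBijective _ PartialNCPairing.toTableau_bijective)⟩
  · rintro rfl N h
    rw [PartialNCPairing.coe_immanantBasis]
    exact DiskNetwork.grEval_boundaryVector_immanant h _ p
  · refine Subtype.ext (PartialNCPairing.eq_of_grEval_boundaryVector g.2
      (PartialNCPairing.immanantBasis k n p).2 fun N hN => ?_)
    rw [PartialNCPairing.coe_immanantBasis, DiskNetwork.grEval_boundaryVector_immanant hN]
    exact h N hN
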